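/- **Setting.** Let $G=(V,E)$ be a finite simple graph with $N=|V|$, with one qubit on each vertex, and let $T>0$. Let $H_{\mathrm{base}}(t)=\sum_{x\in E\cup V}H_x(t)$, $t\in[0,T]$, where each $H_x(t)$ is Hermitian, acts only on the vertices of $x$, and is piecewise continuous in $t$. Put $h=\sum_{x}\sup_{t\in[0,T]}\|H_x(t)\|$, and let $U(t)$ be the evolution generated by $H_{\mathrm{base}}$, $i\dot U=H_{\mathrm{base}}U$, $U(0)=I$. For $0<s\le T/4$ set $$\hat H_x(t)=2H_x(2(t-T/4))\,\mathbf 1[t\in[T/4,3T/4]],\qquad \tilde H_x=\phi_s*\hat H_x,$$ $$\phi_s(t)=\frac1{2\nu s}e^{1/((t/s)^2-1)}\mathbf 1[|t|<s],\qquad \nu=\tfrac12\int_{-1}^1e^{1/(x^2-1)}dx\approx0.222 .$$ Let $N_p,N_q\ge1$ be integers with $N_c=N_pN_q$ even, $\delta=T/N_c$, $\tau=T/N_p$, $\sigma>0$. Attach to every vertex a clock with basis $|k\rangle$, $k\in\mathbb Z_{N_c}$, choose $\rho(e)\in e$ for every edge $e$, put $\rho(v)=v$ for vertices, and let $$\overline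 H=\sum_{v}\frac{i(U_v-U_v^\dagger)}{2\delta}+\sum_{k\in\mathbb Z_{N_c}}\sum_{x\in E\cup V}\tilde H_x(k\delta)\otimes(|k\rangle\langle k|)_{\rho(x)},\qquad U_v=\sum_k(|k+1\rangle\langle k|)_v .$$ Let $|\boldsymbol\Phi_{\mathbf 0}\rangle=\bigotimes_{v}|\phi_0\rangle$, where $|\phi_0\rangle\propto\sum_{l}e^{-\delta^2|l|_c^2/\sigma^2}|l\rangle$ is normalized and $|l|_c=\min\{l,N_c-l\}$ for $0\le l<N_c$. Let $$A=\sqrt{1+3\tfrac\delta\sigma},\quad B=\sqrt{1-\Big[\tfrac\sigma Te^{-T^2/(2\sigma^2)}+\tfrac\delta\sigma\Big]},\quad D=1+2^{-3/2}\tfrac\delta\sigma+\big(\tfrac\delta\sigma\big)^2,$$ where the quantity under the root in $B$ is assumed positive. **(1)** For every unit vector $|\psi\rangle$ of the $N$ qubits, $$\big\|(U(T)|\psi\rangle)|\boldsymbol\Phi_{\mathbf 0}\rangle-e^{-i\overline HT}|\psi\rangle|\boldsymbol\Phi_{\mathbf 0}\rangle\big\|\le\frac{3hT^2}{2N_p\nu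 s}+4Th\sqrt{\frac{N\sigma}\tau}\frac{e^{-\tau^2/(4\sigma^2)}}B+4T\sqrt N\frac{AD}B\frac\delta{\sigma^2}+2\sqrt{\frac{N_cT}\sigma}\frac{e^{-(T-6\delta)^2/(4\sigma^2)}}B+\frac32h^2sT .$$ **(2)** For every $c>0$ there is a constant $K>0$ depending only on $c$ such that, whenever $T,h>0$, $hT\ge c$, $0<\varepsilon\le1$ and $hT\sqrt N\ge2\varepsilon$, there are $N_p,N_q,\sigma$ depending only on $N,T,h,\varepsilon$, admissible as above, with $$N_c\le K\,\frac{\sqrt N\,(hT)^6}{\varepsilon^5}\log\frac{hT\sqrt N}{\varepsilon},$$ for which, with $s=\min\{T/4,\ \varepsilon/(3h^2T)\}$, the right-hand side of (1) is at most $\varepsilon$. Consequently, for all $H_{\mathrm{base}}$ of strength $h$ on $N$ qubits, and all $\rho$, $\overline H$ is a sum of Hermitian terms, one for each edge and each vertex, each acting only on the qubits and clocks of that edge or vertex, and the left-hand side of (1) is at most $\varepsilon$ for all unit $|\psi\rangle$. -/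

import Mathlib

open scoped Matrix.Norms.L2Operator

universe u

namespace WWRL

noncomputable section

/-! ### Operators on qubits placed on the vertices of a graph -/

/-- Operators on a tensor product, over the sites `v : V`, of copies of `ℂ^α`, written in the
product basis, which is indexed by the configurations `V → α`.
The norm is the operator norm of the Euclidean norm. -/
abbrev Op (V : Type u) (α : Type) := Matrix (V → α) (V → α) ℂ

/-- `A` acts only on the sites in `S`, that is, `A = B ⊗ 1` with `B` acting on the sites in `S`. -/
def SupportedOn {V : Type u} {α : Type} (S : Set V) (A : Op V α) : Prop :=
  ∃ B : Matrix (S → α) (S → α) ℂ, ∀ c c' : V → α,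
    ((∀ v, v ∉ S → c v = c' v) → A c c' = B (fun v => c v) (fun v => c' v)) ∧
    (¬ (∀ v, v ∉ S → c v = c' v) → A c c' = 0)

/-- The sites on which the term labelled by an edge or a vertex is allowed to act. -/
def sites {V : Type u} (G : SimpleGraph V) : G.edgeSet ⊕ V → Set V
  | Sum.inl e => {v | v ∈ (e : Sym2 V)}
  | Sum.inr v => {v}

/-- A Hermitian operator that is a sum of Hermitian terms, one for each edge and each vertex of the
graph, where each term acts only on its own edge or vertex. -/
def IsLocalHamiltonian {V : Type u} (G : SimpleGraph V) [Fintype V] [Fintype G.edgeSet]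
    {α : Type} (A : Op V α) : Prop :=
  ∃ K : G.edgeSet ⊕ V → Op V α,
    (∀ x, (K x).IsHermitian ∧ SupportedOn (sites G x) (K x)) ∧ A = ∑ x, K x

/-- `f` is piecewise continuous on `[a, b]`: it is continuous off a finite set, and it has
one-sided limits at all points. -/
def PiecewiseContinuousOn {E : Type*} [TopologicalSpace E] (f : ℝ → E) (a b : ℝ) : Prop :=
  (∃ S : Set ℝ, S.Finite ∧ ContinuousOn f (Set.Icc a b \ S)) ∧
  ∀ t ∈ Set.Icc a b,
    (∃ l, Filter.Tendsto f (nhdsWithin t (Set.Icc a b ∩ Set.Iio t)) (nhds l)) ∧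
    (∃ l, Filter.Tendsto f (nhdsWithin t (Set.Icc a b ∩ Set.Ioi t)) (nhds l))

/-- A piecewise-continuous time-dependent Hamiltonian on `[0, T]`, on qubits placed on the vertices
of `G`, with one term for each edge and one term for each vertex. -/
structure TimeDepHamiltonian {V : Type u} [Fintype V] [DecidableEq V]
    (G : SimpleGraph V) (T : ℝ) where
  term : G.edgeSet ⊕ V → ℝ → Op V (Fin 2)
  isHermitian : ∀ x, ∀ t ∈ Set.Icc 0 T, (term x t).IsHermitian
  supported : ∀ x, ∀ t ∈ Set.Icc 0 T, SupportedOn (sites G x) (term x t)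
  piecewiseContinuous : ∀ x, PiecewiseContinuousOn (term x) 0 T

/-- The full Hamiltonian `H(t) = ∑_x H_x(t)`. -/
def TimeDepHamiltonian.total {V : Type u} [Fintype V] [DecidableEq V] {G : SimpleGraph V}
    [Fintype G.edgeSet] {T : ℝ} (H : TimeDepHamiltonian G T) (t : ℝ) : Op V (Fin 2) :=
  ∑ x, H.term x t

/-- `h = ∑_x sup_{t ∈ [0, T]} ‖H_x(t)‖`. -/
def TimeDepHamiltonian.strength {V : Type u} [Fintype V] [DecidableEq V] {G : SimpleGraph V}
    [Fintype G.edgeSet] {T : ℝ} (H : TimeDepHamiltonian G T) : ℝ :=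
  ∑ x, ⨆ t : Set.Icc (0 : ℝ) T, ‖H.term x t‖

/-- `U` is the evolution generated by `H` on `[0, T]`: it is continuous, `U 0 = 1`, and
`i U' = H U` except at finitely many times. -/
def IsEvolution {V : Type u} [Fintype V] [DecidableEq V] (T : ℝ)
    (H U : ℝ → Op V (Fin 2)) : Prop :=
  ContinuousOn U (Set.Icc 0 T) ∧ U 0 = 1 ∧
  ∃ S : Set ℝ, S.Finite ∧ ∀ t ∈ Set.Ioo 0 T \ S,
    HasDerivAt U (-Complex.I • (H t * U t)) t

/-! ### Compression and mollification -/

/-- `ν = (1/2) ∫_{-1}^{1} exp(1 / (x² - 1)) dx ≈ 0.222`, which makes `bump s` have integral one. -/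
def nu : ℝ := (1 / 2) * ∫ x in (-1 : ℝ)..1, Real.exp (1 / (x ^ 2 - 1))

/-- The mollifier `φ_s`. -/
def bump (s t : ℝ) : ℝ :=
  if |t| < s then 1 / (2 * nu * s) * Real.exp (1 / ((t / s) ^ 2 - 1)) else 0

/-- Compression into `[T/4, 3T/4]`: `2 F(2(t - T/4))` there, and zero elsewhere. -/
def compress {E : Type*} [AddCommGroup E] [Module ℝ E] (T : ℝ) (F : ℝ → E) : ℝ → E :=
  (Set.Icc (T / 4) (3 * T / 4)).indicator fun t => (2 : ℝ) • F (2 * (t - T / 4))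

/-- The convolution of `φ_s` with the compression of `F`. -/
def mollify {E : Type*} [NormedAddCommGroup E] [NormedSpace ℝ E] (T s : ℝ) (F : ℝ → E)
    (t : ℝ) : E :=
  ∫ r, bump s (t - r) • compress T F r

/-! ### The localized clock construction with `Nc` clock states per site -/

/-- A site carries a qubit and a clock. -/
abbrev Site (Nc : ℕ) := Fin 2 × ZMod Nc

/-- `A ⊗ 1` for an operator `A` on the qubits. -/
def onQubits {V : Type u} [Fintype V] [DecidableEq V] (Nc : ℕ) (A : Op V (Fin 2)) :
    Op V (Site Nc) :=
  fun c c' => if (∀ v, (c v).2 = (c' v).2)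
    then A (fun v => (c v).1) (fun v => (c' v).1) else 0

/-- `(|k⟩⟨k|)_v` on the clock at `v`. -/
def clockProj {V : Type u} [Fintype V] [DecidableEq V] {Nc : ℕ} (v : V) (k : ZMod Nc) :
    Op V (Site Nc) :=
  Matrix.diagonal fun c => if (c v).2 = k then 1 else 0

/-- `U_v = ∑_k (|k + 1⟩⟨k|)_v` on the clock at `v`. -/
def clockShift {V : Type u} [Fintype V] [DecidableEq V] (Nc : ℕ) (v : V) :
    Op V (Site Nc) :=
  fun c c' => if c = Function.update c' v ((c' v).1, (c' v).2 + 1) then 1 else 0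

/-- `Δ = ∑_v i (U_v - U_v†) / (2δ)`. -/
def momentum (V : Type u) [Fintype V] [DecidableEq V] (Nc : ℕ) (δ : ℝ) : Op V (Site Nc) :=
  ∑ v : V, (Complex.I / (2 * δ)) • (clockShift Nc v - (clockShift Nc v).conjTranspose)

/-- `C(H) = ∑_k ∑_x H_x(kδ) ⊗ (|k⟩⟨k|)_{ρ(x)}`, where `ρ(v) = v` for the single-site terms. -/
def controlled {V : Type u} [Fintype V] [DecidableEq V] {G : SimpleGraph V} [Fintype G.edgeSet]
    (Nc : ℕ) [NeZero Nc] (δ : ℝ) (ρ : G.edgeSet → V)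
    (F : G.edgeSet ⊕ V → ℝ → Op V (Fin 2)) : Op V (Site Nc) :=
  ∑ k : ZMod Nc, ∑ x, onQubits Nc (F x (k.val * δ)) * clockProj (Sum.elim ρ id x) k

/-- The time-independent Hamiltonian built from the mollified compression of `H`, with `Nc` clock
states per site and `δ = T / Nc`. -/
def clockHamiltonian {V : Type u} [Fintype V] [DecidableEq V] {G : SimpleGraph V}
    [Fintype G.edgeSet] {T : ℝ} (H : TimeDepHamiltonian G T) (ρ : G.edgeSet → V)
    (s : ℝ) (Nc : ℕ) [NeZero Nc] : Op V (Site Nc) :=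
  momentum V Nc (T / Nc) + controlled Nc (T / Nc) ρ fun x => mollify T s (H.term x)

/-- `|k|_c = min{k, Nc - k}` on `ℤ/Nc`. -/
def cyclicAbs {Nc : ℕ} (k : ZMod Nc) : ℝ := min (k.val : ℝ) (Nc - k.val)

/-- The unnormalized clock Gaussian centred at `0`. -/
def gaussWeight {Nc : ℕ} (δ σ : ℝ) (l : ZMod Nc) : ℝ :=
  Real.exp (-(δ ^ 2 / σ ^ 2) * cyclicAbs l ^ 2)

/-- The normalized clock Gaussian `φ_0` centred at `0`. -/
def clockState {Nc : ℕ} [NeZero Nc] (δ σ : ℝ) (l : ZMod Nc) : ℝ :=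
  gaussWeight δ σ l / Real.sqrt (∑ m : ZMod Nc, gaussWeight δ σ m ^ 2)

/-- `|ψ⟩ ⊗ |Φ_0⟩`, where every clock is in the state `φ_0`. -/
def withClocks {V : Type u} [Fintype V] (Nc : ℕ) [NeZero Nc] (δ σ : ℝ)
    (ψ : EuclideanSpace ℂ (V → Fin 2)) : EuclideanSpace ℂ (V → Site Nc) :=
  WithLp.toLp 2 fun c => ψ (fun v => (c v).1) * ∏ v, (clockState δ σ (c v).2 : ℂ)

/-- `‖(U ψ) ⊗ Φ_0 - exp(-i A T) (ψ ⊗ Φ_0)‖`. -/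
def clockError {V : Type u} [Fintype V] [DecidableEq V] (Nc : ℕ) [NeZero Nc] (T σ : ℝ)
    (U : Op V (Fin 2)) (A : Op V (Site Nc)) (ψ : EuclideanSpace ℂ (V → Fin 2)) : ℝ :=
  ‖withClocks Nc (T / Nc) σ (Matrix.toEuclideanLin U ψ)
    - Matrix.toEuclideanLin (NormedSpace.exp ((-Complex.I * T) • A))
        (withClocks Nc (T / Nc) σ ψ)‖

/-! ### The error bound -/

/-- `A = √(1 + 3δ/σ)`. -/
def constA (δ σ : ℝ) : ℝ := Real.sqrt (1 + 3 * (δ / σ))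

/-- `B² = 1 - [(σ/T) exp(-T²/(2σ²)) + δ/σ]`. -/
def constBsq (T δ σ : ℝ) : ℝ := 1 - (σ / T * Real.exp (-(T ^ 2 / (2 * σ ^ 2))) + δ / σ)

/-- `B`, meaningful when `B²` is positive. -/
def constB (T δ σ : ℝ) : ℝ := Real.sqrt (constBsq T δ σ)

/-- `D = 1 + 2^{-3/2} δ/σ + (δ/σ)²`. -/
def constD (δ σ : ℝ) : ℝ := 1 + (2 : ℝ) ^ (-(3 / 2) : ℝ) * (δ / σ) + (δ / σ) ^ 2

/-- The total error bound for `N` qubits, with `Nc = Np * Nq`, `δ = T / Nc`, `τ = T / Np`. -/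
def errorBound (N : ℕ) (h T s σ : ℝ) (Np Nq : ℕ) : ℝ :=
  let Nc : ℝ := Np * Nq
  let δ : ℝ := T / Nc
  let τ : ℝ := T / Np
  let A : ℝ := constA δ σ
  let B : ℝ := constB T δ σ
  let D : ℝ := constD δ σ
  3 * h * T ^ 2 / (2 * Np * nu * s)
    + 4 * T * h * Real.sqrt (N * σ / τ) * (Real.exp (-(τ ^ 2 / (4 * σ ^ 2))) / B)
    + 4 * T * Real.sqrt N * (A * D / B) * (δ / σ ^ 2)
    + 2 * Real.sqrt (Nc * T / σ) * (Real.exp (-((T - 6 * δ) ^ 2 / (4 * σ ^ 2))) / B)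
    + 3 / 2 * h ^ 2 * s * T

end

end WWRL

set_option linter.unusedSectionVars false


namespace WWRL

open MeasureTheory Set Filter Topology

/-! ### The mollifier -/

/-! The proof follows an explicit path of product vectors ξ(t) ⊗ p(t)^{⊗N}, with p(t) a moving clock
packet, which solves the Schrödinger equation of the clock Hamiltonian up to a small defect.
Transported back by the unitary `propagator`, the path is almost constant, so the error is at most
the time integral of the norm of the defect (`norm_sub_le_integral_of_deriv_le`). `clock_defect`
splits this defect into three independent parts.

Qubits. The evolution `U` run at the compressed time obeys the compressed Hamiltonian C, not its
mollification M. Let D be the primitive of M - C. Then W = (1 - iD)U obeys the equation of M up to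
the residue (MD - DC)U, and W agrees with the evolution at both ends, where D vanishes
(`IsEvolution.exists_corrected`). The first absolute moment of the mollifier is at most 3s/8, so D
is of size (3/4)hs and the residue integrates to (3/2)h²sT, the last term of the bound.

Clock motion. During one step of length δ the clock state is the normalized linear interpolation
between a Gaussian and its translate (`packet`). Its velocity differs from the discrete momentum
only through second differences of the Gaussian, of l² size (δ/σ)². The kink of the Gaussian at the
antipode of the ring does not spoil this, because the weight there is tiny
(`sum_second_diff_sq_le`). The residue is orthogonal to the packet, so the residues of different
clocks are orthogonal and add in square: this gives √N and the third term.

Control. A clock shows the true time only up to a spread of order σ. The resulting error is the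
Lipschitz constant of the mollified term times the second moment of the packet, or else the trivial
bound, whichever is smaller (`sqrt_control_le`). Narrow packets are paid for by the first term, wide
ones by the second (`control_term_le`).

These estimates need clocks that resolve the Gaussian and do not reach around the ring. The bound
enforces this by itself: the true error never exceeds 2, so the bound may be assumed smaller than 2,
and then its third and fourth terms and the positivity of B² put the parameters in that regime
(`resolved_of_small`).

For the second part, τ/σ is of order √L with L = log(hT√N/ε), N_p of order (hT)³/ε², and N_q of
order √N N_p L/ε. Each of the first four terms is then at most ε/8 and the last at most ε/2
(`exists_parameters`). -/

/-- The profile `exp (1 / (x² - 1))` of the mollifier, extended by zero. -/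
noncomputable def profile (x : ℝ) : ℝ := if |x| < 1 then Real.exp (1 / (x ^ 2 - 1)) else 0

theorem profile_nonneg (x : ℝ) : 0 ≤ profile x := by
  unfold profile; split_ifs <;> positivity

theorem profile_zero : profile 0 = Real.exp (-1) := by
  simp [profile]

theorem profile_anti {x y : ℝ} (h : |x| ≤ |y|) : profile y ≤ profile x := by
  unfold profile
  split_ifs with hy hx hx
  · apply Real.exp_le_exp.mpr
    have h1 : x ^ 2 ≤ y ^ 2 := sq_le_sq.mpr h
    have h2 : y ^ 2 < 1 := by rw [← sq_abs]; nlinarith [abs_nonneg y]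
    exact one_div_le_one_div_of_neg_of_le (by linarith) (by linarith)
  · exact absurd (h.trans_lt hy) hx
  · positivity
  · exact le_rfl

theorem profile_le (x : ℝ) : profile x ≤ Real.exp (-1) := by
  rw [← profile_zero]; exact profile_anti (by simp)

theorem measurable_profile : Measurable profile := by
  unfold profile
  refine Measurable.ite (measurableSet_lt (by fun_prop) (by fun_prop)) ?_ (by fun_prop)
  fun_prop

theorem profile_eq_zero {x : ℝ} (h : 1 ≤ |x|) : profile x = 0 := by
  simp [profile, not_lt.mpr h]

theorem integrable_of_bounded_support {E : Type*} [NormedAddCommGroup E]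
    {f : ℝ → E} (hf : AEStronglyMeasurable f volume) {a b C : ℝ} (hC : ∀ x, ‖f x‖ ≤ C)
    (h0 : ∀ x, x ∉ Icc a b → f x = 0) : Integrable f := by
  have h : IntegrableOn f (Icc a b) :=
    Measure.integrableOn_of_bounded (M := C) (by simp) hf
      (Eventually.of_forall hC)
  exact h.integrable_of_forall_notMem_eq_zero fun x hx => h0 x hx

theorem integrable_profile : Integrable profile := by
  refine integrable_of_bounded_support measurable_profile.aestronglyMeasurable (a := -1) (b := 1)
    (C := Real.exp (-1)) (fun x => ?_) fun x hx => ?_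
  · rw [Real.norm_of_nonneg (profile_nonneg x)]; exact profile_le x
  · apply profile_eq_zero
    by_contra! h
    exact hx (abs_le.mp h.le)

theorem integral_profile : ∫ x, profile x = 2 * nu := by
  have h1 : ∫ x, profile x = ∫ x in Ioo (-1 : ℝ) 1, profile x :=
    (setIntegral_eq_integral_of_forall_compl_eq_zero fun x hx => by
      apply profile_eq_zero
      by_contra! h
      exact hx (abs_lt.mp h)).symm
  rw [h1, nu, intervalIntegral.integral_of_le (by norm_num), integral_Ioc_eq_integral_Ioo,
    setIntegral_congr_fun measurableSet_Ioo (g := fun x => Real.exp (1 / (x ^ 2 - 1)))]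
  · ring
  · intro x hx
    simp [profile, abs_lt.mpr hx]

theorem nu_pos : 0 < nu := by
  have h : 0 < ∫ x, profile x := by
    rw [integral_pos_iff_support_of_nonneg profile_nonneg integrable_profile]
    have : Ioo (-1 : ℝ) 1 ⊆ Function.support profile := by
      intro x hx
      simp [profile, abs_lt.mpr hx]
    refine lt_of_lt_of_le ?_ (measure_mono this)
    simp
  rw [integral_profile] at h
  linarith

theorem integrable_abs_mul_profile : Integrable fun x => |x| * profile x := by
  refine integrable_of_bounded_support
    (measurable_id.abs.mul measurable_profile).aestronglyMeasurable (a := -1) (b := 1)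
    (C := Real.exp (-1)) (fun x => ?_) fun x hx => ?_
  · rw [Real.norm_of_nonneg (mul_nonneg (abs_nonneg _) (profile_nonneg x))]
    rcases lt_or_ge |x| 1 with h | h
    · nlinarith [profile_le x, profile_nonneg x, abs_nonneg x]
    · rw [profile_eq_zero h, mul_zero]; positivity
  · have : 1 ≤ |x| := by
      by_contra! h
      exact hx (abs_le.mp h.le)
    simp [profile_eq_zero this]

/-- The source of the constant 3/8: it is the mean of |x| under the weight 1 - x² on [-1, 1], the
weight with which the profile is compared. -/
theorem quadratic_moment : ∫ x in (-1 : ℝ)..1, (3 / 8 - |x|) * (1 - x ^ 2) = 0 := by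
  have hc : Continuous fun x : ℝ => (3 / 8 - |x|) * (1 - x ^ 2) := by fun_prop
  rw [← intervalIntegral.integral_add_adjacent_intervals (b := 0) (hc.intervalIntegrable _ _)
    (hc.intervalIntegrable _ _)]
  have h1 : ∫ x in (-1 : ℝ)..0, (3 / 8 - |x|) * (1 - x ^ 2)
      = ∫ x in (-1 : ℝ)..0, (3 / 8 + x - 3 / 8 * x ^ 2 - x ^ 3) := by
    apply intervalIntegral.integral_congr
    intro x hx
    rw [uIcc_of_le (by norm_num)] at hx
    simp only [abs_of_nonpos hx.2]; ring
  have h2 : ∫ x in (0 : ℝ)..1, (3 / 8 - |x|) * (1 - x ^ 2)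
      = ∫ x in (0 : ℝ)..1, (3 / 8 - x - 3 / 8 * x ^ 2 + x ^ 3) := by
    apply intervalIntegral.integral_congr
    intro x hx
    rw [uIcc_of_le (by norm_num)] at hx
    simp only [abs_of_nonneg hx.1]; ring
  rw [h1, h2]
  have ii : ∀ (f : ℝ → ℝ), Continuous f → ∀ a b : ℝ, IntervalIntegrable f volume a b :=
    fun f hf a b => hf.intervalIntegrable a b
  rw [intervalIntegral.integral_sub, intervalIntegral.integral_sub, intervalIntegral.integral_add,
    intervalIntegral.integral_add, intervalIntegral.integral_sub, intervalIntegral.integral_sub]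
  · simp only [intervalIntegral.integral_const_mul, integral_pow, integral_id,
      intervalIntegral.integral_const]
    norm_num
  all_goals exact ii _ (by fun_prop) _ _

/-- `exp (-1/u) / u` is increasing on `(0, 1]`. -/
theorem exp_neg_inv_div_mono {u v : ℝ} (hu : 0 < u) (huv : u ≤ v) (hv : v ≤ 1) :
    Real.exp (-(1 / u)) / u ≤ Real.exp (-(1 / v)) / v := by
  have hv0 : 0 < v := hu.trans_le huv
  rw [div_le_div_iff₀ hu hv0]
  -- By exp z ≥ 1 + z it suffices that (v - u)/v + u ≥ v, which is where v ≤ 1 enters.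
  have h1 : v / u ≤ Real.exp (1 / u - 1 / v) := by
    refine le_trans ?_ (Real.add_one_le_exp _)
    have : 1 / u - 1 / v = (v - u) / (u * v) := by field_simp
    have h3 : v - u ≤ (v - u) / v := le_div_self (by linarith) hv0 hv
    have h4 : ((v - u) / (u * v) + 1) * u = (v - u) / v + u := by field_simp
    rw [this, div_le_iff₀ hu, h4]
    linarith
  have h2 : Real.exp (-(1 / v)) = Real.exp (-(1 / u)) * Real.exp (1 / u - 1 / v) := by
    rw [← Real.exp_add]; ring_nf
  rw [h2]
  have h3 := (div_le_iff₀ hu).mp h1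
  have := Real.exp_pos (-(1 / u))
  nlinarith

/-- A Chebyshev comparison. The ratio of the profile to 1 - x² decreases in |x|, so freezing it at
its value `g0` at |x| = 3/8 can only lower (3/8 - |x|) times the profile, whatever the sign of 3/8 -
|x|. The frozen version integrates to zero by `quadratic_moment`. -/
theorem integral_abs_mul_profile_le : ∫ x, |x| * profile x ≤ 3 / 8 * (2 * nu) := by
  set g0 : ℝ := Real.exp (-(1 / (1 - (3 / 8 : ℝ) ^ 2))) / (1 - (3 / 8 : ℝ) ^ 2) with hg0
  have key : ∀ x : ℝ, (Ioc (-1 : ℝ) 1).indicator (fun x => g0 * ((3 / 8 - |x|) * (1 - x ^ 2))) x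
      ≤ 3 / 8 * profile x - |x| * profile x := by
    intro x
    rcases lt_or_ge |x| 1 with h | h
    · have hx := abs_lt.mp h
      rw [indicator_of_mem (show x ∈ Ioc (-1 : ℝ) 1 from ⟨hx.1, hx.2.le⟩), ← sq_abs x]
      set y := |x| with hy
      have hy0 : 0 ≤ y := abs_nonneg x
      have hu : 0 < 1 - y ^ 2 := by nlinarith
      have hp : profile x = Real.exp (-(1 / (1 - y ^ 2))) / (1 - y ^ 2) * (1 - y ^ 2) := by
        rw [div_mul_cancel₀ _ hu.ne', profile, if_pos h, ← sq_abs x, ← hy, ← neg_sub,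
          one_div_neg_eq_neg_one_div]
      rw [hp]
      rcases le_total y (3 / 8) with h38 | h38
      · have := exp_neg_inv_div_mono (u := 1 - (3 / 8 : ℝ) ^ 2) (v := 1 - y ^ 2) (by norm_num)
          (by nlinarith) (by nlinarith)
        rw [← hg0] at this
        have h3 : 0 ≤ (3 / 8 - y) * (1 - y ^ 2) := mul_nonneg (by linarith) hu.le
        nlinarith
      · have := exp_neg_inv_div_mono (u := 1 - y ^ 2) (v := 1 - (3 / 8 : ℝ) ^ 2) hu
          (by nlinarith) (by norm_num)
        rw [← hg0] at this
        have h3 : 0 ≤ (y - 3 / 8) * (1 - y ^ 2) := mul_nonneg (by linarith) hu.le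
        nlinarith
    · rw [profile_eq_zero h]
      by_cases hx : x ∈ Ioc (-1 : ℝ) 1
      · have : x = 1 := by
          rcases le_abs.mp h with h' | h'
          · exact le_antisymm hx.2 h'
          · linarith [hx.1]
        rw [indicator_of_mem hx, this]; simp
      · rw [indicator_of_notMem hx]; simp
  have hint : Integrable ((Ioc (-1 : ℝ) 1).indicator
      (fun x => g0 * ((3 / 8 - |x|) * (1 - x ^ 2)))) := by
    rw [integrable_indicator_iff measurableSet_Ioc]
    have hc : Continuous fun x : ℝ => g0 * ((3 / 8 - |x|) * (1 - x ^ 2)) := by fun_prop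
    exact (hc.integrableOn_Icc).mono_set Ioc_subset_Icc_self
  have h := integral_mono hint ((integrable_profile.const_mul (3 / 8)).sub
    integrable_abs_mul_profile) key
  rw [integral_indicator measurableSet_Ioc, integral_const_mul,
    ← intervalIntegral.integral_of_le (by norm_num), quadratic_moment] at h
  have h' := integral_sub (integrable_profile.const_mul (3 / 8)) integrable_abs_mul_profile
  rw [integral_const_mul, integral_profile] at h'
  have h'' : (0 : ℝ) ≤ 3 / 8 * (2 * nu) - ∫ x, |x| * profile x := by
    rw [← h']; simpa using h
  linarith

theorem bump_eq {s : ℝ} (hs : 0 < s) (t : ℝ) : bump s t = 1 / (2 * nu * s) * profile (t / s) := by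
  have h : |t / s| < 1 ↔ |t| < s := by rw [abs_div, abs_of_pos hs, div_lt_one hs]
  simp only [bump, profile, h]
  split_ifs <;> simp

theorem bump_nonneg {s : ℝ} (hs : 0 < s) (t : ℝ) : 0 ≤ bump s t := by
  rw [bump_eq hs]
  have := nu_pos
  have := profile_nonneg (t / s)
  positivity

theorem bump_eq_zero {s t : ℝ} (h : s ≤ |t|) : bump s t = 0 := by
  simp [bump, not_lt.mpr h]

theorem bump_anti {s x y : ℝ} (hs : 0 < s) (h : |x| ≤ |y|) : bump s y ≤ bump s x := by
  rw [bump_eq hs, bump_eq hs]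
  have := nu_pos
  refine mul_le_mul_of_nonneg_left (profile_anti ?_) (by positivity)
  rw [abs_div, abs_div]; gcongr

theorem bump_zero {s : ℝ} (hs : 0 < s) : bump s 0 = Real.exp (-1) / (2 * nu * s) := by
  rw [bump_eq hs, zero_div, profile_zero]; ring

theorem bump_le {s : ℝ} (hs : 0 < s) (t : ℝ) : bump s t ≤ bump s 0 :=
  bump_anti hs (by simp)

theorem measurable_bump {s : ℝ} (hs : 0 < s) : Measurable (bump s) := by
  rw [show bump s = fun t => 1 / (2 * nu * s) * profile (t / s) from funext (bump_eq hs)]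
  exact (measurable_profile.comp (measurable_id.div_const s)).const_mul _

theorem integrable_bump {s : ℝ} (hs : 0 < s) : Integrable (bump s) := by
  rw [show bump s = fun t => 1 / (2 * nu * s) * profile (t / s) from funext (bump_eq hs)]
  exact (integrable_profile.comp_div hs.ne').const_mul _

theorem integral_bump {s : ℝ} (hs : 0 < s) : ∫ t, bump s t = 1 := by
  simp_rw [bump_eq hs]
  have := nu_pos
  rw [integral_const_mul, Measure.integral_comp_div profile s, integral_profile, abs_of_pos hs,
    smul_eq_mul]
  field_simp

theorem abs_mul_bump_eq {s : ℝ} (hs : 0 < s) (t : ℝ) :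
    |t| * bump s t = 1 / (2 * nu) * (|t / s| * profile (t / s)) := by
  have := nu_pos
  rw [bump_eq hs, abs_div, abs_of_pos hs]; field_simp

theorem integrable_abs_mul_bump {s : ℝ} (hs : 0 < s) : Integrable fun t => |t| * bump s t := by
  simp_rw [abs_mul_bump_eq hs]
  exact (integrable_abs_mul_profile.comp_div hs.ne').const_mul _

theorem integral_abs_mul_bump_le {s : ℝ} (hs : 0 < s) : ∫ t, |t| * bump s t ≤ 3 / 8 * s := by
  simp_rw [abs_mul_bump_eq hs]
  have h := nu_pos
  rw [integral_const_mul, Measure.integral_comp_div (fun x => |x| * profile x) s, abs_of_pos hs,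
    smul_eq_mul]
  calc 1 / (2 * nu) * (s * ∫ x, |x| * profile x)
      ≤ 1 / (2 * nu) * (s * (3 / 8 * (2 * nu))) := by
        gcongr; exact integral_abs_mul_profile_le
    _ = 3 / 8 * s := by field_simp

/-- The total variation bound for translates of the mollifier. -/
theorem integral_abs_bump_sub_le {s : ℝ} (hs : 0 < s) {a : ℝ} (ha : 0 ≤ a) :
    ∫ u, |bump s u - bump s (u - a)| ≤ 2 * a * bump s 0 := by
  have hi := integrable_bump hs
  have hi' : Integrable fun u => bump s (u - a) := hi.comp_sub_right a
  have hd : Integrable fun u => bump s u - bump s (u - a) := hi.sub hi'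
  -- The mollifier is even and decreasing in |u|, so the difference changes sign only at a/2. Its
  -- total integral is zero, hence its L¹ norm is twice the integral over the left half-line, and
  -- that is the mass of [-a/2, a/2].
  have h1 : ∀ u ∈ Iic (a / 2), |bump s u - bump s (u - a)| = bump s u - bump s (u - a) := by
    intro u hu
    apply abs_of_nonneg
    have : |u| ≤ |u - a| := by
      rw [mem_Iic] at hu
      apply sq_le_sq.mp
      nlinarith
    linarith [bump_anti hs this]
  have h2 : ∀ u ∈ Ioi (a / 2), |bump s u - bump s (u - a)| = -(bump s u - bump s (u - a)) := by
    intro u hu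
    apply abs_of_nonpos
    have : |u - a| ≤ |u| := by
      rw [mem_Ioi] at hu
      apply sq_le_sq.mp
      nlinarith
    linarith [bump_anti hs this]
  have e1 := intervalIntegral.integral_Iic_add_Ioi (b := a / 2) hd.abs.integrableOn
    hd.abs.integrableOn
  rw [setIntegral_congr_fun measurableSet_Iic h1, setIntegral_congr_fun measurableSet_Ioi h2,
    integral_neg] at e1
  have e2 := intervalIntegral.integral_Iic_add_Ioi (b := a / 2) hd.integrableOn
    hd.integrableOn
  have e3 : ∫ u, (bump s u - bump s (u - a)) = 0 := by
    rw [integral_sub hi hi', integral_sub_right_eq_self (bump s) a, sub_self]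
  have e4 : ∫ u in Iic (a / 2), (bump s u - bump s (u - a))
      = ∫ u in (-(a / 2))..(a / 2), bump s u := by
    rw [integral_sub hi.integrableOn hi'.integrableOn]
    have : ∫ u in Iic (a / 2), bump s (u - a) = ∫ u in Iic (-(a / 2)), bump s u := by
      rw [← integral_indicator measurableSet_Iic, ← integral_indicator measurableSet_Iic,

        ← integral_sub_right_eq_self ((Iic (-(a / 2))).indicator fun u => bump s u) a]
      congr 1
      ext u
      have : u ≤ a / 2 ↔ u - a ≤ -(a / 2) := by constructor <;> intro h <;> linarith
      simp only [indicator, mem_Iic, this]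
    rw [this, intervalIntegral.integral_Iic_sub_Iic hi.integrableOn hi.integrableOn]
  have e5 : ∫ u in (-(a / 2))..(a / 2), bump s u ≤ ∫ u in (-(a / 2))..(a / 2), bump s 0 :=
    intervalIntegral.integral_mono (by linarith) hi.intervalIntegrable
      (by simp) fun u => bump_le hs u
  rw [intervalIntegral.integral_const, smul_eq_mul] at e5
  rw [← e1]
  have e5' : ∫ u in Ioi (a / 2), (bump s u - bump s (u - a)) =
    -∫ u in Iic (a / 2), (bump s u - bump s (u - a)) := by linarith
  rw [e5', e4]
  linarith

end WWRL

namespace WWRL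

open MeasureTheory Set Filter Topology

/-! ### Piecewise continuous functions, compression and mollification -/

/-- The one-sided limits bound the function on both sides of each point, its value bounds it at the
point itself, and compactness does the rest. -/
theorem PiecewiseContinuousOn.exists_bound {E : Type*} [NormedAddCommGroup E] {f : ℝ → E}
    {a b : ℝ} (hf : PiecewiseContinuousOn f a b) : ∃ C, ∀ t ∈ Icc a b, ‖f t‖ ≤ C := by
  refine (isCompact_Icc (a := a) (b := b)).induction_on (p := fun s => ∃ C, ∀ t ∈ s, ‖f t‖ ≤ C)
    ⟨0, by simp⟩ (fun s t hst ⟨C, h⟩ => ⟨C, fun x hx => h x (hst hx)⟩) ?_ ?_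
  · rintro s t ⟨C, hC⟩ ⟨D, hD⟩
    refine ⟨max C D, ?_⟩
    rintro x (hx | hx)
    · exact (hC x hx).trans (le_max_left _ _)
    · exact (hD x hx).trans (le_max_right _ _)
  · intro t ht
    obtain ⟨⟨l, hl⟩, ⟨m, hm⟩⟩ := hf.2 t ht
    have h1 := hl.norm.eventually (gt_mem_nhds (lt_add_one ‖l‖))
    have h2 := hm.norm.eventually (gt_mem_nhds (lt_add_one ‖m‖))
    refine ⟨{x | ‖f x‖ ≤ max (max (‖l‖ + 1) (‖m‖ + 1)) ‖f t‖}, ?_,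
      _, fun x hx => hx⟩
    rw [eventually_nhdsWithin_iff] at h1 h2
    rw [mem_nhdsWithin_iff_eventually]
    filter_upwards [h1, h2] with x hx1 hx2 hx
    rcases lt_trichotomy x t with h | h | h
    · exact (hx1 ⟨hx, h⟩).le.trans ((le_max_left _ _).trans (le_max_left _ _))
    · rw [h]; exact le_max_right _ _
    · exact (hx2 ⟨hx, h⟩).le.trans ((le_max_right _ _).trans (le_max_left _ _))

theorem PiecewiseContinuousOn.norm_le_iSup {E : Type*} [NormedAddCommGroup E] {f : ℝ → E}
    {a b : ℝ} (hf : PiecewiseContinuousOn f a b) {t : ℝ} (ht : t ∈ Icc a b) :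
    ‖f t‖ ≤ ⨆ t : Icc a b, ‖f t‖ := by
  obtain ⟨C, hC⟩ := hf.exists_bound
  exact le_ciSup (f := fun t : Icc a b => ‖f t‖) ⟨C, by rintro _ ⟨x, rfl⟩; exact hC x x.2⟩ ⟨t, ht⟩

theorem finite_preimage_affine {S : Set ℝ} (hS : S.Finite) (T : ℝ) :
    ((fun t : ℝ => 2 * (t - T / 4)) ⁻¹' S).Finite :=
  hS.preimage (fun x _ y _ h => by linarith)

section compress

variable {E : Type*} [NormedAddCommGroup E] [NormedSpace ℝ E] {T : ℝ} {F : ℝ → E}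

theorem compress_of_mem {t : ℝ} (ht : t ∈ Icc (T / 4) (3 * T / 4)) :
    compress T F t = (2 : ℝ) • F (2 * (t - T / 4)) := indicator_of_mem ht _

theorem compress_of_notMem {t : ℝ} (ht : t ∉ Icc (T / 4) (3 * T / 4)) :
    compress T F t = 0 := indicator_of_notMem ht _

theorem mem_Icc_of_compress {t : ℝ} (ht : t ∈ Icc (T / 4) (3 * T / 4)) :
    2 * (t - T / 4) ∈ Icc 0 T := by
  constructor <;> linarith [ht.1, ht.2]

theorem norm_compress_le_mul {C : ℝ} (hF : ∀ t ∈ Icc 0 T, ‖F t‖ ≤ C) (t : ℝ) :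
    ‖compress T F t‖ ≤ C * compress T (fun _ => (1 : ℝ)) t := by
  by_cases ht : t ∈ Icc (T / 4) (3 * T / 4)
  · rw [compress_of_mem ht, compress_of_mem ht, norm_smul, smul_eq_mul, Real.norm_ofNat]
    linarith [hF _ (mem_Icc_of_compress ht)]
  · rw [compress_of_notMem ht, compress_of_notMem ht]; simp

theorem norm_compress_le {C : ℝ} (hT : 0 ≤ T) (hF : ∀ t ∈ Icc 0 T, ‖F t‖ ≤ C) (t : ℝ) :
    ‖compress T F t‖ ≤ 2 * C := by
  have hC : 0 ≤ C := (norm_nonneg _).trans (hF 0 ⟨le_rfl, hT⟩)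
  refine (norm_compress_le_mul hF t).trans ?_
  by_cases ht : t ∈ Icc (T / 4) (3 * T / 4)
  · rw [compress_of_mem ht, smul_eq_mul]; linarith
  · rw [compress_of_notMem ht]; linarith

theorem exists_finite_continuousAt_compress (hF : PiecewiseContinuousOn F 0 T) :
    ∃ S : Set ℝ, S.Finite ∧ ∀ t, t ∉ S → ContinuousAt (compress T F) t := by
  obtain ⟨⟨S, hS, hc⟩, -⟩ := hF
  refine ⟨{T / 4, 3 * T / 4} ∪ (fun t : ℝ => 2 * (t - T / 4)) ⁻¹' S,
    (by simp : ({T / 4, 3 * T / 4} : Set ℝ).Finite).union (finite_preimage_affine hS T),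
    fun t ht => ?_⟩
  simp only [mem_union, mem_insert_iff, mem_singleton_iff, mem_preimage, not_or] at ht
  obtain ⟨⟨h1, h2⟩, h3⟩ := ht
  by_cases hm : t ∈ Icc (T / 4) (3 * T / 4)
  · have hlt1 : T / 4 < t := lt_of_le_of_ne hm.1 (Ne.symm h1)
    have hlt2 : t < 3 * T / 4 := lt_of_le_of_ne hm.2 h2
    have hev : compress T F =ᶠ[𝓝 t] fun t => (2 : ℝ) • F (2 * (t - T / 4)) := by
      filter_upwards [Icc_mem_nhds hlt1 hlt2] with x hx using compress_of_mem hx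
    rw [continuousAt_congr hev]
    have hFc : ContinuousAt F (2 * (t - T / 4)) := by
      refine (hc.mono ?_ : ContinuousOn F (Ioo 0 T \ S)).continuousAt ?_
      · exact sdiff_subset_sdiff_left Ioo_subset_Icc_self
      · refine (isOpen_Ioo.sdiff hS.isClosed).mem_nhds ⟨⟨?_, ?_⟩, h3⟩ <;> linarith
    exact (ContinuousAt.comp (f := fun t : ℝ => 2 * (t - T / 4)) hFc (by fun_prop)).const_smul _
  · have hev : compress T F =ᶠ[𝓝 t] fun _ => 0 := by
      filter_upwards [isClosed_Icc.isOpen_compl.mem_nhds hm] with x hx using compress_of_notMem hx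
    rw [continuousAt_congr hev]
    exact continuousAt_const

theorem aestronglyMeasurable_of_continuousAt {g : ℝ → E} {S : Set ℝ} (hS : S.Finite)
    (hg : ∀ t, t ∉ S → ContinuousAt g t) : AEStronglyMeasurable g volume := by
  have h1 : ContinuousOn g Sᶜ := fun t ht => (hg t ht).continuousWithinAt
  have h2 := h1.aestronglyMeasurable (μ := volume) hS.measurableSet.compl
  rwa [Measure.restrict_eq_self_of_ae_mem] at h2
  exact hS.countable.ae_notMem volume

theorem mollify_eq (T s : ℝ) (F : ℝ → E) (t : ℝ) :
    mollify T s F t = ∫ r, bump s r • compress T F (t - r) := by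
  rw [mollify, ← integral_sub_left_eq_self _ volume t]
  simp

theorem piecewiseContinuousOn_const (c : E) (a b : ℝ) :
    PiecewiseContinuousOn (fun _ : ℝ => c) a b :=
  ⟨⟨∅, finite_empty, continuousOn_const⟩, fun _ _ =>
    ⟨⟨c, tendsto_const_nhds⟩, ⟨c, tendsto_const_nhds⟩⟩⟩

variable [CompleteSpace E]

theorem integrable_compress (hT : 0 ≤ T) (hF : PiecewiseContinuousOn F 0 T) :
    Integrable (compress T F) := by
  obtain ⟨C, hC⟩ := hF.exists_bound
  obtain ⟨S, hS, hc⟩ := exists_finite_continuousAt_compress hF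
  exact integrable_of_bounded_support (aestronglyMeasurable_of_continuousAt hS hc)
    (norm_compress_le hT hC) fun x hx => compress_of_notMem hx

theorem integrable_bump_smul {s : ℝ} (hs : 0 < s) {g : ℝ → E}
    (hg : AEStronglyMeasurable g volume) {C : ℝ} (hC : ∀ t, ‖g t‖ ≤ C) :
    Integrable fun r => bump s r • g r := by
  refine ((integrable_bump hs).mul_const C).mono'
    ((measurable_bump hs).aestronglyMeasurable.smul hg) (Eventually.of_forall fun r => ?_)
  rw [norm_smul, Real.norm_of_nonneg (bump_nonneg hs r)]
  exact mul_le_mul_of_nonneg_left (hC r) (bump_nonneg hs r)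

theorem integrable_mollify {s : ℝ} (hT : 0 ≤ T) (hs : 0 < s) (hF : PiecewiseContinuousOn F 0 T)
    (t : ℝ) : Integrable fun r => bump s r • compress T F (t - r) := by
  obtain ⟨C, hC⟩ := hF.exists_bound
  exact integrable_bump_smul hs ((integrable_compress hT hF).comp_sub_left t).aestronglyMeasurable
    (fun r => norm_compress_le hT hC _)

theorem integrable_mollify' {s : ℝ} (hT : 0 ≤ T) (hs : 0 < s) (hF : PiecewiseContinuousOn F 0 T)
    (t : ℝ) : Integrable fun r => bump s (t - r) • compress T F r := by
  simpa using (integrable_mollify hT hs hF t).comp_sub_left t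

theorem norm_mollify_le {s : ℝ} (hT : 0 ≤ T) (hs : 0 < s) {C : ℝ}
    (hF : ∀ t ∈ Icc 0 T, ‖F t‖ ≤ C) (t : ℝ) :
    ‖mollify T s F t‖ ≤ C * mollify T s (fun _ => (1 : ℝ)) t := by
  rw [mollify_eq, mollify_eq, ← integral_const_mul]
  refine norm_integral_le_of_norm_le
    ((integrable_mollify hT hs (piecewiseContinuousOn_const (1 : ℝ) 0 T) t).const_mul C)
    (Eventually.of_forall fun r => ?_)
  rw [norm_smul, Real.norm_of_nonneg (bump_nonneg hs r), smul_eq_mul]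
  have := mul_le_mul_of_nonneg_left (norm_compress_le_mul hF (t - r)) (bump_nonneg hs r)
  linarith

theorem mollify_one_le {s : ℝ} (hT : 0 ≤ T) (hs : 0 < s) (t : ℝ) :
    mollify T s (fun _ => (1 : ℝ)) t ≤ 2 := by
  rw [mollify_eq]
  have h1 : ∫ r, bump s r * 2 = 2 := by rw [integral_mul_const, integral_bump hs, one_mul]
  rw [← h1]
  refine integral_mono (integrable_mollify hT hs (piecewiseContinuousOn_const (1 : ℝ) 0 T) t)
    ((integrable_bump hs).mul_const 2) fun r => ?_
  simp only [smul_eq_mul]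
  refine mul_le_mul_of_nonneg_left ?_ (bump_nonneg hs r)
  refine (le_abs_self _).trans ?_
  simpa using norm_compress_le (F := fun _ => (1 : ℝ)) (C := 1) hT (by simp) (t - r)

/-- All smoothness comes from the mollifier: the compression is bounded by 2C, and
`integral_abs_bump_sub_le` gives the L¹ modulus of translation. -/
theorem norm_mollify_sub_le {s : ℝ} (hT : 0 ≤ T) (hs : 0 < s) (hF : PiecewiseContinuousOn F 0 T)
    {C : ℝ} (hC : ∀ t ∈ Icc 0 T, ‖F t‖ ≤ C) (t t' : ℝ) :
    ‖mollify T s F t - mollify T s F t'‖ ≤ 4 * C * bump s 0 * |t - t'| := by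
  wlog h : t' ≤ t generalizing t t'
  · rw [norm_sub_rev, abs_sub_comm]
    exact this t' t (le_of_not_ge h)
  rw [mollify, mollify, ← integral_sub (integrable_mollify' hT hs hF t)
    (integrable_mollify' hT hs hF t')]
  have hi : Integrable fun u => |bump s u - bump s (u - (t - t'))| :=
    ((integrable_bump hs).sub ((integrable_bump hs).comp_sub_right _)).abs
  have hC0 : 0 ≤ C := (norm_nonneg _).trans (hC 0 ⟨le_rfl, hT⟩)
  calc _ ≤ ∫ r, 2 * C * |bump s (t - r) - bump s (t - r - (t - t'))| := by
        refine norm_integral_le_of_norm_le ((hi.comp_sub_left t).const_mul (2 * C))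
          (Eventually.of_forall fun r => ?_)
        rw [← sub_smul, norm_smul, Real.norm_eq_abs, show t - r - (t - t') = t' - r by ring,
          mul_comm]
        exact mul_le_mul_of_nonneg_right (norm_compress_le hT hC r) (abs_nonneg _)
    _ = 2 * C * ∫ u, |bump s u - bump s (u - (t - t'))| := by
        rw [integral_const_mul,
          integral_sub_left_eq_self (fun u => |bump s u - bump s (u - (t - t'))|) volume t]
    _ ≤ 2 * C * (2 * (t - t') * bump s 0) := by
        gcongr; exact integral_abs_bump_sub_le hs (by linarith)
    _ = _ := by rw [abs_of_nonneg (by linarith : 0 ≤ t - t')]; ring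

theorem continuous_mollify {s : ℝ} (hT : 0 ≤ T) (hs : 0 < s) (hF : PiecewiseContinuousOn F 0 T) :
    Continuous (mollify T s F) := by
  obtain ⟨C, hC⟩ := hF.exists_bound
  exact (LipschitzWith.of_dist_le' (K := 4 * C * bump s 0) fun x y => by
    rw [dist_eq_norm, Real.dist_eq]; exact norm_mollify_sub_le hT hs hF hC x y).continuous

/-- The compression leaves a margin T/4 at either end, which a mollifier of radius s ≤ T/4 does not
cross. This is what makes the mollified term continuous on the clock ring, where the times 0 and T
coincide. -/
theorem mollify_eq_zero {s t : ℝ} (hs : s ≤ T / 4)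
    (ht : t ≤ 0 ∨ T ≤ t) : mollify T s F t = 0 := by
  rw [mollify]
  refine integral_eq_zero_of_ae (Eventually.of_forall fun r => ?_)
  by_cases hr : r ∈ Icc (T / 4) (3 * T / 4)
  · have : s ≤ |t - r| := by
      rcases ht with h | h
      · rw [abs_sub_comm]; refine le_trans ?_ (le_abs_self _); linarith [hr.1]
      · refine le_trans ?_ (le_abs_self _); linarith [hr.2]
    simp [bump_eq_zero this]
  · simp [compress_of_notMem hr]

/-- The primitive of the compression. -/
noncomputable def primitive (T : ℝ) (F : ℝ → E) (t : ℝ) : E := ∫ u in (0 : ℝ)..t, compress T F u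

theorem hasDerivAt_primitive (hT : 0 ≤ T) (hF : PiecewiseContinuousOn F 0 T) {t : ℝ}
    (ht : ContinuousAt (compress T F) t) : HasDerivAt (primitive T F) (compress T F t) t := by
  have hi := integrable_compress hT hF
  exact intervalIntegral.integral_hasDerivAt_right hi.intervalIntegrable
    (hi.aestronglyMeasurable.stronglyMeasurableAtFilter) ht

theorem norm_primitive_sub_le (hT : 0 ≤ T) (hF : PiecewiseContinuousOn F 0 T)
    {C : ℝ} (hC : ∀ t ∈ Icc 0 T, ‖F t‖ ≤ C) (t t' : ℝ) :
    ‖primitive T F t - primitive T F t'‖ ≤ 2 * C * |t - t'| := by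
  have hi := integrable_compress hT hF
  rw [primitive, primitive, intervalIntegral.integral_interval_sub_left hi.intervalIntegrable
    hi.intervalIntegrable]
  exact intervalIntegral.norm_integral_le_of_norm_le_const fun x _ => norm_compress_le hT hC x

theorem primitive_eq_zero {t : ℝ} (hT : 0 ≤ T) (ht : t ≤ T / 4) : primitive T F t = 0 := by
  rw [primitive]
  refine intervalIntegral.integral_zero_ae ?_
  have : ∀ᵐ x : ℝ, x ≠ T / 4 := by simp [ae_iff]
  filter_upwards [this] with x hx hxt
  apply compress_of_notMem
  intro h
  rcases le_total 0 t with h0 | h0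
  · rw [uIoc_of_le h0] at hxt
    exact hx (le_antisymm (hxt.2.trans ht) h.1)
  · rw [uIoc_of_ge h0] at hxt
    exact hx (le_antisymm (hxt.2.trans (by linarith)) h.1)

theorem primitive_eq_of_ge {t : ℝ} (hT : 0 ≤ T) (hF : PiecewiseContinuousOn F 0 T)
    (ht : 3 * T / 4 ≤ t) :
    primitive T F t = primitive T F T := by
  have hi := integrable_compress hT hF
  rw [← sub_eq_zero, primitive, primitive, intervalIntegral.integral_interval_sub_left
    hi.intervalIntegrable hi.intervalIntegrable]
  refine intervalIntegral.integral_zero_ae ?_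
  have : ∀ᵐ x : ℝ, x ≠ 3 * T / 4 := by simp [ae_iff]
  filter_upwards [this] with x hx hxt
  apply compress_of_notMem
  intro h
  rcases le_total T t with h0 | h0
  · rw [uIoc_of_le h0] at hxt
    linarith [h.2, hxt.1]
  · rw [uIoc_of_ge h0] at hxt
    linarith [h.2, hxt.1]

theorem continuous_primitive (hT : 0 ≤ T) (hF : PiecewiseContinuousOn F 0 T) :
    Continuous (primitive T F) := by
  obtain ⟨C, hC⟩ := hF.exists_bound
  exact (LipschitzWith.of_dist_le' (K := 2 * C) fun x y => by
    rw [dist_eq_norm, Real.dist_eq]; exact norm_primitive_sub_le hT hF hC x y).continuous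

/-- The primitive of the difference between the mollified and the compressed function. -/
noncomputable def discrepancy (T s : ℝ) (F : ℝ → E) (t : ℝ) : E :=
  ∫ r, bump s r • (primitive T F (t - r) - primitive T F t)

theorem integrable_bump_smul_primitive {s : ℝ} (hT : 0 ≤ T) (hs : 0 < s)
    (hF : PiecewiseContinuousOn F 0 T) (t : ℝ) :
    Integrable fun r => bump s r • primitive T F (t - r) := by
  obtain ⟨C, hC⟩ := hF.exists_bound
  have hp := continuous_primitive hT hF
  refine integrable_of_bounded_support (a := -s) (b := s)
    (C := bump s 0 * (‖primitive T F t‖ + 2 * C * s))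
    ((measurable_bump hs).aestronglyMeasurable.smul
      (hp.comp (continuous_const.sub continuous_id)).aestronglyMeasurable) (fun r => ?_)
    fun r hr => ?_
  · have hC0 : 0 ≤ C := (norm_nonneg _).trans (hC 0 ⟨le_rfl, hT⟩)
    rw [norm_smul, Real.norm_of_nonneg (bump_nonneg hs r)]
    rcases lt_or_ge |r| s with h | h
    · refine mul_le_mul (bump_le hs r) ?_ (norm_nonneg _) (bump_nonneg hs 0)
      have h1 := norm_primitive_sub_le hT hF hC (t - r) t
      have h2 := norm_le_norm_add_norm_sub' (primitive T F (t - r)) (primitive T F t)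
      rw [show t - r - t = -r by ring, abs_neg] at h1
      have : 2 * C * |r| ≤ 2 * C * s := by gcongr
      linarith
    · rw [bump_eq_zero h, zero_mul]
      have := bump_nonneg hs 0
      positivity
  · have : s ≤ |r| := by
      by_contra! h
      exact hr (abs_le.mp h.le)
    simp [bump_eq_zero this]

theorem discrepancy_eq {s : ℝ} (hT : 0 ≤ T) (hs : 0 < s)
    (hF : PiecewiseContinuousOn F 0 T) (t : ℝ) :
    discrepancy T s F t = (∫ r, bump s r • primitive T F (t - r)) - primitive T F t := by
  simp_rw [discrepancy, smul_sub]
  rw [integral_sub (integrable_bump_smul_primitive hT hs hF t)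
    ((integrable_bump hs).smul_const _), integral_smul_const, integral_bump hs, one_smul]

/-- Differentiation under the integral, dominated by the Lipschitz constant of the primitive. For
each t only finitely many r meet a jump of the compression, so the derivative exists at every t. -/
theorem hasDerivAt_bump_primitive {s : ℝ} (hT : 0 ≤ T) (hs : 0 < s)
    (hF : PiecewiseContinuousOn F 0 T) (t : ℝ) :
    HasDerivAt (fun t => ∫ r, bump s r • primitive T F (t - r)) (mollify T s F t) t := by
  obtain ⟨C, hC⟩ := hF.exists_bound
  have hC0 : 0 ≤ C := (norm_nonneg _).trans (hC 0 ⟨le_rfl, hT⟩)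
  obtain ⟨S, hS, hc⟩ := exists_finite_continuousAt_compress hF
  have hp := continuous_primitive hT hF
  rw [mollify_eq]
  refine (hasDerivAt_integral_of_dominated_loc_of_lip (s := univ)
    (bound := fun r => 2 * C * bump s r) univ_mem
    (Eventually.of_forall fun x => (integrable_bump_smul_primitive hT hs hF x).aestronglyMeasurable)
    (integrable_bump_smul_primitive hT hs hF t)
    (integrable_mollify hT hs hF t).aestronglyMeasurable
    (Eventually.of_forall fun r => ?_) ((integrable_bump hs).const_mul _) ?_).2
  · refine LipschitzWith.lipschitzOnWith (LipschitzWith.of_dist_le_mul fun x y => ?_)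
    have hb := bump_nonneg hs r
    rw [dist_eq_norm, ← smul_sub, norm_smul, Real.norm_of_nonneg hb, Real.coe_nnabs,
      abs_of_nonneg (by positivity), Real.dist_eq]
    have h1 := norm_primitive_sub_le hT hF hC (x - r) (y - r)
    rw [show x - r - (y - r) = x - y by ring] at h1
    have := mul_le_mul_of_nonneg_left h1 hb
    linarith
  · have h0 : ((fun r => t - r) ⁻¹' S).Finite :=
      hS.preimage fun x _ y _ h => by linarith
    filter_upwards [h0.countable.ae_notMem volume] with r hr
    exact ((hasDerivAt_primitive hT hF (hc _ hr)).comp_sub_const t r).const_smul _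

theorem hasDerivAt_discrepancy {s : ℝ} (hT : 0 ≤ T) (hs : 0 < s)
    (hF : PiecewiseContinuousOn F 0 T) {t : ℝ} (ht : ContinuousAt (compress T F) t) :
    HasDerivAt (discrepancy T s F) (mollify T s F t - compress T F t) t := by
  rw [show discrepancy T s F = fun t => _ from funext (discrepancy_eq hT hs hF)]
  exact (hasDerivAt_bump_primitive hT hs hF t).sub (hasDerivAt_primitive hT hF ht)

theorem continuous_discrepancy {s : ℝ} (hT : 0 ≤ T) (hs : 0 < s)
    (hF : PiecewiseContinuousOn F 0 T) : Continuous (discrepancy T s F) := by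
  rw [show discrepancy T s F = fun t => _ from funext (discrepancy_eq hT hs hF)]
  exact (continuous_iff_continuousAt.mpr fun t =>
    (hasDerivAt_bump_primitive hT hs hF t).continuousAt).sub (continuous_primitive hT hF)

/-- The primitive is Lipschitz with constant 2C, so averaging it with the mollifier moves it by at
most 2C times the first absolute moment. -/
theorem norm_discrepancy_le {s : ℝ} (hT : 0 ≤ T) (hs : 0 < s)
    (hF : PiecewiseContinuousOn F 0 T) {C : ℝ} (hC : ∀ t ∈ Icc 0 T, ‖F t‖ ≤ C) (t : ℝ) :
    ‖discrepancy T s F t‖ ≤ 3 / 4 * C * s := by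
  have hC0 : 0 ≤ C := (norm_nonneg _).trans (hC 0 ⟨le_rfl, hT⟩)
  calc ‖discrepancy T s F t‖ ≤ ∫ r, 2 * C * (|r| * bump s r) := by
        refine norm_integral_le_of_norm_le ((integrable_abs_mul_bump hs).const_mul _)
          (Eventually.of_forall fun r => ?_)
        have hb := bump_nonneg hs r
        rw [norm_smul, Real.norm_of_nonneg hb]
        have h1 := norm_primitive_sub_le hT hF hC (t - r) t
        rw [show t - r - t = -r by ring, abs_neg] at h1
        have := mul_le_mul_of_nonneg_left h1 hb
        linarith
    _ = 2 * C * ∫ r, |r| * bump s r := integral_const_mul _ _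
    _ ≤ 2 * C * (3 / 8 * s) := by gcongr; exact integral_abs_mul_bump_le hs
    _ = _ := by ring

/-- Around 0 and around T the primitive is constant within distance s, so averaging does not change
it. Hence the corrected evolution needs no correction at its ends. -/
theorem discrepancy_eq_zero {s t : ℝ} (hT : 0 ≤ T) (hs' : s ≤ T / 4)
    (hF : PiecewiseContinuousOn F 0 T) (ht : t = 0 ∨ t = T) : discrepancy T s F t = 0 := by
  rw [discrepancy]
  refine integral_eq_zero_of_ae (Eventually.of_forall fun r => ?_)
  rcases lt_or_ge |r| s with h | h
  · have h1 := abs_lt.mp h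
    rcases ht with rfl | rfl
    · simp [primitive_eq_zero (F := F) hT (t := -r) (by linarith),
        primitive_eq_zero (F := F) hT (t := 0) (by linarith)]
    · simp [primitive_eq_of_ge hT hF (t := t - r) (by linarith)]
  · simp [bump_eq_zero h]

end compress

theorem integral_mollify_one {T s : ℝ} (hT : 0 ≤ T) (hs : 0 < s) (hs' : s ≤ T / 4) :
    ∫ t in (0 : ℝ)..T, mollify T s (fun _ => (1 : ℝ)) t = T := by
  have hF := piecewiseContinuousOn_const (1 : ℝ) 0 T
  rw [intervalIntegral.integral_eq_sub_of_hasDerivAt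
    (fun t _ => hasDerivAt_bump_primitive hT hs hF t)
    ((continuous_mollify hT hs hF).intervalIntegrable _ _)]
  -- At both ends the smoothed primitive equals the primitive itself, so smoothing preserves the
  -- total integral.
  have e1 := discrepancy_eq hT hs hF T
  have e0 := discrepancy_eq hT hs hF 0
  rw [discrepancy_eq_zero hT hs' hF (Or.inr rfl)] at e1
  rw [discrepancy_eq_zero hT hs' hF (Or.inl rfl)] at e0
  rw [← sub_eq_zero.mp e1.symm |>.symm, ← sub_eq_zero.mp e0.symm |>.symm]
  rw [primitive_eq_zero hT (t := 0) (by linarith), sub_zero, primitive]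
  rw [intervalIntegral.integral_of_le hT, compress, setIntegral_indicator measurableSet_Icc]
  rw [inter_eq_self_of_subset_right]
  · simp
    rw [max_eq_left] <;> linarith
  · intro x hx
    have := hx.1
    have := hx.2
    constructor <;> linarith

end WWRL

namespace WWRL

open MeasureTheory Set Filter Topology

/-! ### Evolutions -/

/-- The mean value inequality for functions differentiable off a finite set. -/
theorem norm_sub_le_integral_of_deriv_le {E : Type*} [NormedAddCommGroup E] [NormedSpace ℝ E]
    [CompleteSpace E] {f f' : ℝ → E} {β : ℝ → ℝ} {a b : ℝ} (hab : a ≤ b) {S : Set ℝ}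
    (hS : S.Finite) (hc : ContinuousOn f (Icc a b))
    (hd : ∀ t ∈ Ioo a b \ S, HasDerivAt f (f' t) t) (hβ : ∀ t ∈ Ioo a b \ S, ‖f' t‖ ≤ β t)
    (hi : IntervalIntegrable β volume a b) : ‖f b - f a‖ ≤ ∫ t in a..b, β t := by
  -- `deriv f` is used in place of `f'` because it is always measurable, while `f'` is arbitrary on
  -- the exceptional set.
  have hae : ∀ᵐ t, t ∈ Ioc a b → ‖deriv f t‖ ≤ β t := by
    have h1 : ∀ᵐ t : ℝ, t ≠ b := by simp [ae_iff]
    filter_upwards [h1, hS.countable.ae_notMem volume] with t htb htS ht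
    have hm : t ∈ Ioo a b \ S := ⟨⟨ht.1, lt_of_le_of_ne ht.2 htb⟩, htS⟩
    rw [(hd t hm).deriv]; exact hβ t hm
  have hint : IntervalIntegrable (deriv f) volume a b := by
    rw [intervalIntegrable_iff_integrableOn_Ioc_of_le hab] at hi ⊢
    exact hi.mono' (aestronglyMeasurable_deriv f _)
      ((ae_restrict_iff' measurableSet_Ioc).mpr hae)
  rw [← integral_eq_of_hasDerivAt_off_countable_of_le f (deriv f) hab hS.countable hc
    (fun t ht => by rw [(hd t ht).deriv]; exact hd t ht) hint]
  exact intervalIntegral.norm_integral_le_of_norm_le hab hae hi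

/-- The star is a continuous linear equivalence, and such maps commute with the Bochner integral
even for non-integrable functions, so no integrability has to be carried along. -/
theorem isSelfAdjoint_integral {A α : Type*} [NormedRing A] [StarRing A] [NormedSpace ℝ A]
    [NormedStarGroup A] [StarModule ℝ A] [MeasurableSpace α] {μ : Measure α} {f : α → A}
    (hf : ∀ x, IsSelfAdjoint (f x)) : IsSelfAdjoint (∫ x, f x ∂μ) := by
  have h := ContinuousLinearEquiv.integral_comp_comm (μ := μ) (starL' ℝ : A ≃L[ℝ] A) f
  rw [IsSelfAdjoint]
  simp only [starL'_apply] at h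
  rw [← h]
  congr 1
  ext x
  exact hf x

section selfAdjoint

variable {A : Type*} [NormedRing A] [StarRing A] [NormedSpace ℝ A]
    [NormedStarGroup A] [StarModule ℝ A] {T s : ℝ} {F : ℝ → A}

theorem isSelfAdjoint_compress (hF : ∀ t ∈ Icc 0 T, IsSelfAdjoint (F t)) (t : ℝ) :
    IsSelfAdjoint (compress T F t) := by
  by_cases ht : t ∈ Icc (T / 4) (3 * T / 4)
  · rw [compress_of_mem ht]
    exact (IsSelfAdjoint.all (2 : ℝ)).smul (hF _ (mem_Icc_of_compress ht))
  · rw [compress_of_notMem ht]; exact .zero _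

theorem isSelfAdjoint_mollify (hF : ∀ t ∈ Icc 0 T, IsSelfAdjoint (F t)) (t : ℝ) :
    IsSelfAdjoint (mollify T s F t) :=
  isSelfAdjoint_integral fun r =>
    (IsSelfAdjoint.all (bump s (t - r))).smul (isSelfAdjoint_compress hF r)

theorem isSelfAdjoint_primitive [CompleteSpace A] (hF : ∀ t ∈ Icc 0 T, IsSelfAdjoint (F t))
    (t : ℝ) : IsSelfAdjoint (primitive T F t) :=
  (isSelfAdjoint_integral (isSelfAdjoint_compress hF)).sub
    (isSelfAdjoint_integral (isSelfAdjoint_compress hF))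

theorem isSelfAdjoint_discrepancy [CompleteSpace A] (hF : ∀ t ∈ Icc 0 T, IsSelfAdjoint (F t))
    (t : ℝ) : IsSelfAdjoint (discrepancy T s F t) :=
  isSelfAdjoint_integral fun r => (IsSelfAdjoint.all (bump s r)).smul
    ((isSelfAdjoint_primitive hF _).sub (isSelfAdjoint_primitive hF _))

end selfAdjoint

theorem integral_compress_one {T : ℝ} (hT : 0 < T) :
    ∫ t in (0 : ℝ)..T, compress T (fun _ => (1 : ℝ)) t = T := by
  rw [intervalIntegral.integral_of_le hT.le, compress, setIntegral_indicator measurableSet_Icc]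
  rw [inter_eq_self_of_subset_right]
  · simp
    rw [max_eq_left] <;> linarith
  · intro x hx
    have := hx.1
    have := hx.2
    constructor <;> linarith

/-! ### The evolution, its time compression and its correction. -/

variable {V : Type u} [Fintype V] [DecidableEq V]

theorem IsEvolution.star_mul_self {T : ℝ} {H U : ℝ → Op V (Fin 2)}
    (hU : IsEvolution T H U) (hH : ∀ t ∈ Icc 0 T, IsSelfAdjoint (H t)) {t : ℝ}
    (ht : t ∈ Icc 0 T) : star (U t) * U t = 1 := by
  obtain ⟨hc, h0, S, hS, hd⟩ := hU
  have hsub : Icc 0 t ⊆ Icc 0 T := Icc_subset_Icc_right ht.2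
  have key := norm_sub_le_integral_of_deriv_le (f := fun t => star (U t) * U t) (f' := fun _ => 0)
    (β := fun _ => 0) ht.1 hS
    (((continuous_star.comp_continuousOn hc).mul hc).mono hsub) (fun r hr => ?_) (by simp)
    (by simp)
  · simp only [h0, star_one, mul_one, intervalIntegral.integral_zero, norm_le_zero_iff] at key
    exact sub_eq_zero.mp key
  · have hr' : r ∈ Ioo 0 T := ⟨hr.1.1, hr.1.2.trans_le ht.2⟩
    have h1 := hd r ⟨hr', hr.2⟩
    have h2 := h1.star.mul h1
    refine h2.congr_deriv ?_
    have := hH r (Ioo_subset_Icc_self hr')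
    rw [star_smul, star_mul, this.star_eq]
    simp [mul_assoc]

theorem norm_le_one_of_star_mul_self {A : Type*} [NormedRing A] [StarRing A] [CStarRing A]
    [NormOneClass A] {a : A} (h : star a * a = 1) : ‖a‖ ≤ 1 := by
  have := CStarRing.norm_star_mul_self (x := a)
  rw [h, norm_one] at this
  nlinarith [norm_nonneg a]

/-- For self-adjoint D the linear terms cancel in (1 - iD)*(1 - iD) = 1 + D², so the corrected
evolution fails to be a contraction only to second order in c. -/
theorem norm_one_sub_I_smul_mul_sq_le {A : Type*} [CStarAlgebra A] [Nontrivial A] {D U : A}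
    {c : ℝ} (hD : star D = D) (hDn : ‖D‖ ≤ c) (hU : star U * U = 1) :
    ‖(1 - Complex.I • D) * U‖ ^ 2 ≤ 1 + c ^ 2 := by
  have hUn := norm_le_one_of_star_mul_self hU
  have e : star ((1 - Complex.I • D) * U) * ((1 - Complex.I • D) * U)
      = star U * (1 + D * D) * U := by
    rw [star_mul, star_sub, star_one, star_smul, hD]
    have : (1 - star Complex.I • D) * (1 - Complex.I • D) = 1 + D * D := by
      simp only [sub_mul, mul_sub, one_mul, mul_one, smul_mul_smul_comm]
      simp only [RCLike.star_def, Complex.conj_I, neg_mul, Complex.I_mul_I, neg_neg, one_smul,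
        neg_smul]
      abel
    rw [← this]; simp only [mul_assoc]
  rw [sq, ← CStarRing.norm_star_mul_self, e]
  have hn : ‖D * D‖ ≤ c ^ 2 := by
    rw [sq]
    exact (norm_mul_le _ _).trans (mul_self_le_mul_self (norm_nonneg _) hDn)
  calc _ ≤ ‖star U‖ * ‖1 + D * D‖ * ‖U‖ :=
        (norm_mul_le _ _).trans (by gcongr; exact norm_mul_le _ _)
    _ ≤ 1 * (1 + c ^ 2) * 1 := by
        gcongr
        · rw [norm_star]; exact hUn
        · exact (norm_add_le _ _).trans (by rw [norm_one]; gcongr)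
    _ = _ := by ring

theorem norm_commutator_mul_le {A : Type*} [NormedRing A] {D M C U : A} {c h m k : ℝ}
    (hD : ‖D‖ ≤ c) (hM : ‖M‖ ≤ h * m) (hC : ‖C‖ ≤ h * k) (hU : ‖U‖ ≤ 1) :
    ‖(M * D - D * C) * U‖ ≤ c * (h * (m + k)) := by
  have hD0 := (norm_nonneg _).trans hD
  have hM0 := (norm_nonneg _).trans hM
  have hC0 := (norm_nonneg _).trans hC
  have h1 : ‖M * D‖ ≤ h * m * c :=
    (norm_mul_le _ _).trans (mul_le_mul hM hD (norm_nonneg _) hM0)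
  have h2 : ‖D * C‖ ≤ c * (h * k) :=
    (norm_mul_le _ _).trans (mul_le_mul hD hC (norm_nonneg _) hD0)
  calc _ ≤ ‖M * D - D * C‖ * ‖U‖ := norm_mul_le _ _
    _ ≤ (‖M * D‖ + ‖D * C‖) * 1 := by
        gcongr
        exact norm_sub_le _ _
    _ ≤ _ := by linarith

/-- The time at which the compressed evolution follows the original one. -/
noncomputable def compressedTime (T t : ℝ) : ℝ := max 0 (min T (2 * (t - T / 4)))

theorem compressedTime_mem {T : ℝ} (hT : 0 ≤ T) (t : ℝ) : compressedTime T t ∈ Icc 0 T :=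
  ⟨le_max_left _ _, max_le hT (min_le_left _ _)⟩

theorem continuous_compressedTime (T : ℝ) : Continuous (compressedTime T) := by
  unfold compressedTime; fun_prop

variable {G : SimpleGraph V} [Fintype G.edgeSet] {T : ℝ}

theorem compress_total (H : TimeDepHamiltonian G T) (t : ℝ) :
    compress T H.total t = ∑ x, compress T (H.term x) t := by
  by_cases ht : t ∈ Icc (T / 4) (3 * T / 4)
  · simp_rw [compress_of_mem ht, TimeDepHamiltonian.total, Finset.smul_sum]
  · simp_rw [compress_of_notMem ht]; simp

theorem IsEvolution.hasDerivAt_compressed {H : TimeDepHamiltonian G T} {U : ℝ → Op V (Fin 2)}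
    (hT : 0 < T) (hU : IsEvolution T H.total U) :
    ∃ S : Set ℝ, S.Finite ∧ ∀ t, t ∉ S → HasDerivAt (fun t => U (compressedTime T t))
      (-Complex.I • (compress T H.total t * U (compressedTime T t))) t := by
  obtain ⟨-, -, S, hS, hd⟩ := hU
  refine ⟨{T / 4, 3 * T / 4} ∪ (fun t : ℝ => 2 * (t - T / 4)) ⁻¹' S,
    (by simp : ({T / 4, 3 * T / 4} : Set ℝ).Finite).union (finite_preimage_affine hS T),
    fun t ht => ?_⟩
  simp only [mem_union, mem_insert_iff, mem_singleton_iff, mem_preimage, not_or] at ht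
  obtain ⟨⟨h1, h2⟩, h3⟩ := ht
  have hconst : ∀ c, t ∉ Icc (T / 4) (3 * T / 4) →
      (compressedTime T =ᶠ[𝓝 t] fun _ => c) → HasDerivAt (fun t => U (compressedTime T t))
      (-Complex.I • (compress T H.total t * U (compressedTime T t))) t := by
    intro c hn hev
    rw [compress_of_notMem hn, zero_mul, smul_zero]
    refine (hasDerivAt_const t (U c)).congr_of_eventuallyEq ?_
    filter_upwards [hev] with x hx
    simp only [hx]
  rcases lt_or_gt_of_ne h1 with hlt | hgt
  · refine hconst 0 (fun h => absurd h.1 (not_le.mpr hlt)) ?_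
    filter_upwards [gt_mem_nhds hlt] with x hx
    exact max_eq_left ((min_le_right _ _).trans (by linarith))
  rcases lt_or_gt_of_ne h2 with hlt | hgt2
  · have hev : compressedTime T =ᶠ[𝓝 t] fun t => 2 * (t - T / 4) := by
      filter_upwards [Icc_mem_nhds hgt hlt] with x hx
      rw [compressedTime, min_eq_right, max_eq_right] <;> linarith [hx.1, hx.2]
    have hm : 2 * (t - T / 4) ∈ Ioo 0 T \ S := ⟨⟨by linarith, by linarith⟩, h3⟩
    have hlin : HasDerivAt (fun t : ℝ => 2 * (t - T / 4)) 2 t := by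
      simpa using ((hasDerivAt_id t).sub_const (T / 4)).const_mul 2
    have := (hd _ hm).scomp t hlin
    rw [compress_of_mem ⟨hgt.le, hlt.le⟩, hev.eq_of_nhds]
    refine (this.congr_of_eventuallyEq ?_).congr_deriv ?_
    · filter_upwards [hev] with x hx
      simp only [hx, Function.comp]
    · rw [smul_mul_assoc, smul_comm]
  · refine hconst T (fun h => absurd h.2 (not_le.mpr hgt2)) ?_
    filter_upwards [lt_mem_nhds hgt2] with x hx
    rw [compressedTime, min_eq_left, max_eq_right] <;> linarith

/-- The mollified Hamiltonian. -/
noncomputable def TimeDepHamiltonian.mollified (H : TimeDepHamiltonian G T) (s t : ℝ) :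
    Op V (Fin 2) := ∑ x, mollify T s (H.term x) t

theorem TimeDepHamiltonian.norm_term_le (H : TimeDepHamiltonian G T) (x : G.edgeSet ⊕ V) :
    ∀ t ∈ Icc 0 T, ‖H.term x t‖ ≤ ⨆ t : Icc (0 : ℝ) T, ‖H.term x t‖ :=
  fun _ ht => (H.piecewiseContinuous x).norm_le_iSup ht

theorem TimeDepHamiltonian.strength_nonneg (H : TimeDepHamiltonian G T) : 0 ≤ H.strength :=
  Finset.sum_nonneg fun _ _ => Real.iSup_nonneg fun _ => norm_nonneg _

/-- A correction of the compressed evolution follows the mollified Hamiltonian up to a small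
residue. -/
theorem IsEvolution.exists_corrected {H : TimeDepHamiltonian G T} {U : ℝ → Op V (Fin 2)}
    (hT : 0 < T) (hU : IsEvolution T H.total U) {s : ℝ} (hs : 0 < s) (hs' : s ≤ T / 4) :
    ∃ (W R : ℝ → Op V (Fin 2)) (S : Set ℝ), S.Finite ∧ ContinuousOn W (Icc 0 T) ∧ W 0 = 1 ∧
      W T = U T ∧ (∀ t ∈ Icc 0 T, ‖W t‖ ^ 2 ≤ 1 + (3 / 4 * H.strength * s) ^ 2) ∧
      ∀ t ∈ Ioo 0 T \ S, HasDerivAt W (-Complex.I • (H.mollified s t * W t) + R t) t ∧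
        ‖R t‖ ≤ 3 / 4 * H.strength * s * (H.strength * (mollify T s (fun _ => (1 : ℝ)) t
          + compress T (fun _ => (1 : ℝ)) t)) := by
  have hT0 := hT.le
  have hsa : ∀ x, ∀ t ∈ Icc 0 T, IsSelfAdjoint (H.term x t) := fun x t ht => H.isHermitian x t ht
  have htot : ∀ t ∈ Icc 0 T, IsSelfAdjoint (H.total t) := fun t ht => by
    rw [IsSelfAdjoint, TimeDepHamiltonian.total, star_sum]
    exact Finset.sum_congr rfl fun x _ => hsa x t ht
  have hUs : ∀ t, star (U (compressedTime T t)) * U (compressedTime T t) = 1 := fun t =>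
    hU.star_mul_self htot (compressedTime_mem hT0 t)
  have hUn : ∀ t, ‖U (compressedTime T t)‖ ≤ 1 := fun t => norm_le_one_of_star_mul_self (hUs t)
  obtain ⟨S1, hS1, hd1⟩ := hU.hasDerivAt_compressed hT
  have hex := fun x => exists_finite_continuousAt_compress (H.piecewiseContinuous x)
  choose S2 hS2 hd2 using hex
  set D : ℝ → Op V (Fin 2) := fun t => ∑ x, discrepancy T s (H.term x) t with hD
  have hDsa : ∀ t, star (D t) = D t := fun t => by
    rw [hD, star_sum]
    exact Finset.sum_congr rfl fun x _ => isSelfAdjoint_discrepancy (hsa x) t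
  have hDn : ∀ t, ‖D t‖ ≤ 3 / 4 * H.strength * s := fun t => by
    rw [TimeDepHamiltonian.strength, Finset.mul_sum, Finset.sum_mul]
    exact norm_sum_le_of_le _ fun x _ =>
      norm_discrepancy_le hT0 hs (H.piecewiseContinuous x) (H.norm_term_le x) t
  have hDz : ∀ t, t = 0 ∨ t = T → D t = 0 := fun t ht =>
    Finset.sum_eq_zero fun x _ => discrepancy_eq_zero hT0 hs' (H.piecewiseContinuous x) ht
  -- With M mollified and C compressed, D' = M - C trades C for M in the leading term: W' = -iMU -
  -- DCU, whereas -iMW = -iMU - MDU. What remains is (MD - DC)U.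
  refine ⟨fun t => (1 - Complex.I • D t) * U (compressedTime T t),
    fun t => (H.mollified s t * D t - D t * compress T H.total t) * U (compressedTime T t),
    S1 ∪ ⋃ x, S2 x, hS1.union (finite_iUnion hS2), ?_, ?_, ?_, ?_, ?_⟩
  · have hDc : Continuous D := continuous_finsetSum _ fun x _ =>
      continuous_discrepancy hT0 hs (H.piecewiseContinuous x)
    refine ContinuousOn.mul (by fun_prop) (hU.1.comp (continuous_compressedTime T).continuousOn ?_)
    exact fun t _ => compressedTime_mem hT0 t
  · have : compressedTime T 0 = 0 := max_eq_left ((min_le_right _ _).trans (by linarith))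
    simp only [hDz 0 (Or.inl rfl), this, hU.2.1]; simp
  · have : compressedTime T T = T := by
      rw [compressedTime, min_eq_left, max_eq_right] <;> linarith
    simp only [hDz T (Or.inr rfl), this]; simp
  · exact fun t _ => norm_one_sub_I_smul_mul_sq_le (hDsa t) (hDn t) (hUs t)
  · intro t ht
    simp only [Set.mem_sdiff, mem_union, mem_iUnion, not_or, not_exists] at ht
    have hDd : HasDerivAt D (H.mollified s t - compress T H.total t) t := by
      rw [compress_total, TimeDepHamiltonian.mollified, ← Finset.sum_sub_distrib]
      exact HasDerivAt.fun_sum fun x _ =>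
        hasDerivAt_discrepancy hT0 hs (H.piecewiseContinuous x) (hd2 x t (ht.2.2 x))
    constructor
    · have := ((hasDerivAt_const t (1 : Op V (Fin 2))).sub (hDd.const_smul Complex.I)).mul
        (hd1 t ht.2.1)
      refine this.congr_deriv ?_
      simp only [sub_mul, mul_sub, one_mul, smul_mul_assoc, mul_smul_comm, zero_sub, smul_sub,
        smul_smul, neg_smul, neg_mul, mul_assoc, Complex.I_mul_I, neg_neg, one_smul, Pi.smul_apply,
        Pi.sub_apply, mul_neg]
      abel
    · have hM : ‖H.mollified s t‖ ≤ H.strength * mollify T s (fun _ => (1 : ℝ)) t := by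
        rw [TimeDepHamiltonian.strength, Finset.sum_mul]
        exact norm_sum_le_of_le _ fun x _ => norm_mollify_le hT0 hs (H.norm_term_le x) t
      have hC : ‖compress T H.total t‖ ≤ H.strength * compress T (fun _ => (1 : ℝ)) t := by
        rw [TimeDepHamiltonian.strength, Finset.sum_mul, compress_total]
        exact norm_sum_le_of_le _ fun x _ => norm_compress_le_mul (H.norm_term_le x) t
      exact norm_commutator_mul_le (hDn t) hM hC (hUn t)

end WWRL

namespace WWRL

open Finset

/-! ### Sums of discrete Gaussians -/

/-- The squared Gaussian weight. -/
noncomputable def gaussSq (r : ℝ) (j : ℕ) : ℝ := Real.exp (-(2 * r ^ 2 * j ^ 2))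

theorem gaussSq_pos (r : ℝ) (j : ℕ) : 0 < gaussSq r j := Real.exp_pos _

/-- The sum over a ring of `2 M` sites of a function of the distance to the origin. -/
noncomputable def ringSum (M : ℕ) (F : ℕ → ℝ) : ℝ :=
  ∑ j ∈ range M, F j + ∑ j ∈ range M, F (j + 1)

theorem ringSum_nonneg {M : ℕ} {F : ℕ → ℝ} (h : ∀ j, 0 ≤ F j) : 0 ≤ ringSum M F :=
  add_nonneg (sum_nonneg fun _ _ => h _) (sum_nonneg fun _ _ => h _)

theorem ringSum_mul_left (M : ℕ) (a : ℝ) (F : ℕ → ℝ) :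
    ringSum M (fun j => a * F j) = a * ringSum M F := by
  simp only [ringSum, ← mul_sum]; ring

theorem ringSum_add (M : ℕ) (F F' : ℕ → ℝ) :
    ringSum M (fun j => F j + F' j) = ringSum M F + ringSum M F' := by
  simp only [ringSum, sum_add_distrib]; ring

theorem ringSum_le_two_mul {M : ℕ} {F : ℕ → ℝ} (h0 : F 0 = 0) (h : ∀ j, 0 ≤ F j) :
    ringSum M F ≤ 2 * ∑ j ∈ range M, F (j + 1) := by
  have : ∑ j ∈ range M, F j ≤ ∑ j ∈ range M, F (j + 1) := by
    have h1 := sum_range_succ F M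
    rw [sum_range_succ', h0, add_zero] at h1
    rw [h1]; linarith [h M]
  rw [ringSum]; linarith

/-- The difference equals 2 sinh(4r²(j + 1)) times the common factor, and sinh y ≥ y. It plays the
role of w' = -4r²xw for the Gaussian, so that moments can be bounded through summation by parts. -/
theorem gaussSq_sub_ge (r : ℝ) (j : ℕ) :
    8 * r ^ 2 * (j + 1) * Real.exp (-(2 * r ^ 2)) * gaussSq r (j + 1)
      ≤ gaussSq r j - gaussSq r (j + 2) := by
  have e1 : gaussSq r j = Real.exp (-(2 * r ^ 2)) * gaussSq r (j + 1)
      * Real.exp (4 * r ^ 2 * (j + 1)) := by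
    simp only [gaussSq, ← Real.exp_add]; push_cast; ring_nf
  have e2 : gaussSq r (j + 2) = Real.exp (-(2 * r ^ 2)) * gaussSq r (j + 1)
      * Real.exp (-(4 * r ^ 2 * (j + 1))) := by
    simp only [gaussSq, ← Real.exp_add]; push_cast; ring_nf
  have h := Real.self_le_sinh_iff.mpr (show 0 ≤ 4 * r ^ 2 * ((j : ℝ) + 1) by positivity)
  rw [Real.sinh_eq] at h
  rw [e1, e2, ← mul_sub]
  have h0 : 0 ≤ Real.exp (-(2 * r ^ 2)) * gaussSq r (j + 1) :=
    mul_nonneg (Real.exp_pos _).le (gaussSq_pos _ _).le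
  nlinarith [mul_le_mul_of_nonneg_left h h0]

/-- Summation by parts: each interior weight gets (j + 1) - (j - 1) = 2, exactly its multiplicity on
the ring. -/
theorem sum_mul_sub_eq (w : ℕ → ℝ) (M : ℕ) :
    ∑ j ∈ range M, ((j : ℝ) + 1) * (w j - w (j + 2))
      = ringSum M w - M * w M - M * w (M + 1) := by
  induction M with
  | zero => simp [ringSum]
  | succ M ih =>
    simp only [ringSum, sum_range_succ] at ih ⊢
    rw [ih]; push_cast; ring

/-- As before, now with (j + 1)³ - (j - 1)³ = 2(3j² + 1). -/
theorem sum_cube_mul_sub_eq (w : ℕ → ℝ) (M : ℕ) :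
    ∑ j ∈ range M, ((j : ℝ) + 1) ^ 3 * (w j - w (j + 2))
      = ringSum M (fun j => (3 * (j : ℝ) ^ 2 + 1) * w j)
        - ((M : ℝ) ^ 3 + 3 * M) * w M - (M : ℝ) ^ 3 * w (M + 1) := by
  induction M with
  | zero => simp [ringSum]
  | succ M ih =>
    simp only [ringSum, sum_range_succ] at ih ⊢
    rw [ih]; push_cast; ring

/-- The Gaussian with density exp(-2r²x²) has variance 1/(4r²); the factor exp(2r²) is the price of
discreteness. The boundary terms of the summation by parts are negative and are dropped. -/
theorem ringSum_sq_mul_gaussSq_le (r : ℝ) (M : ℕ) :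
    r ^ 2 * ringSum M (fun j => (j : ℝ) ^ 2 * gaussSq r j)
      ≤ Real.exp (2 * r ^ 2) / 4 * ringSum M (gaussSq r) := by
  have h1 := ringSum_le_two_mul (M := M) (F := fun j => (j : ℝ) ^ 2 * gaussSq r j) (by simp)
    fun j => mul_nonneg (by positivity) (gaussSq_pos _ _).le
  have h2 : ∑ j ∈ range M, 8 * r ^ 2 * Real.exp (-(2 * r ^ 2)) *
      (((j + 1 : ℕ) : ℝ) ^ 2 * gaussSq r (j + 1))
      ≤ ∑ j ∈ range M, ((j : ℝ) + 1) * (gaussSq r j - gaussSq r (j + 2)) := by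
    refine sum_le_sum fun j _ => ?_
    have := mul_le_mul_of_nonneg_left (gaussSq_sub_ge r j) (by positivity : (0 : ℝ) ≤ j + 1)
    push_cast; nlinarith
  rw [sum_mul_sub_eq, ← mul_sum] at h2
  have h3 : 0 ≤ (M : ℝ) * gaussSq r M := mul_nonneg (by positivity) (gaussSq_pos _ _).le
  have h4 : 0 ≤ (M : ℝ) * gaussSq r (M + 1) := mul_nonneg (by positivity) (gaussSq_pos _ _).le
  have h5 : Real.exp (2 * r ^ 2) * Real.exp (-(2 * r ^ 2)) = 1 := by rw [← Real.exp_add]; simp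
  have h6 : Real.exp (2 * r ^ 2) * (8 * r ^ 2 * Real.exp (-(2 * r ^ 2)) *
      ∑ j ∈ range M, ((j + 1 : ℕ) : ℝ) ^ 2 * gaussSq r (j + 1))
      ≤ Real.exp (2 * r ^ 2) * ringSum M (gaussSq r) :=
    mul_le_mul_of_nonneg_left (by linarith) (Real.exp_pos _).le
  have h7 : Real.exp (2 * r ^ 2) * (8 * r ^ 2 * Real.exp (-(2 * r ^ 2)) *
      ∑ j ∈ range M, ((j + 1 : ℕ) : ℝ) ^ 2 * gaussSq r (j + 1))
      = 8 * r ^ 2 * ∑ j ∈ range M, ((j + 1 : ℕ) : ℝ) ^ 2 * gaussSq r (j + 1) := by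
    linear_combination (8 * r ^ 2 * ∑ j ∈ range M, ((j + 1 : ℕ) : ℝ) ^ 2 * gaussSq r (j + 1)) * h5
  rw [h7] at h6
  have := mul_le_mul_of_nonneg_left h1 (sq_nonneg r)
  linarith

/-- The discrete form of the fourth moment being three times the squared variance. The second moment
left over by the summation by parts is handled by `ringSum_sq_mul_gaussSq_le`. -/
theorem ringSum_four_mul_gaussSq_le (r : ℝ) (M : ℕ) :
    r ^ 4 * ringSum M (fun j => (j : ℝ) ^ 4 * gaussSq r j)
      ≤ Real.exp (2 * r ^ 2) / 4 * (3 * (Real.exp (2 * r ^ 2) / 4) + r ^ 2)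
        * ringSum M (gaussSq r) := by
  have h1 := ringSum_le_two_mul (M := M) (F := fun j => (j : ℝ) ^ 4 * gaussSq r j) (by simp)
    fun j => mul_nonneg (by positivity) (gaussSq_pos _ _).le
  have h2 : ∑ j ∈ range M, 8 * r ^ 2 * Real.exp (-(2 * r ^ 2)) *
      (((j + 1 : ℕ) : ℝ) ^ 4 * gaussSq r (j + 1))
      ≤ ∑ j ∈ range M, ((j : ℝ) + 1) ^ 3 * (gaussSq r j - gaussSq r (j + 2)) := by
    refine sum_le_sum fun j _ => ?_
    have := mul_le_mul_of_nonneg_left (gaussSq_sub_ge r j) (by positivity : (0 : ℝ) ≤ (j + 1) ^ 3)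
    push_cast; linarith
  rw [sum_cube_mul_sub_eq, ← mul_sum] at h2
  have h3 : 0 ≤ ((M : ℝ) ^ 3 + 3 * M) * gaussSq r M :=
    mul_nonneg (by positivity) (gaussSq_pos _ _).le
  have h4 : 0 ≤ (M : ℝ) ^ 3 * gaussSq r (M + 1) :=
    mul_nonneg (by positivity) (gaussSq_pos _ _).le
  have h5 : Real.exp (2 * r ^ 2) * Real.exp (-(2 * r ^ 2)) = 1 := by rw [← Real.exp_add]; simp
  set E := Real.exp (2 * r ^ 2) with hE
  set E' := Real.exp (-(2 * r ^ 2)) with hE'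
  set Q := ∑ j ∈ range M, ((j + 1 : ℕ) : ℝ) ^ 4 * gaussSq r (j + 1) with hQ
  have e : ringSum M (fun j => (3 * (j : ℝ) ^ 2 + 1) * gaussSq r j)
      = 3 * ringSum M (fun j => (j : ℝ) ^ 2 * gaussSq r j) + ringSum M (gaussSq r) := by
    rw [← ringSum_mul_left, ← ringSum_add]; congr 1; ext j; ring
  rw [e] at h2
  have hEpos : 0 < E := Real.exp_pos _
  have hm := ringSum_sq_mul_gaussSq_le r M
  rw [← hE] at hm
  set m2 := ringSum M (fun j => (j : ℝ) ^ 2 * gaussSq r j)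
  set Z := ringSum M (gaussSq r)
  have h6 : E * (8 * r ^ 2 * E' * Q) ≤ E * (3 * m2 + Z) :=
    mul_le_mul_of_nonneg_left (by linarith) hEpos.le
  have h7 : E * (8 * r ^ 2 * E' * Q) = 8 * r ^ 2 * Q := by
    linear_combination (8 * r ^ 2 * Q) * h5
  rw [h7] at h6
  have h8 := mul_le_mul_of_nonneg_left h6 (sq_nonneg r)
  have h9 : E * (r ^ 2 * m2) ≤ E * (E / 4 * Z) := mul_le_mul_of_nonneg_left hm hEpos.le
  have h10 := mul_le_mul_of_nonneg_left h1 (by positivity : 0 ≤ r ^ 4)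
  calc _ ≤ r ^ 4 * (2 * Q) := h10
    _ = 1 / 4 * (r ^ 2 * (8 * r ^ 2 * Q)) := by ring
    _ ≤ 1 / 4 * (r ^ 2 * (E * (3 * m2 + Z))) := by gcongr
    _ = 1 / 4 * (3 * (E * (r ^ 2 * m2)) + E * r ^ 2 * Z) := by ring
    _ ≤ 1 / 4 * (3 * (E * (E / 4 * Z)) + E * r ^ 2 * Z) := by gcongr
    _ = _ := by ring

/-- Only the sites with jr ≤ 1/2 are kept. Each weighs at least exp(-1/2) ≥ 3/5, and they number 2n
+ 1 with (2n + 1)r > 1 - r ≥ 3/4. -/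
theorem mul_ringSum_gaussSq_ge {r : ℝ} {M : ℕ} (hr : 0 < r) (hr' : r ≤ 1 / 4)
    (hx : 2 ≤ 2 * M * r) : 9 / 20 ≤ r * ringSum M (gaussSq r) := by
  set n := ⌊1 / (2 * r)⌋₊ with hn
  have h1 : (n : ℝ) ≤ 1 / (2 * r) := Nat.floor_le (by positivity)
  have h2 : 1 / (2 * r) < n + 1 := Nat.lt_floor_add_one _
  have h1' : n * r ≤ 1 / 2 := by
    rw [le_div_iff₀ (by positivity)] at h1; linarith
  have h2' : 1 / 2 < (n + 1) * r := by
    rw [div_lt_iff₀ (by positivity)] at h2; linarith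
  have hnM : n + 1 ≤ M := by
    have : ((n : ℝ) + 1) * r ≤ M * r := by nlinarith
    exact_mod_cast le_of_mul_le_mul_right this hr
  have hw : ∀ j, j ≤ n → 3 / 5 ≤ gaussSq r j := by
    intro j hj
    have hj' : j * r ≤ 1 / 2 := le_trans (by gcongr) h1'
    have : -(1 / 2) ≤ -(2 * r ^ 2 * (j : ℝ) ^ 2) := by
      have : 0 ≤ j * r := by positivity
      nlinarith
    refine le_trans ?_ (Real.exp_le_exp.mpr this)
    rw [Real.exp_neg, le_inv_comm₀ (by norm_num) (Real.exp_pos _)]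
    have h := Real.exp_bound' (x := 1 / 2) (by norm_num) (by norm_num) (n := 4) (by norm_num)
    refine h.trans ?_
    simp [sum_range_succ, Nat.factorial]; norm_num
  have s1 : ((n : ℝ) + 1) * (3 / 5) ≤ ∑ j ∈ range M, gaussSq r j := by
    calc _ = ∑ j ∈ range (n + 1), (3 / 5 : ℝ) := by simp
      _ ≤ ∑ j ∈ range (n + 1), gaussSq r j :=
        sum_le_sum fun j hj => hw j (by simp at hj; omega)
      _ ≤ _ := sum_le_sum_of_subset_of_nonneg (range_subset_range.mpr hnM)
        fun j _ _ => (gaussSq_pos _ _).le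
  have s2 : (n : ℝ) * (3 / 5) ≤ ∑ j ∈ range M, gaussSq r (j + 1) := by
    calc _ = ∑ j ∈ range n, (3 / 5 : ℝ) := by simp
      _ ≤ ∑ j ∈ range n, gaussSq r (j + 1) :=
        sum_le_sum fun j hj => hw _ (by simp at hj; omega)
      _ ≤ _ := sum_le_sum_of_subset_of_nonneg (range_subset_range.mpr (by omega))
        fun j _ _ => (gaussSq_pos _ _).le
  rw [ringSum]
  nlinarith [mul_le_mul_of_nonneg_left (add_le_add s1 s2) hr.le]

/-- The Gaussian weight. -/
noncomputable def gauss (r : ℝ) (j : ℕ) : ℝ := Real.exp (-(r ^ 2 * j ^ 2))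

theorem gauss_sq (r : ℝ) (j : ℕ) : gauss r j ^ 2 = gaussSq r j := by
  rw [gauss, gaussSq, ← Real.exp_nat_mul]; push_cast; ring_nf

/-- The quantity lies between -r² and (9/16)y². Having one sign, its square is at most one of the
two squares, so no cross term arises. -/
theorem exp_neg_mul_cosh_sub_one_sq_le {r y : ℝ} (hy : |y| ≤ 1 / 2) :
    (Real.exp (-r ^ 2) * Real.cosh y - 1) ^ 2 ≤ r ^ 4 + (9 / 16 * y ^ 2) ^ 2 := by
  have hy2 : y ^ 2 ≤ 1 / 4 := by rw [← sq_abs]; nlinarith [abs_nonneg y]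
  have hy0 := sq_nonneg y
  have h1 : Real.cosh y ≤ 1 + 9 / 16 * y ^ 2 := by
    have h := Real.abs_exp_sub_one_sub_id_le (x := y ^ 2 / 2) (by rw [abs_of_nonneg] <;> linarith)
    have := le_of_abs_le h
    nlinarith [Real.cosh_le_exp_half_sq y]
  have h2 := Real.one_le_cosh y
  have h3 : 1 - r ^ 2 ≤ Real.exp (-r ^ 2) := by
    have := Real.add_one_le_exp (-r ^ 2); linarith
  have h4 : Real.exp (-r ^ 2) ≤ 1 := Real.exp_le_one_iff.mpr (by nlinarith [sq_nonneg r])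
  have h5 := Real.exp_pos (-r ^ 2)
  set q := Real.exp (-r ^ 2) * Real.cosh y - 1 with hq
  have hup : q ≤ 9 / 16 * y ^ 2 := by nlinarith
  have hlo : -r ^ 2 ≤ q := by nlinarith
  rcases le_total 0 q with h | h
  · have : q ^ 2 ≤ (9 / 16 * y ^ 2) ^ 2 := pow_le_pow_left₀ h hup 2
    have : 0 ≤ r ^ 4 := by positivity
    linarith
  · have : (-q) ^ 2 ≤ (r ^ 2) ^ 2 := pow_le_pow_left₀ (by linarith) (by linarith) 2
    have : 0 ≤ (9 / 16 * y ^ 2) ^ 2 := by positivity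
    nlinarith

theorem gauss_second_diff_sq_le {r a b : ℝ} {j : ℕ} (hy : 2 * r ^ 2 * j ≤ 1 / 2)
    (ha : a = Real.exp (-(r ^ 2 * ((j : ℝ) + 1) ^ 2)))
    (hb : b = Real.exp (-(r ^ 2 * ((j : ℝ) - 1) ^ 2))) :
    (a - 2 * gauss r j + b) ^ 2
      ≤ 4 * r ^ 4 * gaussSq r j + 81 / 4 * r ^ 4 * (r ^ 4 * ((j : ℝ) ^ 4 * gaussSq r j)) := by
  have h1 : a = gauss r j * (Real.exp (-r ^ 2) * Real.exp (-(2 * r ^ 2 * j))) := by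
    rw [ha, gauss, ← Real.exp_add, ← Real.exp_add]; ring_nf
  have h2 : b = gauss r j * (Real.exp (-r ^ 2) * Real.exp (2 * r ^ 2 * j)) := by
    rw [hb, gauss, ← Real.exp_add, ← Real.exp_add]; ring_nf
  have e : a - 2 * gauss r j + b
      = gauss r j * (2 * (Real.exp (-r ^ 2) * Real.cosh (2 * r ^ 2 * j) - 1)) := by
    rw [h1, h2, Real.cosh_eq]; ring
  rw [e, mul_pow, gauss_sq]
  have h := exp_neg_mul_cosh_sub_one_sq_le (r := r) (y := 2 * r ^ 2 * j)
    (by rw [abs_of_nonneg (by positivity)]; exact hy)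
  have := mul_le_mul_of_nonneg_left h (gaussSq_pos r j).le
  nlinarith

/-- At the antipode both neighbours lie one step closer to the origin, so the second difference is
of first order, about rx times the weight. The squared weight exp(-x²/2) ≤ r/x² makes up for it. The
constant comes from exp(z) - 1 ≤ 1.31 z for z ≤ 1/2, as 4 · 1.31² < 172/25. -/
theorem gauss_kink_sq_le {r x : ℝ} {M : ℕ} (hx : x = 2 * M * r) (hx0 : 0 < x) (hr : 0 < r)
    (hrx : r * x ≤ 1 / 2) (hexp : Real.exp (-(x ^ 2 / 2)) ≤ r / x ^ 2) :
    (2 * (Real.exp (-(r ^ 2 * ((M : ℝ) - 1) ^ 2)) - gauss r M)) ^ 2 ≤ 172 / 25 * r ^ 3 := by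
  have hM : gaussSq r M = Real.exp (-(x ^ 2 / 2)) := by
    rw [gaussSq, hx]; ring_nf
  have e : Real.exp (-(r ^ 2 * ((M : ℝ) - 1) ^ 2)) = gauss r M * Real.exp (r * x - r ^ 2) := by
    rw [gauss, ← Real.exp_add, hx]; ring_nf
  have h1 : Real.exp (r * x - r ^ 2) - 1 ≤ 131 / 100 * (r * x) := by
    have h := Real.exp_bound' (x := r * x) (by positivity) (by linarith) (n := 3) (by norm_num)
    simp [sum_range_succ, Nat.factorial] at h
    have h' : Real.exp (r * x - r ^ 2) ≤ Real.exp (r * x) :=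
      Real.exp_le_exp.mpr (by nlinarith [sq_nonneg r])
    have h0 : 0 ≤ r * x := by positivity
    nlinarith [mul_nonneg h0 h0, mul_nonneg (mul_nonneg h0 h0) h0]
  have h2 : -(131 / 100 * (r * x)) ≤ Real.exp (r * x - r ^ 2) - 1 := by
    have := Real.add_one_le_exp (r * x - r ^ 2)
    have hM1 : r ≤ x := by
      have : (1 : ℝ) ≤ M := by
        rcases Nat.eq_zero_or_pos M with h | h
        · rw [hx, h] at hx0; simp at hx0
        · exact_mod_cast h
      rw [hx]; nlinarith
    nlinarith
  have h3 : (Real.exp (r * x - r ^ 2) - 1) ^ 2 ≤ (131 / 100 * (r * x)) ^ 2 := sq_le_sq' h2 h1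
  have e2 : (2 * (Real.exp (-(r ^ 2 * ((M : ℝ) - 1) ^ 2)) - gauss r M)) ^ 2
      = 4 * (gaussSq r M * (Real.exp (r * x - r ^ 2) - 1) ^ 2) := by
    rw [e, ← gauss_sq]; ring
  rw [e2, hM]
  calc _ ≤ 4 * (r / x ^ 2 * (131 / 100 * (r * x)) ^ 2) := by gcongr
    _ = 4 * (131 / 100) ^ 2 * r ^ 3 := by field_simp
    _ ≤ _ := by gcongr; norm_num

theorem exp_two_mul_sq_le {r : ℝ} (hr : 0 ≤ r) (hr' : r ≤ 1 / 4) :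
    Real.exp (2 * r ^ 2) ≤ 1134 / 1000 := by
  refine (Real.exp_le_exp.mpr (show 2 * r ^ 2 ≤ 1 / 8 by nlinarith)).trans ?_
  refine (Real.exp_bound' (x := 1 / 8) (by norm_num) (by norm_num) (n := 3) (by norm_num)).trans ?_
  simp [sum_range_succ, Nat.factorial]; norm_num

/-! ### The clock ring -/

section ring

variable {Nc M : ℕ} [NeZero Nc]

/-- The distance to the origin on the clock ring, as a natural number. -/
def cyclicDist (k : ZMod Nc) : ℕ := min k.val (Nc - k.val)

theorem cyclicAbs_eq (k : ZMod Nc) : cyclicAbs k = cyclicDist k := by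
  rw [cyclicAbs, cyclicDist, Nat.cast_min, Nat.cast_sub (ZMod.val_lt k).le]

theorem sum_zmod_eq_sum_range (f : ℕ → ℝ) : ∑ k : ZMod Nc, f k.val = ∑ j ∈ range Nc, f j := by
  obtain ⟨n, rfl⟩ := Nat.exists_eq_succ_of_ne_zero (NeZero.ne Nc)
  exact Fin.sum_univ_eq_sum_range f (n + 1)

theorem sum_cyclicDist (hM : Nc = 2 * M) (F : ℕ → ℝ) :
    ∑ k : ZMod Nc, F (cyclicDist k) = ringSum M F := by
  refine (sum_zmod_eq_sum_range fun j => F (min j (Nc - j))).trans ?_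
  rw [hM, two_mul, sum_range_add, ringSum]
  congr 1
  · refine sum_congr rfl fun j hj => ?_
    rw [mem_range] at hj
    rw [min_eq_left (by omega)]
  · rw [← sum_range_reflect (fun j => F (j + 1))]
    refine sum_congr rfl fun j hj => ?_
    rw [mem_range] at hj
    rw [min_eq_right (by omega)]
    congr 1; omega

theorem val_add_one (k : ZMod Nc) :
    (k + 1).val = if k.val + 1 = Nc then 0 else k.val + 1 := by
  have hk := ZMod.val_lt k
  rcases Nat.lt_or_ge 1 Nc with h | h
  · have : Fact (1 < Nc) := ⟨h⟩
    rw [ZMod.val_add, ZMod.val_one]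
    split_ifs with h1
    · rw [h1, Nat.mod_self]
    · exact Nat.mod_eq_of_lt (by omega)
  · have : Nc = 1 := by have := NeZero.pos Nc; omega
    subst this
    have e : k = 0 := Subsingleton.elim _ _
    subst e; rfl

theorem val_sub_one (k : ZMod Nc) :
    (k - 1).val = if k.val = 0 then Nc - 1 else k.val - 1 := by
  have h := val_add_one (k - 1)
  rw [sub_add_cancel] at h
  have := ZMod.val_lt (k - 1)
  split_ifs at h ⊢ <;> omega

/-- The second difference on the ring is that of the even Gaussian on the integers, also at the
origin; the antipode is the only exception. -/
theorem cyclicDist_neighbours (hM : Nc = 2 * M) (k : ZMod Nc) :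
    (cyclicDist k = M ∧ cyclicDist (k + 1) = M - 1 ∧ cyclicDist (k - 1) = M - 1) ∨
    (cyclicDist k = 0 ∧ 0 < M ∧ cyclicDist (k + 1) = 1 ∧ cyclicDist (k - 1) = 1) ∨
    (0 < cyclicDist k ∧ cyclicDist k < M ∧
      ((cyclicDist (k + 1) = cyclicDist k + 1 ∧ cyclicDist (k - 1) = cyclicDist k - 1) ∨
      (cyclicDist (k + 1) = cyclicDist k - 1 ∧ cyclicDist (k - 1) = cyclicDist k + 1))) := by
  have h1 := val_add_one k
  have h2 := val_sub_one k
  have hk := ZMod.val_lt k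
  have hd : ∀ j, j ≤ M → min j (Nc - j) = j := fun j hj => min_eq_left (by omega)
  have hd' : ∀ j, M ≤ j → min j (Nc - j) = Nc - j := fun j hj => min_eq_right (by omega)
  simp only [cyclicDist]
  generalize k.val = m at *
  rcases lt_trichotomy m M with h | h | h
  · rw [if_neg (by omega)] at h1
    rw [h1, hd m h.le, hd (m + 1) h]
    rcases Nat.eq_zero_or_pos m with h0 | h0
    · rw [if_pos h0] at h2
      rw [h2, hd' (Nc - 1) (by omega)]
      exact Or.inr (Or.inl ⟨h0, by omega, by omega, by omega⟩)
    · rw [if_neg (by omega)] at h2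
      rw [h2, hd (m - 1) (by omega)]
      exact Or.inr (Or.inr ⟨h0, h, Or.inl ⟨rfl, rfl⟩⟩)
  · rw [if_neg (by omega)] at h2
    rw [h2, hd m h.le, hd (m - 1) (by omega)]
    refine Or.inl ⟨h, ?_, by omega⟩
    split_ifs at h1
    · rw [h1, hd 0 (by omega)]; omega
    · rw [h1, hd' (m + 1) (by omega)]; omega
  · rw [if_neg (by omega)] at h2
    rw [h2, hd' m h.le, hd' (m - 1) (by omega)]
    refine Or.inr (Or.inr ⟨by omega, by omega, Or.inr ⟨?_, by omega⟩⟩)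
    split_ifs at h1
    · rw [h1, hd 0 (by omega)]; omega
    · rw [h1, hd' (m + 1) (by omega)]; omega

/-- The second difference on the ring is controlled away from the antipode by the weight, and at
the antipode by the kink. -/
theorem sum_second_diff_sq_le (hM : Nc = 2 * M) {r x : ℝ} (hx : x = 2 * M * r) (hx2 : 2 ≤ x)
    (hr : 0 < r) (hr' : r ≤ 1 / 4) (hrx : r * x ≤ 1 / 2)
    (hexp : Real.exp (-(x ^ 2 / 2)) ≤ r / x ^ 2) :
    ∑ k : ZMod Nc, (gauss r (cyclicDist (k + 1)) - 2 * gauss r (cyclicDist k)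
        + gauss r (cyclicDist (k - 1))) ^ 2
      ≤ 26 * r ^ 4 * ringSum M (gaussSq r) := by
  have hMpos : 0 < M := by
    rcases Nat.eq_zero_or_pos M with h | h
    · rw [hx, h] at hx2; norm_num at hx2
    · exact h
  set P : ℕ → ℝ := fun j =>
    4 * r ^ 4 * gaussSq r j + 81 / 4 * r ^ 4 * (r ^ 4 * ((j : ℝ) ^ 4 * gaussSq r j)) with hP
  have hPnn : ∀ j, 0 ≤ P j := fun j => by have := gaussSq_pos r j; positivity
  set κ : ℝ := 172 / 25 * r ^ 3 with hκ
  have hpt : ∀ k : ZMod Nc, (gauss r (cyclicDist (k + 1)) - 2 * gauss r (cyclicDist k)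
        + gauss r (cyclicDist (k - 1))) ^ 2
      ≤ P (cyclicDist k) + if k = (M : ZMod Nc) then κ else 0 := by
    intro k
    have hy : cyclicDist k < M → 2 * r ^ 2 * (cyclicDist k : ℝ) ≤ 1 / 2 := by
      intro h
      have : (cyclicDist k : ℝ) ≤ M := by exact_mod_cast h.le
      have : 2 * r ^ 2 * (cyclicDist k : ℝ) ≤ 2 * r ^ 2 * M := by gcongr
      rw [hx] at hrx
      nlinarith
    have hκ0 : (0 : ℝ) ≤ if k = (M : ZMod Nc) then κ else 0 := by split_ifs <;> positivity
    rcases cyclicDist_neighbours hM k with ⟨h0, h1, h2⟩ | ⟨h0, _, h1, h2⟩ | ⟨h0, h1, h2 | h2⟩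
    · have hkM : k = (M : ZMod Nc) := by
        have : k.val = M := by
          have hk := ZMod.val_lt k
          simp only [cyclicDist] at h0; omega
        rw [← this, ZMod.natCast_zmod_val]
      rw [if_pos hkM, h0, h1, h2]
      have := gauss_kink_sq_le hx (by linarith) hr hrx hexp
      have e : gauss r (M - 1) = Real.exp (-(r ^ 2 * ((M : ℝ) - 1) ^ 2)) := by
        rw [gauss, Nat.cast_sub hMpos, Nat.cast_one]
      rw [← e] at this
      have h3 := hPnn M
      have e2 : (gauss r (M - 1) - 2 * gauss r M + gauss r (M - 1)) ^ 2
        = (2 * (gauss r (M - 1) - gauss r M)) ^ 2 := by ring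
      rw [e2]; linarith
    · have := gauss_second_diff_sq_le (a := gauss r (cyclicDist (k + 1)))
        (b := gauss r (cyclicDist (k - 1))) (hy (by omega)) (by rw [h0, h1, gauss]; simp)
        (by rw [h0, h2, gauss]; simp)
      exact this.trans (le_add_of_nonneg_right hκ0)
    · have := gauss_second_diff_sq_le (a := gauss r (cyclicDist (k + 1)))
        (b := gauss r (cyclicDist (k - 1))) (hy h1) (by rw [h2.1, gauss]; push_cast; rfl)
        (by rw [h2.2, gauss, Nat.cast_sub h0, Nat.cast_one])
      exact this.trans (le_add_of_nonneg_right hκ0)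
    · have := gauss_second_diff_sq_le (b := gauss r (cyclicDist (k + 1)))
        (a := gauss r (cyclicDist (k - 1))) (hy h1) (by rw [h2.2, gauss]; push_cast; rfl)
        (by rw [h2.1, gauss, Nat.cast_sub h0, Nat.cast_one])
      have e : ∀ a b c : ℝ, a - 2 * b + c = c - 2 * b + a := fun a b c => by ring
      rw [e]; exact this.trans (le_add_of_nonneg_right hκ0)
  refine (sum_le_sum fun k _ => hpt k).trans ?_
  rw [sum_add_distrib, sum_cyclicDist hM, sum_ite_eq' univ (M : ZMod Nc) fun _ => κ,
    if_pos (mem_univ _), hP, ringSum_add, ringSum_mul_left, ringSum_mul_left, ringSum_mul_left]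
  have h4 := ringSum_four_mul_gaussSq_le r M
  have hZ := mul_ringSum_gaussSq_ge hr hr' (hx ▸ hx2)
  have hE := exp_two_mul_sq_le hr.le hr'
  have hE0 := Real.exp_pos (2 * r ^ 2)
  set Z := ringSum M (gaussSq r)
  set E := Real.exp (2 * r ^ 2)
  have hZ0 : 0 ≤ Z := by
    by_contra! h
    nlinarith
  -- The budget: the bulk contributes 4 + (81/4)(0.26), and the kink (172/25)(20/9) after r³ has
  -- been absorbed into r⁴Z by the lower bound on rZ. The total is below 26.
  have h5 : E / 4 * (3 * (E / 4) + r ^ 2) ≤ 26 / 100 := by nlinarith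
  have h6 : E / 4 * (3 * (E / 4) + r ^ 2) * Z ≤ 26 / 100 * Z := by gcongr
  have h7 : 81 / 4 * r ^ 4 * (r ^ 4 * ringSum M fun j => (j : ℝ) ^ 4 * gaussSq r j)
      ≤ 81 / 4 * r ^ 4 * (26 / 100 * Z) :=
    mul_le_mul_of_nonneg_left (h4.trans h6) (by positivity)
  have h8 : r ^ 3 * (9 / 20) ≤ r ^ 3 * (r * Z) := by gcongr
  have h9 : 0 ≤ r ^ 4 * Z := by positivity
  have h10 : κ ≤ 172 / 25 * (20 / 9) * (r ^ 4 * Z) := by rw [hκ]; nlinarith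
  nlinarith

end ring

end WWRL

namespace WWRL

open Finset

/-! ### Interpolation between a clock state and its translate -/

section packet

variable {Nc : ℕ} [NeZero Nc]

/-- Linear interpolation between a clock state and its translate by one site. -/
def interp (a : ZMod Nc → ℝ) (t : ℝ) (l : ZMod Nc) : ℝ := (1 - t) * a l + t * a (l - 1)

/-- The normalized interpolation. -/
noncomputable def packet (a : ZMod Nc → ℝ) (t : ℝ) (l : ZMod Nc) : ℝ :=
  interp a t l / √(∑ k, interp a t k ^ 2)

/-- The derivative of the normalized interpolation. -/
noncomputable def packetDeriv (a : ZMod Nc → ℝ) (t : ℝ) (l : ZMod Nc) : ℝ :=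
  ((a (l - 1) - a l) - (∑ k, (a (k - 1) - a k) * packet a t k) * packet a t l)
    / √(∑ k, interp a t k ^ 2)

/-- The difference between the motion of the interpolation and the discrete momentum. -/
noncomputable def packetResidue (a : ZMod Nc → ℝ) (t : ℝ) (l : ZMod Nc) : ℝ :=
  packetDeriv a t l - (packet a t (l - 1) - packet a t (l + 1)) / 2

theorem sum_comp_sub (f : ZMod Nc → ℝ) (m : ZMod Nc) : ∑ l, f (l - m) = ∑ l, f l :=
  Equiv.sum_comp (Equiv.subRight m) f

theorem sum_comp_add (f : ZMod Nc → ℝ) (m : ZMod Nc) : ∑ l, f (l + m) = ∑ l, f l :=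
  Equiv.sum_comp (Equiv.addRight m) f

variable {a : ZMod Nc → ℝ}

/-- Nonnegative states have a nonnegative overlap, so the squared norm is at least (1 - t)² + t². -/
theorem half_le_sum_interp_sq (ha : ∀ l, 0 ≤ a l) (h1 : ∑ l, a l ^ 2 = 1) {t : ℝ}
    (ht : t ∈ Set.Icc 0 1) : 1 / 2 ≤ ∑ k, interp a t k ^ 2 := by
  have h2 : ∑ l, a (l - 1) ^ 2 = 1 := by rw [sum_comp_sub (fun l => a l ^ 2), h1]
  calc (1 / 2 : ℝ) ≤ (1 - t) ^ 2 * ∑ l, a l ^ 2 + t ^ 2 * ∑ l, a (l - 1) ^ 2 := by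
        rw [h1, h2]; nlinarith [sq_nonneg (2 * t - 1)]
    _ = ∑ l, ((1 - t) ^ 2 * a l ^ 2 + t ^ 2 * a (l - 1) ^ 2) := by
        rw [sum_add_distrib, mul_sum, mul_sum]
    _ ≤ _ := sum_le_sum fun l _ => by
        rw [interp]
        have := mul_nonneg (mul_nonneg ht.1 (sub_nonneg.mpr ht.2)) (mul_nonneg (ha l) (ha (l - 1)))
        nlinarith

theorem sum_packet_sq (ha : ∀ l, 0 ≤ a l) (h1 : ∑ l, a l ^ 2 = 1) {t : ℝ}
    (ht : t ∈ Set.Icc 0 1) : ∑ l, packet a t l ^ 2 = 1 := by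
  have h := half_le_sum_interp_sq ha h1 ht
  simp only [packet, div_pow]
  rw [← sum_div, Real.sq_sqrt (by linarith), div_self (by linarith)]

theorem packet_zero (h1 : ∑ l, a l ^ 2 = 1) : packet a 0 = a := by
  ext l; simp [packet, interp, h1]

theorem packet_one (h1 : ∑ l, a l ^ 2 = 1) : packet a 1 = fun l => a (l - 1) := by
  have h2 : ∑ l, a (l - 1) ^ 2 = 1 := by rw [sum_comp_sub (fun l => a l ^ 2), h1]
  ext l; simp [packet, interp, h2]

theorem hasDerivAt_packet (ha : ∀ l, 0 ≤ a l) (h1 : ∑ l, a l ^ 2 = 1) {t : ℝ}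
    (ht : t ∈ Set.Icc 0 1) (l : ZMod Nc) :
    HasDerivAt (fun t => packet a t l) (packetDeriv a t l) t := by
  have h := half_le_sum_interp_sq ha h1 ht
  have hi : ∀ k, HasDerivAt (fun t => interp a t k) (a (k - 1) - a k) t := fun k => by
    have := ((((hasDerivAt_id t).const_sub 1).mul_const (a k)).add
      ((hasDerivAt_id t).mul_const (a (k - 1))))
    refine this.congr_deriv ?_
    ring
  have hs : HasDerivAt (fun t => ∑ k, interp a t k ^ 2)
      (∑ k, 2 * interp a t k * (a (k - 1) - a k)) t :=
    HasDerivAt.fun_sum fun k _ => ((hi k).pow 2).congr_deriv (by push_cast; ring)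
  have hr := hs.sqrt (by linarith)
  have hn : 0 < √(∑ k, interp a t k ^ 2) := Real.sqrt_pos.mpr (by linarith)
  refine ((hi l).div hr hn.ne').congr_deriv ?_
  have e : ∑ k, 2 * interp a t k * (a (k - 1) - a k)
      = 2 * √(∑ k, interp a t k ^ 2) * ∑ k, (a (k - 1) - a k) * packet a t k := by
    rw [mul_sum]
    refine sum_congr rfl fun k _ => ?_
    rw [packet]; field_simp
  rw [e, packetDeriv, packet]
  set n := √(∑ k, interp a t k ^ 2)
  field_simp

/-- The discrete momentum is antisymmetric. -/
theorem sum_mul_discrete_deriv (p : ZMod Nc → ℝ) :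
    ∑ l, p l * ((p (l - 1) - p (l + 1)) / 2) = 0 := by
  have h : ∑ l, p l * p (l - 1) = ∑ l, p (l + 1) * p l := by
    rw [← sum_comp_add (fun l => p l * p (l - 1)) 1]
    simp
  have : ∀ l, p l * ((p (l - 1) - p (l + 1)) / 2) = (p l * p (l - 1)) / 2 - (p (l + 1) * p l) / 2 :=
    fun l => by ring
  simp only [this]
  rw [sum_sub_distrib, ← sum_div, ← sum_div, h, sub_self]

/-- The defect between the velocity of the interpolation and the discrete momentum. -/
theorem sum_defect_sq_le {S : ℝ} (hS : ∑ l, (a (l + 1) - 2 * a l + a (l - 1)) ^ 2 ≤ S) {t : ℝ}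
    (ht : t ∈ Set.Icc 0 1) :
    ∑ l, ((a (l - 1) - a l) - (interp a t (l - 1) - interp a t (l + 1)) / 2) ^ 2 ≤ S / 4 := by
  have h2 : ∑ l, (a (l - 1 + 1) - 2 * a (l - 1) + a (l - 1 - 1)) ^ 2
      = ∑ l, (a (l + 1) - 2 * a l + a (l - 1)) ^ 2 :=
    sum_comp_sub (fun l => (a (l + 1) - 2 * a l + a (l - 1)) ^ 2) 1
  -- The defect at l is half of (1 - t) times the second difference at l minus t times the one at l
  -- - 1; the square is convex.
  calc _ ≤ ∑ l, ((1 - t) * ((a (l + 1) - 2 * a l + a (l - 1)) ^ 2 / 4)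
        + t * ((a (l - 1 + 1) - 2 * a (l - 1) + a (l - 1 - 1)) ^ 2 / 4)) := by
        refine sum_le_sum fun l _ => ?_
        simp only [interp, sub_add_cancel, add_sub_cancel_right]
        have := mul_nonneg (mul_nonneg ht.1 (sub_nonneg.mpr ht.2))
          (sq_nonneg ((a (l + 1) - 2 * a l + a (l - 1)) + (a l - 2 * a (l - 1) + a (l - 1 - 1))))
        nlinarith
    _ = (1 - t) * ((∑ l, (a (l + 1) - 2 * a l + a (l - 1)) ^ 2) / 4)
        + t * ((∑ l, (a (l + 1) - 2 * a l + a (l - 1)) ^ 2) / 4) := by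
        rw [sum_add_distrib, ← mul_sum, ← mul_sum, ← sum_div, ← sum_div, h2]
    _ ≤ _ := by linarith

/-- Normalizing projects the velocity orthogonally to the packet. The discrete momentum is
antisymmetric, hence already orthogonal, so the residue is the projected defect divided by the norm.
-/
theorem packetResidue_eq (t : ℝ) (l : ZMod Nc) : packetResidue a t l =
    (((a (l - 1) - a l) - (interp a t (l - 1) - interp a t (l + 1)) / 2)
      - (∑ k, ((a (k - 1) - a k) - (interp a t (k - 1) - interp a t (k + 1)) / 2)
        * packet a t k) * packet a t l) / √(∑ k, interp a t k ^ 2) := by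
  have h : ∑ k, (interp a t (k - 1) - interp a t (k + 1)) / 2 * packet a t k = 0 := by
    have := sum_mul_discrete_deriv (interp a t)
    have e : ∀ k, (interp a t (k - 1) - interp a t (k + 1)) / 2 * packet a t k
        = interp a t k * ((interp a t (k - 1) - interp a t (k + 1)) / 2)
          / √(∑ k, interp a t k ^ 2) := fun k => by rw [packet]; ring
    simp only [e]
    rw [← sum_div, this, zero_div]
  simp only [sub_mul _ ((interp a t _ - interp a t _) / 2), sum_sub_distrib, h, sub_zero]
  rw [packetResidue, packetDeriv, packet, packet, packet]
  ring

theorem sum_packetResidue_mul_packet (ha : ∀ l, 0 ≤ a l) (h1 : ∑ l, a l ^ 2 = 1) {t : ℝ}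
    (ht : t ∈ Set.Icc 0 1) : ∑ l, packetResidue a t l * packet a t l = 0 := by
  have hp := sum_packet_sq ha h1 ht
  simp only [packetResidue_eq, div_mul_eq_mul_div]
  rw [← sum_div]
  set w : ZMod Nc → ℝ := fun l =>
    (a (l - 1) - a l) - (interp a t (l - 1) - interp a t (l + 1)) / 2
  change (∑ l, (w l - (∑ k, w k * packet a t k) * packet a t l) * packet a t l) / _ = 0
  simp only [sub_mul, sum_sub_distrib, mul_assoc, ← sq]
  rw [← mul_sum, hp, mul_one, sub_self, zero_div]

/-- The projection does not increase the defect S/4, and the squared norm divided out is at least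
1/2. -/
theorem sum_packetResidue_sq_le (ha : ∀ l, 0 ≤ a l) (h1 : ∑ l, a l ^ 2 = 1) {t S : ℝ}
    (hS : ∑ l, (a (l + 1) - 2 * a l + a (l - 1)) ^ 2 ≤ S)
    (ht : t ∈ Set.Icc 0 1) : ∑ l, packetResidue a t l ^ 2 ≤ S / 2 := by
  have hp := sum_packet_sq ha h1 ht
  have hn := half_le_sum_interp_sq ha h1 ht
  have hd := sum_defect_sq_le hS ht
  simp only [packetResidue_eq, div_pow]
  rw [← sum_div, Real.sq_sqrt (by linarith), div_le_iff₀ (by linarith)]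
  set w : ZMod Nc → ℝ := fun l =>
    (a (l - 1) - a l) - (interp a t (l - 1) - interp a t (l + 1)) / 2 with hw
  set c := ∑ k, w k * packet a t k with hc
  have e : ∑ l, (w l - c * packet a t l) ^ 2 = ∑ l, w l ^ 2 - c ^ 2 := by
    have : ∀ l, (w l - c * packet a t l) ^ 2
        = w l ^ 2 - 2 * c * (w l * packet a t l) + c ^ 2 * packet a t l ^ 2 := fun l => by ring
    simp only [this]
    rw [sum_add_distrib, sum_sub_distrib, ← mul_sum, ← mul_sum, ← hc, hp]
    ring
  have hS0 : 0 ≤ S := (sum_nonneg fun l _ => sq_nonneg _).trans hS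
  change ∑ l, (w l - c * packet a t l) ^ 2 ≤ _
  rw [e]
  change ∑ l, w l ^ 2 ≤ S / 4 at hd
  nlinarith [sq_nonneg c]

/-- The second moment of the interpolation about its moving centre. -/
theorem sum_sq_mul_packet_sq_le (ha : ∀ l, 0 ≤ a l) (h1 : ∑ l, a l ^ 2 = 1) {t r : ℝ}
    (hr : 0 < r) (hr' : r ≤ 1 / 4) {d κ : ZMod Nc → ℝ} (hd : ∀ l, 0 ≤ d l)
    (hm : r ^ 2 * ∑ l, d l ^ 2 * a l ^ 2 ≤ 2835 / 10000) (hκ : ∀ l, 0 ≤ κ l)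
    (hκa : ∀ l, κ l ≤ d l + t) (hκb : ∀ l, κ l ≤ d (l - 1) + (1 - t))
    (ht : t ∈ Set.Icc 0 1) : r ^ 2 * ∑ l, κ l ^ 2 * packet a t l ^ 2 ≤ 7 / 8 := by
  have hn := half_le_sum_interp_sq ha h1 ht
  -- The first moment is bounded by the second through d ≤ r d² + 1/(4r).
  have h1' : r ^ 2 * ∑ l, d l * a l ^ 2 ≤ r * (2835 / 10000) + r / 4 := by
    calc _ ≤ r ^ 2 * ∑ l, (r * (d l ^ 2 * a l ^ 2) + 1 / (4 * r) * a l ^ 2) := by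
          gcongr with l
          have : d l ≤ r * d l ^ 2 + 1 / (4 * r) := by
            have := sq_nonneg (2 * r * d l - 1)
            rw [← sub_nonneg]
            have e : r * d l ^ 2 + 1 / (4 * r) - d l = (2 * r * d l - 1) ^ 2 / (4 * r) := by
              field_simp; ring
            rw [e]; positivity
          nlinarith [sq_nonneg (a l)]
      _ = r * (r ^ 2 * ∑ l, d l ^ 2 * a l ^ 2) + r / 4 := by
          rw [sum_add_distrib, ← mul_sum, ← mul_sum, h1]; field_simp
      _ ≤ _ := by gcongr
  have key : ∀ t ∈ Set.Icc (0 : ℝ) 1, r ^ 2 * ∑ l, (d l + t) ^ 2 * a l ^ 2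
      = r ^ 2 * ∑ l, d l ^ 2 * a l ^ 2 + 2 * t * (r ^ 2 * ∑ l, d l * a l ^ 2) + r ^ 2 * t ^ 2 := by
    intro t _
    have : ∀ l, (d l + t) ^ 2 * a l ^ 2
        = d l ^ 2 * a l ^ 2 + 2 * t * (d l * a l ^ 2) + t ^ 2 * a l ^ 2 := fun l => by ring
    simp only [this]
    rw [sum_add_distrib, sum_add_distrib, ← mul_sum, ← mul_sum, h1]
    ring
  have hshift : ∑ l, (d (l - 1) + (1 - t)) ^ 2 * a (l - 1) ^ 2
      = ∑ l, (d l + (1 - t)) ^ 2 * a l ^ 2 :=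
    sum_comp_sub (fun l => (d l + (1 - t)) ^ 2 * a l ^ 2) 1
  have ht' : 0 ≤ 1 - t := by linarith [ht.2]
  have hnum : r ^ 2 * ∑ l, κ l ^ 2 * interp a t l ^ 2 ≤ 7 / 16 := by
    calc _ ≤ r ^ 2 * ∑ l, ((1 - t) * ((d l + t) ^ 2 * a l ^ 2)
          + t * ((d (l - 1) + (1 - t)) ^ 2 * a (l - 1) ^ 2)) := by
          gcongr with l
          -- Convexity separates the Gaussian from its translate, and each is then measured from its
          -- own centre: the first with distance d + t, the second with the translated d plus 1 - t.
          have hconv : interp a t l ^ 2 ≤ (1 - t) * a l ^ 2 + t * a (l - 1) ^ 2 := by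
            rw [interp]
            nlinarith [mul_nonneg (mul_nonneg ht.1 ht') (sq_nonneg (a l - a (l - 1)))]
          have k1 : κ l ^ 2 ≤ (d l + t) ^ 2 := pow_le_pow_left₀ (hκ l) (hκa l) 2
          have k2 : κ l ^ 2 ≤ (d (l - 1) + (1 - t)) ^ 2 := pow_le_pow_left₀ (hκ l) (hκb l) 2
          calc _ ≤ κ l ^ 2 * ((1 - t) * a l ^ 2 + t * a (l - 1) ^ 2) := by gcongr
            _ = (1 - t) * (κ l ^ 2 * a l ^ 2) + t * (κ l ^ 2 * a (l - 1) ^ 2) := by ring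
            _ ≤ _ := by have := ht.1; gcongr
      _ = (1 - t) * (r ^ 2 * ∑ l, (d l + t) ^ 2 * a l ^ 2)
          + t * (r ^ 2 * ∑ l, (d l + (1 - t)) ^ 2 * a l ^ 2) := by
          rw [sum_add_distrib, ← mul_sum, ← mul_sum, hshift]; ring
      _ ≤ _ := by
          rw [key t ht, key (1 - t) ⟨ht', by linarith [ht.1]⟩]
          set m2 := r ^ 2 * ∑ l, d l ^ 2 * a l ^ 2
          set m1 := r ^ 2 * ∑ l, d l * a l ^ 2 with hm1
          have hm10 : 0 ≤ m1 := by
            have : ∀ l, 0 ≤ d l * a l ^ 2 := fun l => mul_nonneg (hd l) (sq_nonneg _)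
            rw [hm1]
            have := sum_nonneg fun l (_ : l ∈ univ) => this l
            positivity
          have hm1' : m1 ≤ 1334 / 10000 := by linarith
          have hq : t * (1 - t) ≤ 1 / 4 := by nlinarith [sq_nonneg (2 * t - 1)]
          have hq0 : 0 ≤ t * (1 - t) := mul_nonneg ht.1 ht'
          have hrr : r ^ 2 ≤ 1 / 16 := by nlinarith
          have e : (1 - t) * (m2 + 2 * t * m1 + r ^ 2 * t ^ 2)
              + t * (m2 + 2 * (1 - t) * m1 + r ^ 2 * (1 - t) ^ 2)
              = m2 + 4 * (t * (1 - t)) * m1 + r ^ 2 * (t * (1 - t)) := by ring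
          rw [e]
          have : 4 * (t * (1 - t)) * m1 ≤ 4 * (1 / 4) * (1334 / 10000) := by gcongr
          have : r ^ 2 * (t * (1 - t)) ≤ 1 / 16 * (1 / 4) := by gcongr
          linarith
  simp only [packet, div_pow, ← mul_div_assoc]
  rw [← sum_div, Real.sq_sqrt (by linarith), ← mul_div_assoc, div_le_iff₀ (by linarith)]
  linarith

end packet

/-! ### The Gaussian clock state -/

section clockState

variable {Nc M : ℕ} [NeZero Nc] {δ σ : ℝ}

theorem gaussWeight_eq (δ σ : ℝ) (l : ZMod Nc) :
    gaussWeight δ σ l = gauss (δ / σ) (cyclicDist l) := by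
  rw [gaussWeight, gauss, cyclicAbs_eq, div_pow]; ring_nf

theorem sum_gaussWeight_sq (hM : Nc = 2 * M) (δ σ : ℝ) :
    ∑ m : ZMod Nc, gaussWeight δ σ m ^ 2 = ringSum M (gaussSq (δ / σ)) := by
  simp only [gaussWeight_eq, gauss_sq]
  exact sum_cyclicDist hM _

theorem sum_gaussWeight_sq_pos (δ σ : ℝ) : 0 < ∑ m : ZMod Nc, gaussWeight δ σ m ^ 2 :=
  sum_pos (fun _ _ => pow_pos (Real.exp_pos _) 2) univ_nonempty

theorem clockState_nonneg (l : ZMod Nc) : 0 ≤ clockState δ σ l :=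
  div_nonneg (Real.exp_pos _).le (Real.sqrt_nonneg _)

theorem sum_clockState_sq (δ σ : ℝ) : ∑ l : ZMod Nc, clockState δ σ l ^ 2 = 1 := by
  have h := sum_gaussWeight_sq_pos (Nc := Nc) δ σ
  simp only [clockState, div_pow]
  rw [← sum_div, Real.sq_sqrt h.le, div_self h.ne']

/-- The constant is 1.134/4, where 1.134 bounds exp(2r²) for r ≤ 1/4. -/
theorem sum_dist_sq_mul_clockState_sq_le (hM : Nc = 2 * M) (hr : 0 ≤ δ / σ)
    (hr' : δ / σ ≤ 1 / 4) :
    (δ / σ) ^ 2 * ∑ l : ZMod Nc, (cyclicDist l : ℝ) ^ 2 * clockState δ σ l ^ 2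
      ≤ 2835 / 10000 := by
  have h := sum_gaussWeight_sq_pos (Nc := Nc) δ σ
  have h2 := ringSum_sq_mul_gaussSq_le (δ / σ) M
  have h3 := exp_two_mul_sq_le hr hr'
  simp only [clockState, div_pow _ √_, ← mul_div_assoc]
  rw [← sum_div, Real.sq_sqrt h.le, ← mul_div_assoc, div_le_iff₀ h]
  simp only [gaussWeight_eq, gauss_sq]
  rw [sum_cyclicDist hM fun j => (j : ℝ) ^ 2 * gaussSq (δ / σ) j, sum_cyclicDist hM]
  refine h2.trans ?_
  have : 0 ≤ ringSum M (gaussSq (δ / σ)) := ringSum_nonneg fun j => (gaussSq_pos _ j).le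
  nlinarith

theorem sum_clockState_second_diff_sq_le (hM : Nc = 2 * M) {x : ℝ} (hx : x = Nc * (δ / σ))
    (hx2 : 2 ≤ x) (hr : 0 < δ / σ) (hr' : δ / σ ≤ 1 / 4) (hrx : δ / σ * x ≤ 1 / 2)
    (hexp : Real.exp (-(x ^ 2 / 2)) ≤ δ / σ / x ^ 2) :
    ∑ l : ZMod Nc, (clockState δ σ (l + 1) - 2 * clockState δ σ l + clockState δ σ (l - 1)) ^ 2
      ≤ 26 * (δ / σ) ^ 4 := by
  have h := sum_gaussWeight_sq_pos (Nc := Nc) δ σ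
  have e : ∀ l : ZMod Nc,
      (clockState δ σ (l + 1) - 2 * clockState δ σ l + clockState δ σ (l - 1)) ^ 2
      = (gaussWeight δ σ (l + 1) - 2 * gaussWeight δ σ l + gaussWeight δ σ (l - 1)) ^ 2
        / √(∑ m : ZMod Nc, gaussWeight δ σ m ^ 2) ^ 2 := fun l => by
    simp only [clockState]; rw [← div_pow]; ring
  simp only [e]
  rw [← sum_div, Real.sq_sqrt h.le, div_le_iff₀ h, sum_gaussWeight_sq hM]
  simp only [gaussWeight_eq]
  refine sum_second_diff_sq_le hM (x := x) ?_ hx2 hr hr' hrx hexp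
  rw [hx, hM]; push_cast; ring

end clockState

end WWRL

namespace WWRL

open Finset

/-! ### Vectors on qubits and clocks -/

theorem toEuclideanLin_coord {m : Type*} [Fintype m] [DecidableEq m] (A : Matrix m m ℂ)
    (ξ : EuclideanSpace ℂ m) (i : m) : Matrix.toEuclideanLin A ξ i = ∑ j, A i j * ξ j := rfl

theorem norm_toEuclideanLin_le {m : Type*} [Fintype m] [DecidableEq m] (A : Matrix m m ℂ)
    (ξ : EuclideanSpace ℂ m) : ‖Matrix.toEuclideanLin A ξ‖ ≤ ‖A‖ * ‖ξ‖ :=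
  Matrix.l2_opNorm_mulVec A ξ

section vectors

variable {V : Type u} [Fintype V] {Nc : ℕ} [NeZero Nc]

/-- A vector given by a function of the qubit and the clock configurations. -/
def confVec (f : (V → Fin 2) → (V → ZMod Nc) → ℂ) : EuclideanSpace ℂ (V → Site Nc) :=
  WithLp.toLp 2 fun c => f (fun v => (c v).1) (fun v => (c v).2)

theorem confVec_apply (f : (V → Fin 2) → (V → ZMod Nc) → ℂ) (c : V → Site Nc) :
    confVec f c = f (fun v => (c v).1) (fun v => (c v).2) := rfl

variable [DecidableEq V]

theorem sum_config (F : (V → Fin 2) → (V → ZMod Nc) → ℂ) :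
    ∑ c : V → Site Nc, F (fun v => (c v).1) (fun v => (c v).2) = ∑ κ, ∑ q, F q κ := by
  rw [sum_comm, ← Fintype.sum_prod_type' F]
  exact Equiv.sum_comp (Equiv.arrowProdEquivProdArrow V (fun _ => Fin 2) (fun _ => ZMod Nc))
    fun z => F z.1 z.2

theorem sum_config_real (F : (V → Fin 2) → (V → ZMod Nc) → ℝ) :
    ∑ c : V → Site Nc, F (fun v => (c v).1) (fun v => (c v).2) = ∑ κ, ∑ q, F q κ := by
  rw [sum_comm, ← Fintype.sum_prod_type' F]
  exact Equiv.sum_comp (Equiv.arrowProdEquivProdArrow V (fun _ => Fin 2) (fun _ => ZMod Nc))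
    fun z => F z.1 z.2

theorem norm_confVec_sq (f : (V → Fin 2) → (V → ZMod Nc) → ℂ) :
    ‖confVec f‖ ^ 2 = ∑ κ, ∑ q, ‖f q κ‖ ^ 2 := by
  rw [EuclideanSpace.norm_sq_eq]
  exact sum_config_real fun q κ => ‖f q κ‖ ^ 2

/-- The tensor product of a qubit vector and a real clock vector. -/
def tens (ξ : EuclideanSpace ℂ (V → Fin 2)) (Θ : (V → ZMod Nc) → ℝ) :
    EuclideanSpace ℂ (V → Site Nc) :=
  confVec fun q κ => ξ q * (Θ κ : ℂ)

theorem norm_tens_sq (ξ : EuclideanSpace ℂ (V → Fin 2)) (Θ : (V → ZMod Nc) → ℝ) :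
    ‖tens ξ Θ‖ ^ 2 = ‖ξ‖ ^ 2 * ∑ κ, Θ κ ^ 2 := by
  rw [tens, norm_confVec_sq, EuclideanSpace.norm_sq_eq, mul_sum]
  refine sum_congr rfl fun κ _ => ?_
  rw [sum_mul]
  refine sum_congr rfl fun q _ => ?_
  rw [norm_mul, mul_pow, Complex.norm_real, Real.norm_eq_abs, sq_abs]

/-- The product clock state. -/
def prodState (p : ZMod Nc → ℝ) (κ : V → ZMod Nc) : ℝ := ∏ v, p (κ v)

/-- The product clock state with one factor replaced. -/
def mixedState (p χ : ZMod Nc → ℝ) (v : V) (κ : V → ZMod Nc) : ℝ :=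
  χ (κ v) * ∏ w ∈ univ.erase v, p (κ w)

theorem withClocks_eq (δ σ : ℝ) (ψ : EuclideanSpace ℂ (V → Fin 2)) :
    withClocks Nc δ σ ψ = tens ψ (prodState (clockState δ σ)) := by
  ext c
  simp [withClocks, tens, confVec, prodState]

theorem mixedState_eq_prod (p χ : ZMod Nc → ℝ) (v : V) (κ : V → ZMod Nc) :
    mixedState p χ v κ = ∏ w, (if w = v then χ else p) (κ w) := by
  rw [mixedState, ← mul_prod_erase univ _ (mem_univ v), if_pos rfl]
  congr 1
  refine prod_congr rfl fun w hw => ?_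
  rw [if_neg (ne_of_mem_erase hw)]

theorem sum_prod_clock (F : V → ZMod Nc → ℝ) :
    ∑ κ : V → ZMod Nc, ∏ w, F w (κ w) = ∏ w, ∑ l, F w l := by
  rw [prod_univ_sum, Fintype.piFinset_univ]

theorem sum_prodState_sq {p : ZMod Nc → ℝ} (hp : ∑ l, p l ^ 2 = 1) :
    ∑ κ : V → ZMod Nc, prodState p κ ^ 2 = 1 := by
  simp only [prodState, ← prod_pow]
  rw [sum_prod_clock fun _ l => p l ^ 2]
  simp [hp]

theorem sum_mul_prodState_sq {p : ZMod Nc → ℝ} (hp : ∑ l, p l ^ 2 = 1) (g : ZMod Nc → ℝ) (v : V) :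
    ∑ κ : V → ZMod Nc, g (κ v) * prodState p κ ^ 2 = ∑ l, g l * p l ^ 2 := by
  have e : ∀ κ : V → ZMod Nc, g (κ v) * prodState p κ ^ 2
      = ∏ w, (if w = v then fun l => g l * p l ^ 2 else fun l => p l ^ 2) (κ w) := fun κ => by
    rw [← mixedState_eq_prod (fun l => p l ^ 2) (fun l => g l * p l ^ 2), mixedState, prodState,
      ← prod_pow, ← mul_prod_erase univ (fun w => p (κ w) ^ 2) (mem_univ v), mul_assoc]
  simp only [e]
  rw [sum_prod_clock, prod_eq_single v]
  · simp
  · intro w _ hw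
    simp [hw, hp]
  · simp

/-- Products with the replaced factor at different vertices are orthogonal, because χ is orthogonal
to p. The sum over vertices therefore costs N in square, not N². -/
theorem sum_mixedState_sq {p χ : ZMod Nc → ℝ} (hp : ∑ l, p l ^ 2 = 1)
    (hχ : ∑ l, χ l * p l = 0) :
    ∑ κ : V → ZMod Nc, (∑ v, mixedState p χ v κ) ^ 2 = Fintype.card V * ∑ l, χ l ^ 2 := by
  have e : ∀ v v', ∑ κ : V → ZMod Nc, mixedState p χ v κ * mixedState p χ v' κ
      = if v = v' then ∑ l, χ l ^ 2 else 0 := by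
    intro v v'
    simp only [mixedState_eq_prod, ← prod_mul_distrib]
    rw [sum_prod_clock fun w l => (if w = v then χ else p) l * (if w = v' then χ else p) l]
    split_ifs with h
    · subst h
      rw [prod_eq_single v]
      · simp [sq]
      · intro w _ hw
        simp [hw, ← sq, hp]
      · simp
    · refine prod_eq_zero (mem_univ v) ?_
      simp [h, hχ]
  simp only [sq (∑ v, mixedState p χ v _), sum_mul_sum]
  rw [sum_comm]
  have : ∀ v : V, ∑ κ : V → ZMod Nc, ∑ v', mixedState p χ v κ * mixedState p χ v' κ
      = ∑ l, χ l ^ 2 := fun v => by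
    rw [sum_comm]; simp only [e]; simp
  simp only [this]
  simp

/-- The operator depends on the clock at v alone. The other clocks integrate to one, which leaves
the mean square of its norm in the distribution p² of that clock. -/
theorem norm_controlled_vec_le {p : ZMod Nc → ℝ} (hp : ∑ l, p l ^ 2 = 1)
    (A : ZMod Nc → Op V (Fin 2)) (ξ : EuclideanSpace ℂ (V → Fin 2)) (v : V) :
    ‖confVec (Nc := Nc) fun q κ => Matrix.toEuclideanLin (A (κ v)) ξ q * (prodState p κ : ℂ)‖
      ≤ ‖ξ‖ * √(∑ l, ‖A l‖ ^ 2 * p l ^ 2) := by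
  refine abs_le_of_sq_le_sq' ?_ (by positivity) |>.2
  rw [norm_confVec_sq, mul_pow, Real.sq_sqrt (by positivity), ← sum_mul_prodState_sq hp _ v,
    mul_sum]
  refine sum_le_sum fun κ _ => ?_
  have e : ∑ q, ‖Matrix.toEuclideanLin (A (κ v)) ξ q * (prodState p κ : ℂ)‖ ^ 2
      = ‖Matrix.toEuclideanLin (A (κ v)) ξ‖ ^ 2 * prodState p κ ^ 2 := by
    rw [EuclideanSpace.norm_sq_eq, sum_mul]
    refine sum_congr rfl fun q _ => ?_
    rw [norm_mul, mul_pow, Complex.norm_real, Real.norm_eq_abs, sq_abs]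
  have h : ‖Matrix.toEuclideanLin (A (κ v)) ξ‖ ^ 2 ≤ (‖A (κ v)‖ * ‖ξ‖) ^ 2 :=
    pow_le_pow_left₀ (norm_nonneg _) (norm_toEuclideanLin_le _ _) 2
  rw [e]
  calc _ ≤ (‖A (κ v)‖ * ‖ξ‖) ^ 2 * prodState p κ ^ 2 := by gcongr
    _ = _ := by ring

/-! ### The action of the clock Hamiltonian -/

theorem clockShift_apply (v : V) (f : (V → Fin 2) → (V → ZMod Nc) → ℂ) :
    Matrix.toEuclideanLin (clockShift Nc v) (confVec f)
      = confVec fun q κ => f q (Function.update κ v (κ v - 1)) := by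
  ext c
  rw [toEuclideanLin_coord]
  have h : ∀ c' : V → Site Nc, c = Function.update c' v ((c' v).1, (c' v).2 + 1) ↔
      c' = Function.update c v ((c v).1, (c v).2 - 1) := by
    intro c'
    constructor
    · rintro rfl; simp
    · rintro rfl; simp
  simp only [clockShift, h, ite_mul, one_mul, zero_mul]
  rw [sum_ite_eq' univ, if_pos (mem_univ _), confVec_apply, confVec_apply]
  congr 1
  · ext w; by_cases hw : w = v <;> simp [hw, Function.update]
  · ext w; by_cases hw : w = v <;> simp [hw, Function.update]

theorem clockShift_conjTranspose_apply (v : V) (f : (V → Fin 2) → (V → ZMod Nc) → ℂ) :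
    Matrix.toEuclideanLin (clockShift Nc v).conjTranspose (confVec f)
      = confVec fun q κ => f q (Function.update κ v (κ v + 1)) := by
  ext c
  rw [toEuclideanLin_coord]
  simp only [clockShift, Matrix.conjTranspose_apply, apply_ite star, star_one, star_zero, ite_mul,
    one_mul, zero_mul]
  rw [sum_ite_eq' univ, if_pos (mem_univ _), confVec_apply, confVec_apply]
  congr 1
  · ext w; by_cases hw : w = v <;> simp [hw, Function.update]
  · ext w; by_cases hw : w = v <;> simp [hw, Function.update]

theorem prodState_update (p : ZMod Nc → ℝ) (κ : V → ZMod Nc) (v : V) (l : ZMod Nc) :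
    prodState p (Function.update κ v l) = p l * ∏ w ∈ univ.erase v, p (κ w) := by
  rw [prodState, ← mul_prod_erase univ _ (mem_univ v), Function.update_self]
  congr 1
  refine prod_congr rfl fun w hw => ?_
  rw [Function.update_of_ne (ne_of_mem_erase hw)]

theorem momentum_apply_tens (δ : ℝ) (ξ : EuclideanSpace ℂ (V → Fin 2)) (p : ZMod Nc → ℝ) :
    Matrix.toEuclideanLin (momentum V Nc δ) (tens ξ (prodState p))
      = (Complex.I / δ) • tens ξ (fun κ =>
        ∑ v, mixedState p (fun l => (p (l - 1) - p (l + 1)) / 2) v κ) := by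
  rw [momentum, map_sum, LinearMap.sum_apply]
  simp only [map_smul, map_sub, LinearMap.smul_apply, LinearMap.sub_apply, tens,
    clockShift_apply, clockShift_conjTranspose_apply, prodState_update]
  ext c
  simp only [WithLp.ofLp_sum, Finset.sum_apply, PiLp.smul_apply, PiLp.sub_apply, confVec_apply,
    mixedState, smul_eq_mul]
  push_cast
  rw [mul_sum, mul_sum]
  refine sum_congr rfl fun v _ => ?_
  ring

theorem onQubits_apply (A : Op V (Fin 2)) (f : (V → Fin 2) → (V → ZMod Nc) → ℂ) :
    Matrix.toEuclideanLin (onQubits Nc A) (confVec f)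
      = confVec fun q κ => ∑ q', A q q' * f q' κ := by
  ext c
  rw [toEuclideanLin_coord]
  have h : ∀ c' : V → Site Nc, (∀ v, (c v).2 = (c' v).2) ↔
      (fun v => (c' v).2) = fun v => (c v).2 := fun c' =>
    ⟨fun h => funext fun v => (h v).symm, fun h v => (congrFun h v).symm⟩
  simp only [onQubits, h, confVec_apply]
  rw [sum_config fun q' κ' => (if κ' = fun v => (c v).2 then A (fun v => (c v).1) q' else 0)
    * f q' κ', Fintype.sum_eq_single (fun v => (c v).2)]
  · simp
  · intro κ' hκ
    simp [hκ]

theorem clockProj_apply (v : V) (k : ZMod Nc) (f : (V → Fin 2) → (V → ZMod Nc) → ℂ) :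
    Matrix.toEuclideanLin (clockProj v k) (confVec f)
      = confVec fun q κ => if κ v = k then f q κ else 0 := by
  ext c
  rw [toEuclideanLin_coord, clockProj, Fintype.sum_eq_single c]
  · simp [confVec_apply]
  · intro c' hc
    rw [Matrix.diagonal_apply_ne _ hc.symm, zero_mul]

theorem toEuclideanLin_mul_apply {m : Type*} [Fintype m] [DecidableEq m] (A B : Matrix m m ℂ)
    (ξ : EuclideanSpace ℂ m) : Matrix.toEuclideanLin (A * B) ξ
      = Matrix.toEuclideanLin A (Matrix.toEuclideanLin B ξ) := by
  ext i
  change ((A * B).mulVec ξ) i = (A.mulVec (B.mulVec ξ)) i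
  rw [Matrix.mulVec_mulVec]

variable {G : SimpleGraph V} [Fintype G.edgeSet]

theorem controlled_apply_tens (δ : ℝ) (ρ : G.edgeSet → V) (F : G.edgeSet ⊕ V → ℝ → Op V (Fin 2))
    (ξ : EuclideanSpace ℂ (V → Fin 2)) (Θ : (V → ZMod Nc) → ℝ) :
    Matrix.toEuclideanLin (controlled Nc δ ρ F) (tens ξ Θ)
      = ∑ x, confVec fun q κ =>
        Matrix.toEuclideanLin (F x ((κ (Sum.elim ρ id x)).val * δ)) ξ q * (Θ κ : ℂ) := by
  rw [controlled, map_sum, LinearMap.sum_apply]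
  simp only [map_sum, LinearMap.sum_apply]
  rw [sum_comm]
  refine sum_congr rfl fun x _ => ?_
  simp only [toEuclideanLin_mul_apply, tens, clockProj_apply, onQubits_apply]
  ext c
  simp only [WithLp.ofLp_sum, Finset.sum_apply, confVec_apply]
  rw [Fintype.sum_eq_single (c (Sum.elim ρ id x)).2]
  · simp only [if_true, toEuclideanLin_coord, sum_mul, mul_assoc]
  · intro k hk
    simp [hk.symm]

/-! ### Hermiticity -/

theorem isHermitian_momentum (δ : ℝ) (v : V) :
    ((Complex.I / (2 * δ)) • (clockShift Nc v - (clockShift Nc v).conjTranspose)).IsHermitian := by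
  rw [Matrix.IsHermitian, Matrix.conjTranspose_smul, Matrix.conjTranspose_sub,
    Matrix.conjTranspose_conjTranspose]
  have : star (Complex.I / (2 * δ)) = -(Complex.I / (2 * δ)) := by
    simp [neg_div]
  rw [this, neg_smul, ← smul_neg, neg_sub]

theorem onQubits_mul_clockProj_apply (A : Op V (Fin 2)) (v : V) (k : ZMod Nc) (c c' : V → Site Nc) :
    (onQubits Nc A * clockProj v k) c c'
      = if (∀ w, (c w).2 = (c' w).2) ∧ (c v).2 = k
        then A (fun w => (c w).1) (fun w => (c' w).1) else 0 := by
  rw [clockProj, Matrix.mul_diagonal, onQubits]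
  by_cases h : ∀ w, (c w).2 = (c' w).2
  · simp only [h, implies_true, true_and, if_true, mul_ite, mul_one, mul_zero]
  · simp [h]

theorem isHermitian_onQubits_mul_clockProj {A : Op V (Fin 2)} (hA : A.IsHermitian) (v : V)
    (k : ZMod Nc) : (onQubits Nc A * clockProj v k).IsHermitian := by
  ext c c'
  rw [Matrix.conjTranspose_apply, onQubits_mul_clockProj_apply, onQubits_mul_clockProj_apply]
  have h : ((∀ w, (c' w).2 = (c w).2) ∧ (c' v).2 = k) ↔
      ((∀ w, (c w).2 = (c' w).2) ∧ (c v).2 = k) :=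
    ⟨fun ⟨h, h'⟩ => ⟨fun w => (h w).symm, (h v) ▸ h'⟩,
      fun ⟨h, h'⟩ => ⟨fun w => (h w).symm, (h v) ▸ h'⟩⟩
  simp only [h]
  split_ifs
  · exact hA.apply _ _
  · exact star_zero _

end vectors

end WWRL

namespace WWRL

open MeasureTheory Set Filter Topology

/-! ### Calculus with matrices and coordinates -/

section calculus

variable {m : Type*} [Fintype m] [DecidableEq m]

theorem hasDerivAt_entry {A : ℝ → Matrix m m ℂ} {A' : Matrix m m ℂ} {t : ℝ}
    (h : HasDerivAt A A' t) (i j : m) : HasDerivAt (fun t => A t i j) (A' i j) t :=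
  ((Matrix.entryLinearMap ℝ ℂ i j).toContinuousLinearMap.hasFDerivAt (x := A t)).comp_hasDerivAt t h

theorem continuousOn_entry {A : ℝ → Matrix m m ℂ} {s : Set ℝ}
    (h : ContinuousOn A s) (i j : m) : ContinuousOn (fun t => A t i j) s :=
  (Matrix.entryLinearMap ℝ ℂ i j).toContinuousLinearMap.continuous.comp_continuousOn h

theorem hasDerivAt_euclidean_iff {f : ℝ → EuclideanSpace ℂ m} {f' : EuclideanSpace ℂ m} {t : ℝ} :
    HasDerivAt f f' t ↔ ∀ i, HasDerivAt (fun t => f t i) (f' i) t := by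
  constructor
  · intro h i
    exact ((PiLp.proj (𝕜 := ℝ) 2 (fun _ : m => ℂ) i).hasFDerivAt (x := f t)).comp_hasDerivAt t h
  · intro h
    exact ((PiLp.continuousLinearEquiv 2 ℝ (fun _ : m => ℂ)).symm.toContinuousLinearMap.hasFDerivAt
      (x := fun i => f t i)).comp_hasDerivAt t (hasDerivAt_pi.mpr h)

theorem continuousOn_euclidean_iff {f : ℝ → EuclideanSpace ℂ m} {s : Set ℝ} :
    ContinuousOn f s ↔ ∀ i, ContinuousOn (fun t => f t i) s := by
  rw [← continuousOn_pi (f := fun t i => f t i)]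
  exact ((PiLp.continuousLinearEquiv 2 ℝ (fun _ : m => ℂ)).comp_continuousOn_iff (f := f)).symm

theorem hasDerivAt_toEuclideanLin {A : ℝ → Matrix m m ℂ} {A' : Matrix m m ℂ}
    {ξ : ℝ → EuclideanSpace ℂ m} {ξ' : EuclideanSpace ℂ m} {t : ℝ}
    (hA : HasDerivAt A A' t) (hξ : HasDerivAt ξ ξ' t) :
    HasDerivAt (fun t => Matrix.toEuclideanLin (A t) (ξ t))
      (Matrix.toEuclideanLin A' (ξ t) + Matrix.toEuclideanLin (A t) ξ') t := by
  rw [hasDerivAt_euclidean_iff] at hξ ⊢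
  intro i
  simp only [PiLp.add_apply, toEuclideanLin_coord, ← Finset.sum_add_distrib]
  exact HasDerivAt.fun_sum fun j _ => (hasDerivAt_entry hA i j).mul (hξ j)

theorem continuousOn_toEuclideanLin {A : ℝ → Matrix m m ℂ} {ξ : ℝ → EuclideanSpace ℂ m}
    {s : Set ℝ} (hA : ContinuousOn A s) (hξ : ContinuousOn ξ s) :
    ContinuousOn (fun t => Matrix.toEuclideanLin (A t) (ξ t)) s := by
  rw [continuousOn_euclidean_iff] at hξ ⊢
  intro i
  simp only [toEuclideanLin_coord]
  exact continuousOn_finsetSum _ fun j _ => (continuousOn_entry hA i j).mul (hξ j)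

theorem toEuclideanLin_add_apply (A B : Matrix m m ℂ) (ξ : EuclideanSpace ℂ m) :
    Matrix.toEuclideanLin (A + B) ξ = Matrix.toEuclideanLin A ξ + Matrix.toEuclideanLin B ξ := by
  rw [map_add, LinearMap.add_apply]

theorem toEuclideanLin_smul_apply (z : ℂ) (A : Matrix m m ℂ) (ξ : EuclideanSpace ℂ m) :
    Matrix.toEuclideanLin (z • A) ξ = z • Matrix.toEuclideanLin A ξ := by
  rw [map_smul, LinearMap.smul_apply]

theorem toEuclideanLin_one_apply (ξ : EuclideanSpace ℂ m) :
    Matrix.toEuclideanLin (1 : Matrix m m ℂ) ξ = ξ := by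
  ext i
  change ((1 : Matrix m m ℂ).mulVec ξ) i = _
  rw [Matrix.one_mulVec]

/-- The Heisenberg propagator `exp (i A t)`. -/
noncomputable def propagator (A : Matrix m m ℂ) (t : ℝ) : Matrix m m ℂ :=
  NormedSpace.exp (t • (Complex.I • A))

theorem hasDerivAt_propagator (A : Matrix m m ℂ) (t : ℝ) :
    HasDerivAt (propagator A) (propagator A t * (Complex.I • A)) t :=
  hasDerivAt_exp_smul_const _ t

theorem propagator_mem_unitary {A : Matrix m m ℂ} (hA : A.IsHermitian) (t : ℝ) :
    propagator A t ∈ unitary (Matrix m m ℂ) := by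
  have h : IsSelfAdjoint (t • A) := (IsSelfAdjoint.all t).smul hA
  rw [propagator, smul_comm, ← selfAdjoint.expUnitary_coe ⟨t • A, h⟩]
  exact Subtype.property _

theorem norm_propagator_le [Nonempty m] {A : Matrix m m ℂ} (hA : A.IsHermitian) (t : ℝ) :
    ‖propagator A t‖ ≤ 1 :=
  norm_le_one_of_star_mul_self (Unitary.star_mul_self_of_mem (propagator_mem_unitary hA t))

theorem propagator_neg_mul (A : Matrix m m ℂ) (t : ℝ) :
    propagator A (-t) * propagator A t = 1 := by
  rw [propagator, propagator, ← Matrix.exp_add_of_commute]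
  · simp
  · exact (Commute.refl (Complex.I • A)).smul_left (-t) |>.smul_right t

theorem propagator_zero (A : Matrix m m ℂ) : propagator A 0 = 1 := by
  simp [propagator]

theorem propagator_neg (A : Matrix m m ℂ) (t : ℝ) :
    propagator A (-t) = NormedSpace.exp ((-Complex.I * t) • A) := by
  rw [propagator]
  congr 1
  ext i j
  simp
  ring

end calculus

section tensor

variable {V : Type u} [Fintype V] [DecidableEq V] {Nc : ℕ} [NeZero Nc]

theorem hasDerivAt_tens {ξ : ℝ → EuclideanSpace ℂ (V → Fin 2)} {ξ' : EuclideanSpace ℂ (V → Fin 2)}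
    {p : ℝ → ZMod Nc → ℝ} {p' : ZMod Nc → ℝ} {t : ℝ} (hξ : HasDerivAt ξ ξ' t)
    (hp : ∀ l, HasDerivAt (fun t => p t l) (p' l) t) :
    HasDerivAt (fun t => tens (ξ t) (prodState (p t)))
      (tens ξ' (prodState (p t)) + tens (ξ t) fun κ => ∑ v, mixedState (p t) p' v κ) t := by
  rw [hasDerivAt_euclidean_iff] at hξ ⊢
  intro c
  simp only [PiLp.add_apply, tens, confVec_apply]
  have h : HasDerivAt (fun t => prodState (p t) fun v => (c v).2)
      (∑ v, mixedState (p t) p' v fun v => (c v).2) t := by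
    refine (HasDerivAt.fun_finsetProd (u := Finset.univ) (f := fun v t => p t (c v).2)
      fun v _ => hp (c v).2).congr_deriv ?_
    refine Finset.sum_congr rfl fun v _ => ?_
    rw [mixedState, smul_eq_mul, mul_comm]
  exact (hξ _).mul h.ofReal_comp

theorem continuousOn_tens {ξ : ℝ → EuclideanSpace ℂ (V → Fin 2)} {p : ℝ → ZMod Nc → ℝ}
    {s : Set ℝ} (hξ : ContinuousOn ξ s) (hp : ∀ l, ContinuousOn (fun t => p t l) s) :
    ContinuousOn (fun t => tens (ξ t) (prodState (p t))) s := by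
  rw [continuousOn_euclidean_iff] at hξ ⊢
  intro c
  simp only [tens, confVec_apply, prodState]
  exact (hξ _).mul (Complex.continuous_ofReal.comp_continuousOn
    (continuousOn_finsetProd _ fun v _ => hp (c v).2))

variable {G : SimpleGraph V} [Fintype G.edgeSet] {T : ℝ}

/-- The defect of a product path relative to the clock evolution. -/
theorem clock_defect (ρ : G.edgeSet → V) (F : G.edgeSet ⊕ V → ℝ → Op V (Fin 2)) {δ : ℝ}
    (hδ : δ ≠ 0) (t : ℝ) (ξ η : EuclideanSpace ℂ (V → Fin 2)) (p χ : ZMod Nc → ℝ) :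
    Matrix.toEuclideanLin (Complex.I • (momentum V Nc δ + controlled Nc δ ρ F))
        (tens ξ (prodState p))
      + (tens (-Complex.I • Matrix.toEuclideanLin (∑ x, F x t) ξ + η) (prodState p)
        + tens ξ fun κ => ∑ v, mixedState p
          (fun l => (χ l + (p (l - 1) - p (l + 1)) / 2) / δ) v κ)
    = Complex.I • (∑ x, confVec fun q κ =>
        Matrix.toEuclideanLin (F x ((κ (Sum.elim ρ id x)).val * δ) - F x t) ξ q
          * (prodState p κ : ℂ))
      + tens η (prodState p)
      + (δ : ℂ)⁻¹ • tens ξ fun κ => ∑ v, mixedState p χ v κ := by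
  -- The discrete derivative in the packet velocity cancels the momentum term because i² = -1, and
  -- the drift turns each controlled value into its difference from the value at time t.
  rw [toEuclideanLin_smul_apply, toEuclideanLin_add_apply, momentum_apply_tens,
    controlled_apply_tens]
  have hδ' : (δ : ℂ) ≠ 0 := Complex.ofReal_ne_zero.mpr hδ
  ext c
  simp only [map_sum, LinearMap.sum_apply, map_sub, LinearMap.sub_apply, PiLp.add_apply, tens,
    PiLp.smul_apply, confVec_apply, WithLp.ofLp_sum, Finset.sum_apply, PiLp.sub_apply, mixedState,
    smul_eq_mul]
  push_cast
  simp only [sub_mul, Finset.sum_sub_distrib, add_div, add_mul, Finset.sum_add_distrib,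
    ← Finset.sum_mul, div_mul_eq_mul_div, ← Finset.sum_div]
  generalize ∑ x, Matrix.toEuclideanLin (F x ((c (Sum.elim ρ id x)).2.val * δ)) ξ
    (fun v => (c v).1) = S1
  generalize ∑ x, Matrix.toEuclideanLin (F x t) ξ (fun v => (c v).1) = S2
  generalize ∑ v, (p ((c v).2 - 1) : ℂ) * ∏ w ∈ Finset.univ.erase v, (p (c w).2 : ℂ) = S3
  generalize ∑ v, (p ((c v).2 + 1) : ℂ) * ∏ w ∈ Finset.univ.erase v, (p (c w).2 : ℂ) = S4
  field_simp
  linear_combination (ξ (fun v => (c v).1) * (S3 - S4)) * Complex.I_sq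

theorem isHermitian_clockHamiltonian (H : TimeDepHamiltonian G T) (ρ : G.edgeSet → V) (s : ℝ) :
    (clockHamiltonian H ρ s Nc).IsHermitian := by
  have hs : ∀ {ι : Type u} (S : Finset ι) (f : ι → Op V (Site Nc)), (∀ i ∈ S, (f i).IsHermitian) →
      (∑ i ∈ S, f i).IsHermitian := fun S f hf => by
    rw [Matrix.IsHermitian, Matrix.conjTranspose_sum]
    exact Finset.sum_congr rfl hf
  have hs' : ∀ {ι : Type} (S : Finset ι) (f : ι → Op V (Site Nc)), (∀ i ∈ S, (f i).IsHermitian) →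
      (∑ i ∈ S, f i).IsHermitian := fun S f hf => by
    rw [Matrix.IsHermitian, Matrix.conjTranspose_sum]
    exact Finset.sum_congr rfl hf
  refine Matrix.IsHermitian.add (hs _ _ fun v _ => isHermitian_momentum _ v)
    (hs' _ _ fun k _ => hs _ _ fun x _ => isHermitian_onQubits_mul_clockProj ?_ _ k)
  exact isSelfAdjoint_mollify (fun t ht => H.isHermitian x t ht) _

end tensor

end WWRL

namespace WWRL

open MeasureTheory Set Filter Topology

/-! ### Estimates along the clock path -/

section ring

variable {Nc : ℕ} [NeZero Nc]

theorem cyclicDist_sub_of_le (l : ZMod Nc) {m : ℕ} (h : m ≤ l.val) :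
    cyclicDist (l - (m : ZMod Nc)) = min (l.val - m) (Nc - (l.val - m)) := by
  have hl := ZMod.val_lt l
  have e : l - (m : ZMod Nc) = ((l.val - m : ℕ) : ZMod Nc) := by
    rw [Nat.cast_sub h, ZMod.natCast_zmod_val]
  rw [cyclicDist, e, ZMod.val_natCast_of_lt (by omega)]

theorem cyclicDist_sub_of_lt (l : ZMod Nc) {m : ℕ} (h : l.val < m) (hm : m ≤ Nc) :
    cyclicDist (l - (m : ZMod Nc)) = min (m - l.val) (Nc - (m - l.val)) := by
  have e : l - (m : ZMod Nc) = ((Nc - (m - l.val) : ℕ) : ZMod Nc) := by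
    rw [Nat.cast_sub (by omega), Nat.cast_sub h.le, ZMod.natCast_zmod_val, ZMod.natCast_self]
    ring
  rw [cyclicDist, e, ZMod.val_natCast_of_lt (by omega)]
  omega

variable {E : Type*} [NormedAddCommGroup E] [NormedSpace ℝ E] [CompleteSpace E] {T s C : ℝ}
  {F : ℝ → E}

/-- The mollification is Lipschitz on the clock ring. -/
theorem norm_mollify_val_sub_le (hT : 0 < T) (hs : 0 < s) (hs' : s ≤ T / 4)
    (hF : PiecewiseContinuousOn F 0 T) (hC : ∀ t ∈ Icc 0 T, ‖F t‖ ≤ C) (l : ZMod Nc) {m : ℕ}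
    (hm : m ≤ Nc) :
    ‖mollify T s F (l.val * (T / Nc)) - mollify T s F (m * (T / Nc))‖
      ≤ 4 * C * bump s 0 * (T / Nc) * cyclicDist (l - (m : ZMod Nc)) := by
  have hN : (0 : ℝ) < Nc := Nat.cast_pos.mpr (NeZero.pos Nc)
  have hδ : 0 < T / Nc := by positivity
  have hC0 : 0 ≤ C := (norm_nonneg _).trans (hC 0 ⟨le_rfl, hT.le⟩)
  have hb := bump_nonneg hs 0
  have hlip := norm_mollify_sub_le hT.le hs hF hC
  have h0 : mollify T s F 0 = 0 := mollify_eq_zero hs' (Or.inl le_rfl)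
  have hTT : mollify T s F (Nc * (T / Nc)) = 0 :=
    mollify_eq_zero hs' (Or.inr (by rw [mul_div_cancel₀ _ hN.ne']))
  -- Two routes join the times: the direct one, and the one through the ends, where the mollified
  -- function vanishes. The shorter of them is the cyclic distance.
  have key : ∀ a b : ℕ, a ≤ b → b ≤ Nc →
      ‖mollify T s F (b * (T / Nc)) - mollify T s F (a * (T / Nc))‖
      ≤ 4 * C * bump s 0 * (T / Nc) * (min (b - a) (Nc - (b - a)) : ℕ) := by
    intro a b hab hb'
    have hab' : (a : ℝ) ≤ b := by exact_mod_cast hab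
    have hbN : (b : ℝ) ≤ Nc := by exact_mod_cast hb'
    rw [Nat.cast_min, mul_min_of_nonneg _ _ (by positivity), Nat.cast_sub (show b - a ≤ Nc by omega),
      Nat.cast_sub hab]
    refine le_min ?_ ?_
    · refine (hlip _ _).trans_eq ?_
      rw [← sub_mul, abs_mul, abs_of_pos hδ, abs_of_nonneg (by linarith)]; ring
    · have h1 := hlip (b * (T / Nc)) (Nc * (T / Nc))
      have h2 := hlip 0 (a * (T / Nc))
      rw [hTT, sub_zero, ← sub_mul, abs_mul, abs_of_pos hδ, abs_of_nonpos (by linarith)] at h1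
      rw [h0, zero_sub, norm_neg, zero_sub, abs_neg, abs_of_nonneg (by positivity)] at h2
      refine (norm_sub_le _ _).trans ((add_le_add h1 h2).trans_eq ?_)
      ring
  rcases le_or_gt m l.val with h | h
  · rw [cyclicDist_sub_of_le l h]
    exact key m l.val h (ZMod.val_lt l).le
  · rw [cyclicDist_sub_of_lt l h hm, norm_sub_rev]
    exact key l.val m h.le hm

/-- Off the true time, the clock control errs by little in the interpolated clock state. -/
theorem sqrt_control_le {M : ℕ} {σ : ℝ} (hM : Nc = 2 * M) (hT : 0 < T) (hs : 0 < s)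
    (hs' : s ≤ T / 4) (hσ : 0 < σ) (hr : T / Nc / σ ≤ 1 / 4)
    (hF : PiecewiseContinuousOn F 0 T) (hC : ∀ t ∈ Icc 0 T, ‖F t‖ ≤ C) {m : ℕ} (hm : m < Nc)
    {t : ℝ} (ht : t ∈ Icc (0 : ℝ) 1) :
    √(∑ l : ZMod Nc, ‖mollify T s F (l.val * (T / Nc)) - mollify T s F ((m + t) * (T / Nc))‖ ^ 2
      * packet (fun l => clockState (T / Nc) σ (l - (m : ZMod Nc))) t l ^ 2)
      ≤ C * min (15 / 4 * σ * bump s 0) 4 := by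
  have hN : (0 : ℝ) < Nc := Nat.cast_pos.mpr (NeZero.pos Nc)
  set δ := T / Nc with hδd
  have hδ : 0 < δ := by positivity
  have hC0 : 0 ≤ C := (norm_nonneg _).trans (hC 0 ⟨le_rfl, hT.le⟩)
  have hb := bump_nonneg hs 0
  set a : ZMod Nc → ℝ := fun l => clockState δ σ (l - (m : ZMod Nc)) with ha
  have ha0 : ∀ l, 0 ≤ a l := fun l => clockState_nonneg _
  have ha1 : ∑ l, a l ^ 2 = 1 := by
    rw [ha, sum_comp_sub (fun l => clockState δ σ l ^ 2), sum_clockState_sq]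
  have hp := sum_packet_sq ha0 ha1 ht
  rw [mul_min_of_nonneg _ _ hC0]
  refine le_min ?_ ?_
  -- The Lipschitz alternative. The distance to the true time is estimated through either adjacent
  -- grid time, as the moment bound requires, and 4√(7/8) ≤ 15/4.
  · set d : ZMod Nc → ℝ := fun l => cyclicDist (l - (m : ZMod Nc)) with hd
    have hd0 : ∀ l, 0 ≤ d l := fun l => Nat.cast_nonneg _
    have ht1 : 0 ≤ 1 - t := by linarith [ht.2]
    have hmom : (δ / σ) ^ 2 * ∑ l, d l ^ 2 * a l ^ 2 ≤ 2835 / 10000 := by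
      have := sum_dist_sq_mul_clockState_sq_le (Nc := Nc) (δ := δ) (σ := σ) hM
        (by positivity) hr
      rwa [← sum_comp_sub _ (m : ZMod Nc)] at this
    have h2 := sum_sq_mul_packet_sq_le ha0 ha1 (t := t) (r := δ / σ) (by positivity) hr hd0 hmom
      (κ := fun l => min (d l + t) (d (l - 1) + (1 - t)))
      (fun l => le_min (add_nonneg (hd0 _) ht.1) (add_nonneg (hd0 _) ht1))
      (fun l => min_le_left _ _) (fun l => min_le_right _ _) ht
    have hL : ∀ l : ZMod Nc, ‖mollify T s F (l.val * δ) - mollify T s F ((m + t) * δ)‖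
        ≤ 4 * C * bump s 0 * δ * min (d l + t) (d (l - 1) + (1 - t)) := by
      intro l
      rw [mul_min_of_nonneg _ _ (by positivity)]
      refine le_min ?_ ?_
      · have h1 := norm_mollify_val_sub_le hT hs hs' hF hC l hm.le
        have h2 := norm_mollify_sub_le hT.le hs hF hC (m * δ) ((m + t) * δ)
        rw [show (m : ℝ) * δ - (m + t) * δ = -(t * δ) by ring, abs_neg,
          abs_of_nonneg (mul_nonneg ht.1 hδ.le)] at h2
        refine (norm_sub_le_norm_sub_add_norm_sub _ (mollify T s F (m * δ)) _).trans
          ((add_le_add h1 h2).trans_eq ?_)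
        rw [hd]; ring
      · have h1 := norm_mollify_val_sub_le hT hs hs' hF hC l (m := m + 1) hm
        have h2 := norm_mollify_sub_le hT.le hs hF hC ((m + 1 : ℕ) * δ) ((m + t) * δ)
        rw [show ((m + 1 : ℕ) : ℝ) * δ - (m + t) * δ = (1 - t) * δ by push_cast; ring,
          abs_of_nonneg (mul_nonneg ht1 hδ.le)] at h2
        refine (norm_sub_le_norm_sub_add_norm_sub _ (mollify T s F ((m + 1 : ℕ) * δ)) _).trans
          ((add_le_add h1 h2).trans_eq ?_)
        have e : l - ((m + 1 : ℕ) : ZMod Nc) = l - 1 - (m : ZMod Nc) := by push_cast; ring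
        rw [hd, e]; ring
    refine Real.sqrt_le_iff.mpr ⟨by positivity, ?_⟩
    calc _ ≤ ∑ l : ZMod Nc, (4 * C * bump s 0 * δ * min (d l + t) (d (l - 1) + (1 - t))) ^ 2
          * packet a t l ^ 2 := by
          gcongr with l
          exact hL l
      _ = (4 * C * bump s 0 * σ) ^ 2 * ((δ / σ) ^ 2 *
          ∑ l : ZMod Nc, min (d l + t) (d (l - 1) + (1 - t)) ^ 2 * packet a t l ^ 2) := by
          rw [Finset.mul_sum, Finset.mul_sum]
          refine Finset.sum_congr rfl fun l _ => ?_
          field_simp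
      _ ≤ (4 * C * bump s 0 * σ) ^ 2 * (7 / 8) := by gcongr
      _ ≤ _ := by
          have : 0 ≤ (C * σ * bump s 0) ^ 2 := sq_nonneg _
          nlinarith
  -- The crude alternative: both mollified values are at most 2C in norm.
  · refine Real.sqrt_le_iff.mpr ⟨by positivity, ?_⟩
    have hb : ∀ t, ‖mollify T s F t‖ ≤ C * 2 := fun t =>
      (norm_mollify_le hT.le hs hC t).trans (by gcongr; exact mollify_one_le hT.le hs t)
    calc _ ≤ ∑ l : ZMod Nc, (C * 4) ^ 2 * packet a t l ^ 2 := by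
          gcongr with l
          refine (norm_sub_le _ _).trans ((add_le_add (hb _) (hb _)).trans_eq ?_)
          ring
      _ = _ := by rw [← Finset.mul_sum, hp, mul_one]

end ring

section path

variable {V : Type u} [Fintype V] [DecidableEq V] {Nc : ℕ} [NeZero Nc]
  {G : SimpleGraph V} [Fintype G.edgeSet] {T : ℝ}

theorem norm_defect_le (ρ : G.edgeSet → V) (F : G.edgeSet ⊕ V → ℝ → Op V (Fin 2)) {δ : ℝ}
    (hδ : 0 < δ) (t : ℝ) (ξ η : EuclideanSpace ℂ (V → Fin 2)) {p χ : ZMod Nc → ℝ}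
    (hp : ∑ l, p l ^ 2 = 1) (hχ : ∑ l, χ l * p l = 0) :
    ‖Complex.I • (∑ x, confVec fun q κ =>
        Matrix.toEuclideanLin (F x ((κ (Sum.elim ρ id x)).val * δ) - F x t) ξ q
          * (prodState p κ : ℂ))
      + tens η (prodState p)
      + (δ : ℂ)⁻¹ • tens ξ fun κ => ∑ v, mixedState p χ v κ‖
    ≤ ‖ξ‖ * ∑ x, √(∑ l : ZMod Nc, ‖F x (l.val * δ) - F x t‖ ^ 2 * p l ^ 2)
      + ‖η‖ + δ⁻¹ * (‖ξ‖ * √(Fintype.card V * ∑ l, χ l ^ 2)) := by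
  refine (norm_add_le _ _).trans (add_le_add ((norm_add_le _ _).trans (add_le_add ?_ ?_)) ?_)
  · rw [norm_smul, Complex.norm_I, one_mul, Finset.mul_sum]
    exact norm_sum_le_of_le _ fun x _ =>
      norm_controlled_vec_le hp (fun l => F x (l.val * δ) - F x t) ξ (Sum.elim ρ id x)
  · refine (pow_le_pow_iff_left₀ (norm_nonneg _) (norm_nonneg _) two_ne_zero).mp ?_
    rw [norm_tens_sq, sum_prodState_sq hp, mul_one]
  · rw [norm_smul, norm_inv, Complex.norm_real, Real.norm_of_nonneg hδ.le]
    gcongr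
    refine (pow_le_pow_iff_left₀ (norm_nonneg _) (by positivity) two_ne_zero).mp ?_
    rw [norm_tens_sq, sum_mixedState_sq hp hχ, mul_pow, Real.sq_sqrt]
    exact mul_nonneg (Nat.cast_nonneg _) (Finset.sum_nonneg fun _ _ => sq_nonneg _)

end path

end WWRL

namespace WWRL

open MeasureTheory Set Filter Topology

/-! ### The clock path and its total error. -/

section path

variable {V : Type u} [Fintype V] [DecidableEq V] {Nc M : ℕ} [NeZero Nc]
  {G : SimpleGraph V} [Fintype G.edgeSet] {T s σ : ℝ}

/-- The rate of the total error along the clock path. -/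
noncomputable def errorRate (N Nc : ℕ) (h T s σ t : ℝ) : ℝ :=
  11 / 10 * (h * min (15 / 4 * σ * bump s 0) 4)
    + 3 / 4 * h * s * (h * (mollify T s (fun _ => (1 : ℝ)) t + compress T (fun _ => (1 : ℝ)) t))
    + (T / Nc)⁻¹ * (11 / 10 * √(N * (13 * (T / Nc / σ) ^ 4)))

theorem intervalIntegrable_errorRate (N Nc : ℕ) (h σ : ℝ) (hT : 0 < T) (hs : 0 < s) (a b : ℝ) :
    IntervalIntegrable (errorRate N Nc h T s σ) volume a b := by
  have hF := piecewiseContinuousOn_const (1 : ℝ) 0 T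
  have h1 := (continuous_mollify hT.le hs hF).intervalIntegrable (μ := volume) a b
  have h2 := (integrable_compress hT.le hF).intervalIntegrable (a := a) (b := b)
  exact (intervalIntegrable_const.add (((h1.add h2).const_mul h).const_mul (3 / 4 * h * s))).add
    intervalIntegrable_const

/-- The mollified and the compressed unit functions both have integral T, so the residue rate
(3/4)h²s doubles to (3/2)h²s. -/
theorem integral_errorRate (N Nc : ℕ) (h σ : ℝ) (hT : 0 < T) (hs : 0 < s) (hs' : s ≤ T / 4) :
    ∫ t in (0 : ℝ)..T, errorRate N Nc h T s σ t
      = 11 / 10 * (h * min (15 / 4 * σ * bump s 0) 4) * T + 3 / 2 * h ^ 2 * s * T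
        + T * ((T / Nc)⁻¹ * (11 / 10 * √(N * (13 * (T / Nc / σ) ^ 4)))) := by
  have hF := piecewiseContinuousOn_const (1 : ℝ) 0 T
  have h1 := (continuous_mollify hT.le hs hF).intervalIntegrable (μ := volume) 0 T
  have h2 := (integrable_compress hT.le hF).intervalIntegrable (a := 0) (b := T)
  have h3 := ((h1.add h2).const_mul h).const_mul (3 / 4 * h * s)
  simp only [errorRate]
  rw [intervalIntegral.integral_add (intervalIntegrable_const.add h3) intervalIntegrable_const,
    intervalIntegral.integral_add intervalIntegrable_const h3,
    intervalIntegral.integral_const_mul (3 / 4 * h * s), intervalIntegral.integral_const_mul h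
      (fun t => mollify T s (fun _ => (1 : ℝ)) t + compress T (fun _ => (1 : ℝ)) t),
    intervalIntegral.integral_add h1 h2, integral_mollify_one hT.le hs hs',
    integral_compress_one hT, intervalIntegral.integral_const, intervalIntegral.integral_const]
  simp only [smul_eq_mul]
  ring

/-- The clock state after `m` steps. -/
noncomputable def shiftedClock (Nc : ℕ) [NeZero Nc] (δ σ : ℝ) (m : ℕ) (l : ZMod Nc) : ℝ :=
  clockState δ σ (l - (m : ZMod Nc))

theorem sum_shiftedClock_sq (δ σ : ℝ) (m : ℕ) : ∑ l, shiftedClock Nc δ σ m l ^ 2 = 1 := by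
  simp only [shiftedClock]
  rw [sum_comp_sub (fun l => clockState δ σ l ^ 2), sum_clockState_sq]

theorem shiftedClock_succ (δ σ : ℝ) (m : ℕ) :
    shiftedClock Nc δ σ (m + 1) = fun l => shiftedClock Nc δ σ m (l - 1) := by
  ext l
  simp only [shiftedClock]
  congr 1
  push_cast; ring

/-- One clock step of the path that follows the corrected evolution. -/
theorem norm_clock_step_le (hT : 0 < T) (hs : 0 < s) (hs' : s ≤ T / 4) (hσ : 0 < σ)
    (hM : Nc = 2 * M) (H : TimeDepHamiltonian G T) (ρ : G.edgeSet → V)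
    (hr : T / Nc / σ ≤ 1 / 4)
    (hS : ∑ l : ZMod Nc, (clockState (T / Nc) σ (l + 1) - 2 * clockState (T / Nc) σ l
      + clockState (T / Nc) σ (l - 1)) ^ 2 ≤ 26 * (T / Nc / σ) ^ 4)
    {ξ η : ℝ → EuclideanSpace ℂ (V → Fin 2)} {S : Set ℝ} (hSf : S.Finite)
    (hξc : ContinuousOn ξ (Icc 0 T)) (hξn : ∀ t ∈ Icc 0 T, ‖ξ t‖ ≤ 11 / 10)
    (hξd : ∀ t ∈ Ioo 0 T \ S,
      HasDerivAt ξ (-Complex.I • Matrix.toEuclideanLin (H.mollified s t) (ξ t) + η t) t)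
    (hη : ∀ t ∈ Ioo 0 T \ S, ‖η t‖ ≤ 3 / 4 * H.strength * s *
      (H.strength * (mollify T s (fun _ => (1 : ℝ)) t + compress T (fun _ => (1 : ℝ)) t)))
    {m : ℕ} (hm : m < Nc) :
    ‖Matrix.toEuclideanLin (propagator (clockHamiltonian H ρ s Nc) ((m + 1 : ℕ) * (T / Nc)))
        (tens (ξ ((m + 1 : ℕ) * (T / Nc))) (prodState (shiftedClock Nc (T / Nc) σ (m + 1))))
      - Matrix.toEuclideanLin (propagator (clockHamiltonian H ρ s Nc) (m * (T / Nc)))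
        (tens (ξ (m * (T / Nc))) (prodState (shiftedClock Nc (T / Nc) σ m)))‖
      ≤ ∫ t in (m * (T / Nc))..((m + 1 : ℕ) * (T / Nc)),
        errorRate (Fintype.card V) Nc H.strength T s σ t := by
  have hN : (0 : ℝ) < Nc := Nat.cast_pos.mpr (NeZero.pos Nc)
  set δ := T / Nc with hδd
  have hδ : 0 < δ := by positivity
  set A := clockHamiltonian H ρ s Nc with hA
  have hAH : A.IsHermitian := isHermitian_clockHamiltonian H ρ s
  set a := shiftedClock Nc δ σ m with ha
  have ha0 : ∀ l, 0 ≤ a l := fun l => clockState_nonneg _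
  have ha1 : ∑ l, a l ^ 2 = 1 := sum_shiftedClock_sq _ _ _
  have hS' : ∑ l, (a (l + 1) - 2 * a l + a (l - 1)) ^ 2 ≤ 26 * (δ / σ) ^ 4 := by
    rw [← sum_comp_sub _ (m : ZMod Nc)] at hS
    refine (Finset.sum_congr rfl fun l _ => ?_).trans_le hS
    simp only [ha, shiftedClock]
    rw [show l + 1 - (m : ZMod Nc) = l - m + 1 by ring,
      show l - 1 - (m : ZMod Nc) = l - m - 1 by ring]
  have hmN : ((m + 1 : ℕ) : ℝ) * δ ≤ T := by
    have : ((m + 1 : ℕ) : ℝ) ≤ Nc := by exact_mod_cast hm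
    calc _ ≤ (Nc : ℝ) * δ := by gcongr
      _ = T := by rw [hδd]; field_simp
  have hle : (m : ℝ) * δ ≤ (m + 1 : ℕ) * δ := by push_cast; nlinarith
  have hsub : Icc ((m : ℝ) * δ) ((m + 1 : ℕ) * δ) ⊆ Icc 0 T :=
    Icc_subset_Icc (by positivity) hmN
  have hph : ∀ t ∈ Icc ((m : ℝ) * δ) ((m + 1 : ℕ) * δ), t / δ - m ∈ Icc (0 : ℝ) 1 := by
    intro t ht
    constructor
    · rw [sub_nonneg, le_div_iff₀ hδ]; exact ht.1
    · rw [sub_le_iff_le_add, div_le_iff₀ hδ]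
      have := ht.2
      push_cast at this; linarith
  have hpd : ∀ t ∈ Icc ((m : ℝ) * δ) ((m + 1 : ℕ) * δ), ∀ l,
      HasDerivAt (fun t => packet a (t / δ - m) l)
        ((packetResidue a (t / δ - m) l + (packet a (t / δ - m) (l - 1)
          - packet a (t / δ - m) (l + 1)) / 2) / δ) t := by
    intro t ht l
    have h1 : HasDerivAt (fun t : ℝ => t / δ - m) (1 / δ) t :=
      ((hasDerivAt_id t).div_const δ).sub_const _
    refine ((hasDerivAt_packet ha0 ha1 (hph t ht) l).comp t h1).congr_deriv ?_
    rw [packetResidue]; ring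
  have hstart : packet a ((m : ℝ) * δ / δ - m) = a := by
    rw [mul_div_cancel_right₀ _ hδ.ne', sub_self, packet_zero ha1]
  have hend : packet a (((m + 1 : ℕ) : ℝ) * δ / δ - m) = shiftedClock Nc δ σ (m + 1) := by
    rw [mul_div_cancel_right₀ _ hδ.ne', Nat.cast_add, add_sub_cancel_left, Nat.cast_one,
      packet_one ha1, shiftedClock_succ]
  -- The estimate is made in the Heisenberg picture: the propagator is a contraction, so the
  -- derivative of the transported path is no larger than the defect.
  have key := norm_sub_le_integral_of_deriv_le
    (f := fun t => Matrix.toEuclideanLin (propagator A t)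
      (tens (ξ t) (prodState (packet a (t / δ - m)))))
    (f' := fun t => Matrix.toEuclideanLin (propagator A t * (Complex.I • A))
        (tens (ξ t) (prodState (packet a (t / δ - m))))
      + Matrix.toEuclideanLin (propagator A t)
        (tens (-Complex.I • Matrix.toEuclideanLin (H.mollified s t) (ξ t) + η t)
            (prodState (packet a (t / δ - m)))
          + tens (ξ t) fun κ => ∑ v, mixedState (packet a (t / δ - m))
            (fun l => (packetResidue a (t / δ - m) l + (packet a (t / δ - m) (l - 1)
              - packet a (t / δ - m) (l + 1)) / 2) / δ) v κ))
    (β := errorRate (Fintype.card V) Nc H.strength T s σ) hle hSf ?_ ?_ ?_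
    (intervalIntegrable_errorRate _ _ _ _ hT hs _ _)
  · simp only [hstart, hend] at key
    exact key
  · refine continuousOn_toEuclideanLin (fun t _ =>
      (hasDerivAt_propagator A t).continuousAt.continuousWithinAt)
      (continuousOn_tens (hξc.mono hsub) fun l t ht => (hpd t ht l).continuousAt.continuousWithinAt)
  · intro t ht
    have hti := Ioo_subset_Icc_self ht.1
    have ht0 : t ∈ Ioo 0 T \ S :=
      ⟨⟨lt_of_le_of_lt (by positivity) ht.1.1, ht.1.2.trans_le hmN⟩, ht.2⟩
    exact hasDerivAt_toEuclideanLin (hasDerivAt_propagator A t)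
      (hasDerivAt_tens (hξd t ht0) (hpd t hti))
  · intro t ht
    have hti := Ioo_subset_Icc_self ht.1
    have ht0 : t ∈ Ioo 0 T \ S :=
      ⟨⟨lt_of_le_of_lt (by positivity) ht.1.1, ht.1.2.trans_le hmN⟩, ht.2⟩
    have hph' := hph t hti
    rw [toEuclideanLin_mul_apply, ← map_add]
    refine (norm_toEuclideanLin_le _ _).trans ?_
    have hd := clock_defect ρ (fun x => mollify T s (H.term x)) hδ.ne' t (ξ t) (η t)
      (packet a (t / δ - m)) (packetResidue a (t / δ - m))
    have hA' : A = momentum V Nc δ + controlled Nc δ ρ fun x => mollify T s (H.term x) := rfl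
    rw [← hA'] at hd
    have hn := norm_defect_le ρ (fun x => mollify T s (H.term x)) hδ t (ξ t) (η t)
      (sum_packet_sq ha0 ha1 hph') (sum_packetResidue_mul_packet ha0 ha1 hph')
    rw [← hd] at hn
    have hξ := hξn t (Ioo_subset_Icc_self ht0.1)
    have hres := sum_packetResidue_sq_le ha0 ha1 hS' hph'
    have hctrl : ∑ x, √(∑ l : ZMod Nc, ‖mollify T s (H.term x) (l.val * δ)
          - mollify T s (H.term x) t‖ ^ 2 * packet a (t / δ - m) l ^ 2)
        ≤ H.strength * min (15 / 4 * σ * bump s 0) 4 := by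
      rw [TimeDepHamiltonian.strength, Finset.sum_mul]
      refine Finset.sum_le_sum fun x _ => ?_
      have := sqrt_control_le hM hT hs hs' hσ hr (H.piecewiseContinuous x) (H.norm_term_le x) hm hph'
      rwa [show (m + (t / δ - m)) * (T / Nc) = t by
        rw [← hδd]; field_simp; ring] at this
    have hc0 : 0 ≤ ∑ x, √(∑ l : ZMod Nc, ‖mollify T s (H.term x) (l.val * δ)
          - mollify T s (H.term x) t‖ ^ 2 * packet a (t / δ - m) l ^ 2) :=
      Finset.sum_nonneg fun _ _ => Real.sqrt_nonneg _
    calc _ ≤ 1 * _ := mul_le_mul_of_nonneg_right (norm_propagator_le hAH t) (norm_nonneg _)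
      _ ≤ _ := by
        rw [one_mul]
        refine hn.trans ?_
        rw [errorRate]
        refine add_le_add (add_le_add ?_ (hη t ht0)) ?_
        · exact mul_le_mul hξ hctrl hc0 (by norm_num)
        · gcongr
          linarith

/-- The error of the clock construction in the regime where the clock states are well resolved and
do not reach around the ring. -/
theorem clockError_le_of_resolved (hT : 0 < T) (hs : 0 < s) (hs' : s ≤ T / 4) (hσ : 0 < σ)
    (hM : Nc = 2 * M) (H : TimeDepHamiltonian G T) (ρ : G.edgeSet → V)
    {U : ℝ → Op V (Fin 2)} (hU : IsEvolution T H.total U)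
    (hr : T / Nc / σ ≤ 1 / 4)
    (hS : ∑ l : ZMod Nc, (clockState (T / Nc) σ (l + 1) - 2 * clockState (T / Nc) σ l
      + clockState (T / Nc) σ (l - 1)) ^ 2 ≤ 26 * (T / Nc / σ) ^ 4)
    (hh : (3 / 4 * H.strength * s) ^ 2 ≤ 21 / 100)
    (ψ : EuclideanSpace ℂ (V → Fin 2)) (hψ : ‖ψ‖ = 1) :
    clockError Nc T σ (U T) (clockHamiltonian H ρ s Nc) ψ
      ≤ 11 / 10 * (H.strength * min (15 / 4 * σ * bump s 0) 4) * T + 3 / 2 * H.strength ^ 2 * s * T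
        + T * ((T / Nc)⁻¹ * (11 / 10 * √(Fintype.card V * (13 * (T / Nc / σ) ^ 4)))) := by
  obtain ⟨W, R, S, hSf, hWc, hW0, hWT, hWn, hWd⟩ := hU.exists_corrected hT hs hs'
  set A := clockHamiltonian H ρ s Nc with hA
  have hAH : A.IsHermitian := isHermitian_clockHamiltonian H ρ s
  have hN : (0 : ℝ) < Nc := Nat.cast_pos.mpr (NeZero.pos Nc)
  set Z : ℕ → EuclideanSpace ℂ (V → Site Nc) := fun m =>
    Matrix.toEuclideanLin (propagator A (m * (T / Nc)))
      (tens (Matrix.toEuclideanLin (W (m * (T / Nc))) ψ)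
        (prodState (shiftedClock Nc (T / Nc) σ m))) with hZ
  have hstep : ∀ m < Nc, ‖Z (m + 1) - Z m‖ ≤ ∫ t in (m * (T / Nc))..((m + 1 : ℕ) * (T / Nc)),
      errorRate (Fintype.card V) Nc H.strength T s σ t := fun m hm =>
    norm_clock_step_le (ξ := fun t => Matrix.toEuclideanLin (W t) ψ)
      (η := fun t => Matrix.toEuclideanLin (R t) ψ) hT hs hs' hσ hM H ρ hr hS hSf
      (continuousOn_toEuclideanLin hWc continuousOn_const)
      (fun t ht => by
        refine (norm_toEuclideanLin_le _ _).trans ?_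
        rw [hψ, mul_one]
        -- The bound 1 + 21/100 on the square is (11/10)².
        have := hWn t ht
        nlinarith [norm_nonneg (W t)])
      (fun t ht => by
        refine (hasDerivAt_toEuclideanLin (hWd t ht).1 (hasDerivAt_const t ψ)).congr_deriv ?_
        rw [map_zero, add_zero, toEuclideanLin_add_apply, toEuclideanLin_smul_apply,
          toEuclideanLin_mul_apply])
      (fun t ht => by
        refine (norm_toEuclideanLin_le _ _).trans ?_
        rw [hψ, mul_one]
        exact (hWd t ht).2) hm
  have hsum : ∀ n ≤ Nc, ‖Z n - Z 0‖ ≤ ∫ t in (0 : ℝ)..(n * (T / Nc)),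
      errorRate (Fintype.card V) Nc H.strength T s σ t := by
    intro n
    induction n with
    | zero => simp
    | succ n ih =>
      intro hn
      rw [← intervalIntegral.integral_add_adjacent_intervals (b := n * (T / Nc))
        (intervalIntegrable_errorRate _ _ _ _ hT hs _ _)
        (intervalIntegrable_errorRate _ _ _ _ hT hs _ _)]
      refine (norm_sub_le_norm_sub_add_norm_sub _ (Z n) _).trans ?_
      exact (add_le_add (hstep n hn) (ih (by omega))).trans_eq (add_comm _ _)
  have hfin := hsum Nc le_rfl
  rw [mul_div_cancel₀ _ hN.ne', integral_errorRate _ _ _ _ hT hs hs'] at hfin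
  refine le_trans ?_ hfin
  have h0 : shiftedClock Nc (T / Nc) σ 0 = clockState (T / Nc) σ := by
    ext l; simp [shiftedClock]
  -- After a full turn every clock is back in its initial state.
  have hNc : shiftedClock Nc (T / Nc) σ Nc = clockState (T / Nc) σ := by
    ext l; simp [shiftedClock]
  have hZ0 : Z 0 = withClocks Nc (T / Nc) σ ψ := by
    simp only [hZ, Nat.cast_zero, zero_mul, propagator_zero, hW0, toEuclideanLin_one_apply, h0,
      withClocks_eq]
  have hZN : Z Nc = Matrix.toEuclideanLin (propagator A T)
      (withClocks Nc (T / Nc) σ (Matrix.toEuclideanLin (U T) ψ)) := by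
    simp only [hZ, mul_div_cancel₀ _ hN.ne', hWT, hNc, withClocks_eq]
  rw [clockError, ← propagator_neg]
  have e : withClocks Nc (T / Nc) σ (Matrix.toEuclideanLin (U T) ψ)
      - Matrix.toEuclideanLin (propagator A (-T)) (withClocks Nc (T / Nc) σ ψ)
      = Matrix.toEuclideanLin (propagator A (-T)) (Z Nc - Z 0) := by
    rw [map_sub, hZ0, hZN, ← toEuclideanLin_mul_apply, propagator_neg_mul,
      toEuclideanLin_one_apply]
  rw [e]
  refine (norm_toEuclideanLin_le _ _).trans ?_
  calc _ ≤ 1 * ‖Z Nc - Z 0‖ :=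
        mul_le_mul_of_nonneg_right (norm_propagator_le hAH _) (norm_nonneg _)
    _ = _ := one_mul _

/-- The error of the clock construction never exceeds two. -/
theorem clockError_le_two (hT : 0 < T) (H : TimeDepHamiltonian G T) (ρ : G.edgeSet → V)
    {U : ℝ → Op V (Fin 2)} (hU : IsEvolution T H.total U)
    (ψ : EuclideanSpace ℂ (V → Fin 2)) (hψ : ‖ψ‖ = 1) :
    clockError Nc T σ (U T) (clockHamiltonian H ρ s Nc) ψ ≤ 2 := by
  have hnorm : ∀ φ : EuclideanSpace ℂ (V → Fin 2), ‖withClocks Nc (T / Nc) σ φ‖ = ‖φ‖ := by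
    intro φ
    refine (pow_left_inj₀ (norm_nonneg _) (norm_nonneg _) two_ne_zero).mp ?_
    rw [withClocks_eq, norm_tens_sq, sum_prodState_sq (sum_clockState_sq _ _), mul_one]
  have htot : ∀ t ∈ Icc 0 T, IsSelfAdjoint (H.total t) := fun t ht => by
    rw [IsSelfAdjoint, TimeDepHamiltonian.total, star_sum]
    exact Finset.sum_congr rfl fun x _ => H.isHermitian x t ht
  have hUn : ‖U T‖ ≤ 1 := norm_le_one_of_star_mul_self (hU.star_mul_self htot ⟨hT.le, le_rfl⟩)
  have h1 : ‖withClocks Nc (T / Nc) σ (Matrix.toEuclideanLin (U T) ψ)‖ ≤ 1 := by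
    rw [hnorm]
    refine (norm_toEuclideanLin_le _ _).trans ?_
    rw [hψ, mul_one]; exact hUn
  rw [clockError, ← propagator_neg]
  have h2 : ‖Matrix.toEuclideanLin (propagator (clockHamiltonian H ρ s Nc) (-T))
      (withClocks Nc (T / Nc) σ ψ)‖ ≤ 1 := by
    refine (norm_toEuclideanLin_le _ _).trans ?_
    rw [hnorm, hψ, mul_one]
    exact norm_propagator_le (isHermitian_clockHamiltonian H ρ s) _
  exact (norm_sub_le _ _).trans (by linarith)

end path

end WWRL

namespace WWRL

open MeasureTheory Set Filter Topology

/-! ### The explicit error bound -/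

theorem exp_neg_one_gt : (0.3678 : ℝ) < Real.exp (-1) := by
  rw [Real.exp_neg, lt_inv_comm₀ (by norm_num) (Real.exp_pos 1)]
  exact Real.exp_one_lt_d9.trans (by norm_num)

theorem exp_neg_two_gt : (0.135 : ℝ) < Real.exp (-2) := by
  have h := exp_neg_one_gt
  have e : Real.exp (-2) = Real.exp (-1) * Real.exp (-1) := by rw [← Real.exp_add]; norm_num
  nlinarith

theorem exp_neg_three_halves_gt : (0.22 : ℝ) < Real.exp (-(3 / 2)) := by
  have h := exp_neg_one_gt
  have h2 := exp_neg_two_gt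
  have e : Real.exp (-(3 / 2)) * Real.exp (-(3 / 2)) = Real.exp (-2) * Real.exp (-1) := by
    rw [← Real.exp_add, ← Real.exp_add]; norm_num
  by_contra! hc
  have := mul_le_mul hc hc (Real.exp_pos _).le (by norm_num)
  nlinarith

/-- Small values of the parts of the error bound that concern the clocks alone force the clocks to
resolve the Gaussian. -/
theorem resolved_of_small {M : ℕ} {n x : ℝ} (hn : n = 2 * M) (hM : 1 ≤ M) (hx : 0 < x)
    (hB : Real.exp (-(x ^ 2 / 2)) / x + x / n < 1) (h3 : x * (x / n) < 1 / 2)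
    (h4 : n * x * Real.exp (-(x ^ 2 * (1 - 6 / n) ^ 2 / 2)) < 1) :
    2 ≤ x ∧ x / n ≤ 1 / 4 ∧ Real.exp (-(x ^ 2 / 2)) ≤ x / n / x ^ 2 := by
  have hn2 : 2 ≤ n := by rw [hn]; have : (1 : ℝ) ≤ M := by exact_mod_cast hM
                         linarith
  have hn0 : 0 < n := by linarith
  have hE1 : 1 - x ^ 2 / 2 ≤ Real.exp (-(x ^ 2 / 2)) := by
    linarith [Real.add_one_le_exp (-(x ^ 2 / 2))]
  have h3' : 2 * x ^ 2 < n := by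
    rw [← mul_div_assoc, div_lt_iff₀ hn0] at h3; nlinarith
  -- Only n = 2 has to be excluded. There `hB` together with exp(-x²/2) ≥ 1 - x²/2 gives x > 1,
  -- while `h3` gives x < 1.
  have hn4 : 4 ≤ n := by
    by_contra! hlt
    have : M = 1 := by
      have : (M : ℝ) < 2 := by linarith
      have : M < 2 := by exact_mod_cast this
      omega
    have hn' : n = 2 := by rw [hn, this]; norm_num
    subst hn'
    rw [div_add' _ _ _ hx.ne', div_lt_one hx] at hB
    nlinarith
  -- For n ≥ 4 the number 6/n is at most 3/2, so the shift by six steps in `h4` can be dropped.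
  have hsq : (1 - 6 / n) ^ 2 ≤ 1 := by
    have h6 : 6 / n ≤ 3 / 2 := by rw [div_le_iff₀ hn0]; linarith
    have : 0 < 6 / n := by positivity
    nlinarith
  have hE4 : n * x * Real.exp (-(x ^ 2 / 2)) < 1 := by
    refine lt_of_le_of_lt ?_ h4
    have : x ^ 2 * (1 - 6 / n) ^ 2 ≤ x ^ 2 := by nlinarith [sq_nonneg x]
    gcongr
  have hEx : Real.exp (-(x ^ 2 / 2)) < x := by
    have : Real.exp (-(x ^ 2 / 2)) / x < 1 := by
      have : 0 < x / n := by positivity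
      linarith
    rwa [div_lt_one hx] at this
  have hEpos := Real.exp_pos (-(x ^ 2 / 2))
  have hbase : ∀ y E : ℝ, 0 < E → x ^ 2 / 2 ≤ y → E < Real.exp (-y) → n * x * E < 1 :=
    fun y E hE hy h => by
      refine lt_of_le_of_lt ?_ hE4
      have : Real.exp (-y) ≤ Real.exp (-(x ^ 2 / 2)) := Real.exp_le_exp.mpr (by linarith)
      have : 0 < n * x := by positivity
      nlinarith
  -- For x < 2 the product n x exp(-x²/2) would reach 1. On each of three ranges of x the
  -- exponential is bounded below by a constant, and n ≥ 4 or n > 2x² supplies the rest; for small x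
  -- the bound x > 0.73 comes from `hEx`.
  have hx2 : 2 ≤ x := by
    by_contra! hlt
    rcases le_or_gt x 1.4 with h1 | h1
    · have := hbase 1 0.3678 (by norm_num) (by nlinarith) exp_neg_one_gt
      have hx7 : 0.73 < x := by nlinarith
      nlinarith
    · rcases le_or_gt x 1.7 with h2 | h2
      · have := hbase (3 / 2) 0.22 (by norm_num) (by nlinarith) exp_neg_three_halves_gt
        nlinarith
      · have := hbase 2 0.135 (by norm_num) (by nlinarith) exp_neg_two_gt
        nlinarith
  refine ⟨hx2, ?_, ?_⟩
  · have : 0 < x / n := by positivity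
    nlinarith
  · rw [div_div, le_div_iff₀ (by positivity)]
    nlinarith

section terms

variable {T δ σ : ℝ}

theorem one_le_constA (hr : 0 ≤ δ / σ) : 1 ≤ constA δ σ := by
  rw [constA, Real.one_le_sqrt]; linarith

theorem one_le_constD (hr : 0 ≤ δ / σ) : 1 ≤ constD δ σ := by
  have : (0 : ℝ) < 2 ^ (-(3 / 2) : ℝ) := by positivity
  rw [constD]; nlinarith [mul_nonneg this.le hr, sq_nonneg (δ / σ)]

theorem constB_pos (hB : 0 < constBsq T δ σ) : 0 < constB T δ σ := Real.sqrt_pos.mpr hB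

theorem constB_le_one (hT : 0 < T) (hδ : 0 ≤ δ) (hσ : 0 < σ) : constB T δ σ ≤ 1 := by
  rw [constB, Real.sqrt_le_one, constBsq]
  have : 0 ≤ σ / T * Real.exp (-(T ^ 2 / (2 * σ ^ 2))) + δ / σ := by positivity
  linarith

end terms

/-- For use with the fourth term of the bound: if it is below 2, dropping the division by B ≤ 1 and
squaring removes the root. -/
theorem sqrt_mul_exp_lt_one {n x B u : ℝ} (hn : 0 ≤ n * x) (hB : 0 < B) (hB1 : B ≤ 1)
    (h : 2 * √(n * x) * (Real.exp (-u) / B) < 2) : n * x * Real.exp (-(2 * u)) < 1 := by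
  have h1 : √(n * x) * Real.exp (-u) < 1 := by
    have : Real.exp (-u) ≤ Real.exp (-u) / B := le_div_self (Real.exp_pos _).le hB hB1
    have := mul_le_mul_of_nonneg_left this (Real.sqrt_nonneg (n * x))
    linarith
  have h0 : 0 ≤ √(n * x) * Real.exp (-u) := by positivity
  have h2 : (√(n * x) * Real.exp (-u)) ^ 2 < 1 := by nlinarith
  rw [mul_pow, Real.sq_sqrt hn, ← Real.exp_nat_mul] at h2
  convert h2 using 3
  push_cast; ring

/-- The control error is covered by the first two terms of the bound. -/
theorem control_term_le {N : ℕ} {h T s σ τ B Np : ℝ} (hN : 1 ≤ N) (hh : 0 ≤ h) (hT : 0 < T)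
    (hs : 0 < s) (hσ : 0 < σ) (hNp : 0 < Np) (hτ : τ = T / Np) (hB : 0 < B) (hB1 : B ≤ 1) :
    11 / 10 * (h * min (15 / 4 * σ * bump s 0) 4) * T
      ≤ 3 * h * T ^ 2 / (2 * Np * nu * s)
        + 4 * T * h * √(N * σ / τ) * (Real.exp (-(τ ^ 2 / (4 * σ ^ 2))) / B) := by
  have hν := nu_pos
  have hτ0 : 0 < τ := by rw [hτ]; positivity
  have hb : bump s 0 ≤ 0.37 / (2 * nu * s) := by
    rw [bump_zero hs]
    gcongr
    rw [Real.exp_neg, inv_le_comm₀ (Real.exp_pos 1) (by norm_num)]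
    exact le_trans (by norm_num) Real.exp_one_gt_d9.le
  -- At the threshold 7/4 both alternatives fit: 1.1 · (15/4) · (7/4) · 0.37 < 3 for narrow packets,
  -- and √(7/4) exp(-4/49) > 1.1 for wide ones.
  rcases le_total σ (7 / 4 * τ) with hc | hc
  · have h1 : 11 / 10 * (h * min (15 / 4 * σ * bump s 0) 4) * T
        ≤ 11 / 10 * (h * (15 / 4 * (7 / 4 * τ) * (0.37 / (2 * nu * s)))) * T := by
      gcongr
      have := bump_nonneg hs 0
      exact (min_le_left _ _).trans (by gcongr)
    have h2 : 11 / 10 * (h * (15 / 4 * (7 / 4 * τ) * (0.37 / (2 * nu * s)))) * T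
        ≤ 3 * h * T ^ 2 / (2 * Np * nu * s) := by
      have e : 11 / 10 * (h * (15 / 4 * (7 / 4 * τ) * (0.37 / (2 * nu * s)))) * T
          = (11 / 10 * (15 / 4) * (7 / 4) * 0.37 / 3) * (3 * h * T ^ 2 / (2 * Np * nu * s)) := by
        rw [hτ]; field_simp
      rw [e]
      have : 0 ≤ 3 * h * T ^ 2 / (2 * Np * nu * s) := by positivity
      nlinarith
    have : 0 ≤ 4 * T * h * √(N * σ / τ) * (Real.exp (-(τ ^ 2 / (4 * σ ^ 2))) / B) := by positivity
    linarith
  · have h1 : 11 / 10 * (h * min (15 / 4 * σ * bump s 0) 4) * T ≤ 11 / 10 * (h * 4) * T := by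
      gcongr; exact min_le_right _ _
    have h2 : (1.32 : ℝ) ≤ √(N * σ / τ) := by
      apply Real.le_sqrt_of_sq_le
      have hN' : (1 : ℝ) ≤ N := by exact_mod_cast hN
      have : 7 / 4 ≤ N * σ / τ := by
        rw [le_div_iff₀ hτ0]; nlinarith
      linarith
    have h3 : (45 / 49 : ℝ) ≤ Real.exp (-(τ ^ 2 / (4 * σ ^ 2))) / B := by
      refine le_trans ?_ (le_div_self (Real.exp_pos _).le hB hB1)
      have h5 : τ ^ 2 / (4 * σ ^ 2) ≤ 4 / 49 := by
        rw [div_le_iff₀ (by positivity)]; nlinarith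
      linarith [Real.add_one_le_exp (-(τ ^ 2 / (4 * σ ^ 2)))]
    have h4 : (1.1 : ℝ) ≤ √(N * σ / τ) * (Real.exp (-(τ ^ 2 / (4 * σ ^ 2))) / B) :=
      le_trans (by norm_num) (mul_le_mul h2 h3 (by norm_num) (by positivity))
    have h5 : 0 ≤ 4 * T * h := by positivity
    have h6 : 0 ≤ 3 * h * T ^ 2 / (2 * Np * nu * s) := by positivity
    nlinarith

/-- The dispersion error is covered by the third term of the bound. -/
theorem dispersion_term_le {N : ℕ} {T δ σ A B D : ℝ} (hT : 0 < T) (hδ : 0 < δ) (hσ : 0 < σ)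
    (hA : 1 ≤ A) (hD : 1 ≤ D) (hB : 0 < B) (hB1 : B ≤ 1) :
    T * (δ⁻¹ * (11 / 10 * √(N * (13 * (δ / σ) ^ 4)))) ≤ 4 * T * √N * (A * D / B) * (δ / σ ^ 2) := by
  have e : √(N * (13 * (δ / σ) ^ 4)) = √N * (√13 * (δ / σ) ^ 2) := by
    rw [Real.sqrt_mul (by positivity), Real.sqrt_mul (by positivity),
      show (δ / σ) ^ 4 = ((δ / σ) ^ 2) ^ 2 by ring, Real.sqrt_sq (by positivity)]
  -- With this value (11/10)√13 stays below the factor 4 of the bound.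
  have h13 : √13 ≤ 3.63 := by
    rw [Real.sqrt_le_left (by norm_num)]; norm_num
  have h1 : 1 ≤ A * D / B := by
    rw [one_le_div hB]; nlinarith
  calc T * (δ⁻¹ * (11 / 10 * √(N * (13 * (δ / σ) ^ 4))))
      = (11 / 10 * √13) * (T * √N * (δ / σ ^ 2)) := by rw [e]; field_simp
    _ ≤ (4 * (A * D / B)) * (T * √N * (δ / σ ^ 2)) := by
        refine mul_le_mul_of_nonneg_right ?_ (by positivity)
        linarith
    _ = _ := by ring

/-! ### Assembly of the explicit bound. -/

variable {V : Type u} [Fintype V] [DecidableEq V] {G : SimpleGraph V} [Fintype G.edgeSet] {T : ℝ}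

/-- Without vertices both Hamiltonians vanish. The case is split off because the general argument
uses N ≥ 1. -/
theorem clockError_eq_zero_of_isEmpty [IsEmpty V] {Nc : ℕ} [NeZero Nc] {s σ : ℝ} (hT : 0 < T)
    (H : TimeDepHamiltonian G T) (ρ : G.edgeSet → V) {U : ℝ → Op V (Fin 2)}
    (hU : IsEvolution T H.total U) (ψ : EuclideanSpace ℂ (V → Fin 2)) :
    clockError Nc T σ (U T) (clockHamiltonian H ρ s Nc) ψ = 0 := by
  have : IsEmpty G.edgeSet := ⟨fun e => isEmptyElim (ρ e)⟩
  have hH : clockHamiltonian H ρ s Nc = 0 := by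
    simp [clockHamiltonian, momentum, controlled]
  have hU1 : U T = 1 := by
    obtain ⟨hc, h0, S, hS, hd⟩ := hU
    have hc' : ∀ t ∈ Ioo 0 T \ S, HasDerivAt U 0 t := fun t ht => by
      simpa [TimeDepHamiltonian.total] using hd t ht
    have key := norm_sub_le_integral_of_deriv_le (β := fun _ => 0) hT.le hS hc hc' (by simp)
      (by simp)
    rw [intervalIntegral.integral_zero, norm_le_zero_iff, h0] at key
    exact sub_eq_zero.mp key
  rw [clockError, hH, hU1, smul_zero, NormedSpace.exp_zero, toEuclideanLin_one_apply,
    toEuclideanLin_one_apply, sub_self, norm_zero]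

theorem errorBound_nonneg {N Np Nq : ℕ} {h s σ : ℝ} (hh : 0 ≤ h) (hT : 0 < T) (hs : 0 < s)
    (hσ : 0 < σ) : 0 ≤ errorBound N h T s σ Np Nq := by
  have hν := nu_pos
  have hr : 0 ≤ T / (Np * Nq) / σ := by positivity
  have hA := one_le_constA hr
  have hD := one_le_constD hr
  have hB : 0 ≤ constB T (T / (Np * Nq)) σ := Real.sqrt_nonneg _
  rw [errorBound]
  positivity

/-- The error of the clock construction is at most the explicit bound. -/
theorem clockError_le_errorBound (hT : 0 < T) (H : TimeDepHamiltonian G T) (ρ : G.edgeSet → V)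
    {U : ℝ → Op V (Fin 2)} (hU : IsEvolution T H.total U) {s σ : ℝ} (hs : 0 < s) (hs' : s ≤ T / 4)
    {Np Nq : ℕ} [NeZero Np] [NeZero Nq] (hev : Even (Np * Nq)) (hσ : 0 < σ)
    (hB : 0 < constBsq T (T / (Np * Nq)) σ) (ψ : EuclideanSpace ℂ (V → Fin 2)) (hψ : ‖ψ‖ = 1) :
    clockError (Np * Nq) T σ (U T) (clockHamiltonian H ρ s (Np * Nq)) ψ
      ≤ errorBound (Fintype.card V) H.strength T s σ Np Nq := by
  have hν := nu_pos
  have hh := H.strength_nonneg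
  rcases isEmpty_or_nonempty V with hV | hV
  · rw [clockError_eq_zero_of_isEmpty hT H ρ hU]
    exact errorBound_nonneg hh hT hs hσ
  -- When the bound is at least 2 there is nothing to prove. Otherwise each of its nonnegative terms
  -- is below 2, and these inequalities replace any assumption on the parameters.
  rcases le_or_gt 2 (errorBound (Fintype.card V) H.strength T s σ Np Nq) with h2 | h2
  · exact (clockError_le_two hT H ρ hU ψ hψ).trans h2
  obtain ⟨M, hM⟩ := hev
  rw [← two_mul] at hM
  have hNp : (0 : ℝ) < Np := by exact_mod_cast Nat.pos_of_ne_zero (NeZero.ne Np)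
  have hNq : (0 : ℝ) < Nq := by exact_mod_cast Nat.pos_of_ne_zero (NeZero.ne Nq)
  have hcast : ((Np * Nq : ℕ) : ℝ) = Np * Nq := by push_cast; ring
  have hn0 : (0 : ℝ) < Np * Nq := by positivity
  have hnM : (Np * Nq : ℝ) = 2 * M := by rw [← hcast, hM]; push_cast; ring
  have hM1 : 1 ≤ M := by
    by_contra! hlt
    have : M = 0 := by omega
    rw [hnM, this] at hn0; simp at hn0
  have hδ : 0 < T / (Np * Nq) := by positivity
  have hr0 : 0 ≤ T / (Np * Nq) / σ := by positivity
  have hA := one_le_constA hr0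
  have hD := one_le_constD hr0
  have hB0 := constB_pos hB
  have hB1 := constB_le_one hT hδ.le hσ
  have hN1 : 1 ≤ Fintype.card V := Fintype.card_pos
  have hN1' : (1 : ℝ) ≤ Fintype.card V := by exact_mod_cast hN1
  simp only [errorBound] at h2 ⊢
  set n : ℝ := Np * Nq with hn
  set δ : ℝ := T / n with hδdef
  set A := constA δ σ
  set D := constD δ σ
  set B := constB T δ σ
  set N := Fintype.card V
  set h := H.strength
  have t1 : 0 ≤ 3 * h * T ^ 2 / (2 * Np * nu * s) := by positivity
  have t2 : 0 ≤ 4 * T * h * √(N * σ / (T / Np))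
    * (Real.exp (-((T / Np) ^ 2 / (4 * σ ^ 2))) / B) := by positivity
  have t3 : 0 ≤ 4 * T * √N * (A * D / B) * (δ / σ ^ 2) := by positivity
  have t4 : 0 ≤ 2 * √(n * T / σ) * (Real.exp (-((T - 6 * δ) ^ 2 / (4 * σ ^ 2))) / B) := by
    positivity
  have t5 : 0 ≤ 3 / 2 * h ^ 2 * s * T := by positivity
  have hx0 : 0 < T / σ := by positivity
  -- The third term is below 2, and the factor √N AD/B is at least 1.
  have hrx : T / σ * (T / σ / n) < 1 / 2 := by
    have h1 : 1 ≤ √N * (A * D / B) := by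
      have h1 : 1 ≤ √(N : ℝ) := by rw [Real.one_le_sqrt]; exact hN1'
      have h2 : 1 ≤ A * D / B := by
        rw [one_le_div hB0]
        exact hB1.trans (one_le_mul_of_one_le_of_one_le hA hD)
      exact one_le_mul_of_one_le_of_one_le h1 h2
    have e : T / σ * (T / σ / n) = T * (δ / σ ^ 2) := by rw [hδdef]; field_simp
    rw [e]
    have h3 : 4 * T * √N * (A * D / B) * (δ / σ ^ 2) < 2 := by linarith
    have h4 := mul_le_mul_of_nonneg_right h1 (show 0 ≤ T * (δ / σ ^ 2) by positivity)
    linarith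
  have hres : 2 ≤ T / σ ∧ T / σ / n ≤ 1 / 4 ∧
      Real.exp (-((T / σ) ^ 2 / 2)) ≤ T / σ / n / (T / σ) ^ 2 := by
    refine resolved_of_small hnM hM1 hx0 ?_ hrx ?_
    · have e : constBsq T δ σ = 1 - (Real.exp (-((T / σ) ^ 2 / 2)) / (T / σ) + T / σ / n) := by
        rw [constBsq, hδdef]
        congr 2
        · rw [show T ^ 2 / (2 * σ ^ 2) = (T / σ) ^ 2 / 2 by field_simp]; field_simp
        · field_simp
      rw [e] at hB; linarith
    · have h4 : 2 * √(n * T / σ) * (Real.exp (-((T - 6 * δ) ^ 2 / (4 * σ ^ 2))) / B) < 2 := by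
        linarith
      rw [mul_div_assoc] at h4
      have := sqrt_mul_exp_lt_one (by positivity) hB0 hB1 h4
      convert this using 4
      rw [hδdef]; field_simp; ring
  obtain ⟨hx2, hr4, hexp⟩ := hres
  have hrr : T / σ / n = δ / σ := by rw [hδdef]; field_simp
  rw [hrr] at hr4 hexp hrx
  have hxr : T / σ = n * (δ / σ) := by rw [← hrr]; field_simp
  -- The last term is below 2, which with s ≤ T/4 gives (hs)² < 1/3.
  have h5 : (3 / 4 * h * s) ^ 2 ≤ 21 / 100 := by
    have : h ^ 2 * s * T < 4 / 3 := by linarith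
    have h6 : h ^ 2 * s * s ≤ h ^ 2 * s * (T / 4) := by gcongr
    have e : (3 / 4 * h * s) ^ 2 = 9 / 16 * (h ^ 2 * s * s) := by ring
    linarith
  have key := clockError_le_of_resolved (Nc := Np * Nq) hT hs hs' hσ hM H ρ hU
    (by rw [hcast]; exact hr4)
    (by
      rw [hcast]
      exact sum_clockState_second_diff_sq_le hM (x := T / σ) (by rw [hcast]; exact hxr) hx2
        (by positivity) hr4 (by rw [mul_comm]; exact hrx.le) hexp) h5 ψ hψ
  rw [hcast] at key
  refine key.trans ?_
  have c1 := control_term_le (τ := T / Np) hN1 hh hT hs hσ hNp rfl hB0 hB1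
  have c2 := dispersion_term_le (N := N) hT hδ hσ hA hD hB0 hB1
  linarith

end WWRL

namespace WWRL

open MeasureTheory Set Filter Topology

/-! ### Locality of the clock Hamiltonian -/

section supported

variable {V : Type u} {α : Type} [Inhabited α] {S : Set V}

/-- A criterion on matrix entries that mentions no factor B, and so passes at once to sums, adjoints
and integrals. Conversely, B is read off by filling the sites outside S with a default value. -/
theorem supportedOn_iff {A : Op V α} : SupportedOn S A ↔
    (∀ c c', (¬ ∀ v, v ∉ S → c v = c' v) → A c c' = 0) ∧
    ∀ c c' d d', (∀ v, v ∉ S → c v = c' v) → (∀ v, v ∉ S → d v = d' v) →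
      (∀ v ∈ S, c v = d v ∧ c' v = d' v) → A c c' = A d d' := by
  classical
  constructor
  · rintro ⟨B, hB⟩
    refine ⟨fun c c' => (hB c c').2, fun c c' d d' hc hd h => ?_⟩
    rw [(hB c c').1 hc, (hB d d').1 hd]
    congr 1
    · ext v; exact (h v v.2).1
    · ext v; exact (h v v.2).2
  · rintro ⟨h0, h1⟩
    refine ⟨fun b b' => A (fun v => if h : v ∈ S then b ⟨v, h⟩ else default)
      (fun v => if h : v ∈ S then b' ⟨v, h⟩ else default), fun c c' => ⟨fun hc => ?_, h0 c c'⟩⟩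
    refine h1 _ _ _ _ hc (fun v hv => by simp [hv]) fun v hv => by simp [hv]

theorem SupportedOn.sum {ι : Type*} {s : Finset ι} {A : ι → Op V α}
    (h : ∀ i ∈ s, SupportedOn S (A i)) : SupportedOn S (∑ i ∈ s, A i) := by
  simp only [supportedOn_iff] at h ⊢
  refine ⟨fun c c' hc => ?_, fun c c' d d' hc hd hcd => ?_⟩
  · rw [Matrix.sum_apply]
    exact Finset.sum_eq_zero fun i hi => (h i hi).1 c c' hc
  · rw [Matrix.sum_apply, Matrix.sum_apply]
    exact Finset.sum_congr rfl fun i hi => (h i hi).2 c c' d d' hc hd hcd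

theorem SupportedOn.add {A B : Op V α} (hA : SupportedOn S A) (hB : SupportedOn S B) :
    SupportedOn S (A + B) := by
  rw [supportedOn_iff] at hA hB ⊢
  refine ⟨fun c c' hc => ?_, fun c c' d d' hc hd hcd => ?_⟩
  · rw [Matrix.add_apply, hA.1 c c' hc, hB.1 c c' hc, add_zero]
  · rw [Matrix.add_apply, Matrix.add_apply, hA.2 c c' d d' hc hd hcd, hB.2 c c' d d' hc hd hcd]

theorem SupportedOn.smul {R : Type*} [SMulZeroClass R ℂ] {A : Op V α} (hA : SupportedOn S A)
    (z : R) : SupportedOn S (z • A) := by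
  rw [supportedOn_iff] at hA ⊢
  refine ⟨fun c c' hc => ?_, fun c c' d d' hc hd hcd => ?_⟩
  · rw [Matrix.smul_apply, hA.1 c c' hc, smul_zero]
  · rw [Matrix.smul_apply, Matrix.smul_apply, hA.2 c c' d d' hc hd hcd]

theorem SupportedOn.conjTranspose {A : Op V α} (hA : SupportedOn S A) :
    SupportedOn S A.conjTranspose := by
  rw [supportedOn_iff] at hA ⊢
  refine ⟨fun c c' hc => ?_, fun c c' d d' hc hd hcd => ?_⟩
  · rw [Matrix.conjTranspose_apply, hA.1 c' c fun h => hc fun v hv => (h v hv).symm, star_zero]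
  · rw [Matrix.conjTranspose_apply, Matrix.conjTranspose_apply,
      hA.2 c' c d' d (fun v hv => (hc v hv).symm) (fun v hv => (hd v hv).symm)
        fun v hv => (hcd v hv).symm]

theorem supportedOn_zero : SupportedOn S (0 : Op V α) :=
  supportedOn_iff.mpr ⟨fun _ _ _ => rfl, fun _ _ _ _ _ _ _ => rfl⟩

end supported

variable {V : Type u} [Fintype V] [DecidableEq V] {S : Set V} {T : ℝ}

theorem mollify_apply {s : ℝ} {F : ℝ → Op V (Fin 2)} (hT : 0 ≤ T) (hs : 0 < s)
    (hF : PiecewiseContinuousOn F 0 T) (t : ℝ) (c c' : V → Fin 2) :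
    mollify T s F t c c' = ∫ r, (bump s (t - r) • compress T F r) c c' :=
  ((Matrix.entryLinearMap ℝ ℂ c c').toContinuousLinearMap.integral_comp_comm
    (integrable_mollify' hT hs hF t)).symm

theorem supportedOn_mollify {s : ℝ} {F : ℝ → Op V (Fin 2)} (hT : 0 ≤ T) (hs : 0 < s)
    (hF : PiecewiseContinuousOn F 0 T) (hS : ∀ t ∈ Icc 0 T, SupportedOn S (F t)) (t : ℝ) :
    SupportedOn S (mollify T s F t) := by
  have h : ∀ r, SupportedOn S (bump s (t - r) • compress T F r) := fun r => by
    refine SupportedOn.smul ?_ _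
    by_cases hr : r ∈ Icc (T / 4) (3 * T / 4)
    · rw [compress_of_mem hr]
      exact (hS _ (mem_Icc_of_compress hr)).smul _
    · rw [compress_of_notMem hr]
      exact supportedOn_zero
  simp only [supportedOn_iff] at h ⊢
  refine ⟨fun c c' hc => ?_, fun c c' d d' hc hd hcd => ?_⟩
  · rw [mollify_apply hT hs hF]
    simp only [fun r => (h r).1 c c' hc, integral_zero]
  · rw [mollify_apply hT hs hF, mollify_apply hT hs hF]
    simp only [fun r => (h r).2 c c' d d' hc hd hcd]

variable {Nc : ℕ} [NeZero Nc]

theorem supportedOn_onQubits_mul_clockProj {A : Op V (Fin 2)} (hA : SupportedOn S A) {v : V}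
    (hv : v ∈ S) (k : ZMod Nc) : SupportedOn S (onQubits Nc A * clockProj v k) := by
  rw [supportedOn_iff] at hA ⊢
  refine ⟨fun c c' hc => ?_, fun c c' d d' hc hd hcd => ?_⟩
  · rw [onQubits_mul_clockProj_apply]
    split_ifs with h
    · exact hA.1 _ _ fun h' => hc fun w hw => Prod.ext (h' w hw) (h.1 w)
    · rfl
  · rw [onQubits_mul_clockProj_apply, onQubits_mul_clockProj_apply]
    have e : (∀ w, (c w).2 = (c' w).2) ↔ ∀ w, (d w).2 = (d' w).2 := by
      refine forall_congr' fun w => ?_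
      by_cases hw : w ∈ S
      · rw [(hcd w hw).1, (hcd w hw).2]
      · simp only [hc w hw, hd w hw]
    simp only [e, (hcd v hv).1]
    rw [hA.2 (fun w => (c w).1) (fun w => (c' w).1) (fun w => (d w).1)
      (fun w => (d' w).1) (fun w hw => congrArg Prod.fst (hc w hw))
      (fun w hw => congrArg Prod.fst (hd w hw))
      fun w hw => ⟨congrArg Prod.fst (hcd w hw).1, congrArg Prod.fst (hcd w hw).2⟩]

theorem supportedOn_clockShift (v : V) : SupportedOn {v} (clockShift Nc v) := by
  have key : ∀ c c' : V → Site Nc, c = Function.update c' v ((c' v).1, (c' v).2 + 1) ↔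
      (∀ w, w ∉ ({v} : Set V) → c w = c' w) ∧ c v = ((c' v).1, (c' v).2 + 1) := fun c c' => by
    rw [Function.eq_update_iff]
    simp [and_comm]
  rw [supportedOn_iff]
  refine ⟨fun c c' hc => ?_, fun c c' d d' hc hd hcd => ?_⟩
  · exact if_neg fun h => hc ((key c c').mp h).1
  · rw [clockShift, clockShift]
    refine if_congr ?_ rfl rfl
    rw [key, key, (hcd v rfl).1, (hcd v rfl).2]
    exact and_congr_left fun _ => iff_of_true hc hd

theorem supportedOn_momentum (δ : ℝ) (v : V) : SupportedOn {v}
    ((Complex.I / (2 * δ)) • (clockShift Nc v - (clockShift Nc v).conjTranspose)) := by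
  refine SupportedOn.smul ?_ _
  rw [sub_eq_add_neg, ← neg_one_smul ℂ (Matrix.conjTranspose _)]
  exact (supportedOn_clockShift v).add ((supportedOn_clockShift v).conjTranspose.smul _)

variable {G : SimpleGraph V} [Fintype G.edgeSet]

/-- The clock Hamiltonian is a sum of Hermitian terms on the edges and the vertices. -/
theorem isLocalHamiltonian_clockHamiltonian (hT : 0 ≤ T) {s : ℝ} (hs : 0 < s)
    (H : TimeDepHamiltonian G T) {ρ : G.edgeSet → V} (hρ : ∀ e : G.edgeSet, ρ e ∈ (e : Sym2 V)) :
    IsLocalHamiltonian G (clockHamiltonian H ρ s Nc) := by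
  have hsite : ∀ x : G.edgeSet ⊕ V, Sum.elim ρ id x ∈ sites G x := by
    rintro (e | v)
    · exact hρ e
    · exact mem_singleton v
  let C : G.edgeSet ⊕ V → Op V (Site Nc) := fun x => ∑ k : ZMod Nc,
    onQubits Nc (mollify T s (H.term x) (k.val * (T / Nc))) * clockProj (Sum.elim ρ id x) k
  have hCH : ∀ x, (C x).IsHermitian := fun x =>
    isSelfAdjoint_sum _ fun k _ => isHermitian_onQubits_mul_clockProj
      (isSelfAdjoint_mollify (fun t ht => H.isHermitian x t ht) _) _ _
  have hCS : ∀ x, SupportedOn (sites G x) (C x) := fun x => SupportedOn.sum fun k _ =>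
    supportedOn_onQubits_mul_clockProj (supportedOn_mollify hT hs (H.piecewiseContinuous x)
      (H.supported x) _) (hsite x) k
  let P : V → Op V (Site Nc) := fun v => (Complex.I / (2 * (T / Nc : ℝ))) •
    (clockShift Nc v - (clockShift Nc v).conjTranspose)
  refine ⟨fun x => C x + Sum.elim (fun _ => 0) P x, fun x => ?_, ?_⟩
  · rcases x with e | v
    · simpa using ⟨hCH _, hCS _⟩
    · exact ⟨(hCH _).add (isHermitian_momentum _ v), (hCS _).add (supportedOn_momentum _ v)⟩
  · rw [Finset.sum_add_distrib, Fintype.sum_sum_type (fun x => Sum.elim (fun _ => 0) P x)]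
    simp only [Sum.elim_inl, Sum.elim_inr, Finset.sum_const_zero, zero_add]
    rw [clockHamiltonian, controlled, Finset.sum_comm, add_comm]
    rfl

end WWRL

namespace WWRL

open MeasureTheory Set Filter Topology

/-! ### Choice of the parameters -/

section parameters

variable {T σ δ p q y : ℝ}

theorem ratio_of_width (hT : 0 < T) (hp : 2 ≤ p) (hy : 4 ≤ y) (hq : 384 * y ^ 2 ≤ q)
    (hσ : σ = T / (p * y)) (hδ : δ = T / (p * q)) :
    0 < δ / σ ∧ δ / σ ≤ 1 / 384 ∧ T / σ = p * y := by
  have hy0 : 0 < y := by linarith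
  have hp0 : 0 < p := by linarith
  have hq0 : 0 < q := by nlinarith
  have e : δ / σ = y / q := by rw [hσ, hδ]; field_simp
  refine ⟨by rw [e]; positivity, ?_, by rw [hσ]; field_simp⟩
  rw [e, div_le_div_iff₀ hq0 (by norm_num)]
  nlinarith

theorem quarter_le_constBsq (hT : 0 < T) (hp : 2 ≤ p) (hy : 4 ≤ y) (hq : 384 * y ^ 2 ≤ q)
    (hσ : σ = T / (p * y)) (hδ : δ = T / (p * q)) : 1 / 4 ≤ constBsq T δ σ := by
  obtain ⟨-, hr, hx⟩ := ratio_of_width hT hp hy hq hσ hδ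
  have h1 : σ / T ≤ 1 / 8 := by
    rw [← inv_div, hx, inv_le_comm₀ (by nlinarith) (by norm_num)]
    nlinarith
  have h2 : Real.exp (-(T ^ 2 / (2 * σ ^ 2))) ≤ 1 := Real.exp_le_one_iff.mpr (by
    have : 0 ≤ T ^ 2 / (2 * σ ^ 2) := by positivity
    linarith)
  have h3 := mul_le_mul h1 h2 (Real.exp_pos _).le (by norm_num)
  rw [constBsq]; linarith

theorem constants_le (hT : 0 < T) (hp : 2 ≤ p) (hy : 4 ≤ y) (hq : 384 * y ^ 2 ≤ q)
    (hσ : σ = T / (p * y)) (hδ : δ = T / (p * q)) :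
    1 / 2 ≤ constB T δ σ ∧ constA δ σ * constD δ σ / constB T δ σ ≤ 12 := by
  obtain ⟨hr0, hr, -⟩ := ratio_of_width hT hp hy hq hσ hδ
  have hB : 1 / 2 ≤ constB T δ σ := by
    refine Real.le_sqrt_of_sq_le (le_trans (by norm_num) (quarter_le_constBsq hT hp hy hq hσ hδ))
  have hA : constA δ σ ≤ 2 := by
    rw [constA, Real.sqrt_le_left (by norm_num)]; linarith
  have hA0 : 0 ≤ constA δ σ := Real.sqrt_nonneg _
  have h2 : (2 : ℝ) ^ (-(3 / 2) : ℝ) ≤ 1 := Real.rpow_le_one_of_one_le_of_nonpos (by norm_num)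
    (by norm_num)
  have hD : constD δ σ ≤ 3 := by
    rw [constD]; nlinarith
  refine ⟨hB, ?_⟩
  rw [div_le_iff₀ (by linarith)]
  nlinarith

/-- A Gaussian beats a polynomial. -/
theorem pow_mul_exp_neg_le {u : ℝ} (hu : 75 ≤ u) :
    u ^ 2 * Real.exp (-(0.44 * u)) ≤ 1 / 200000 := by
  -- One term of the exponential series suffices: (0.44 · 75)¹⁰ · 0.44² exceeds 200000 · 12!.
  have h := Real.pow_div_factorial_le_exp (0.44 * u) (by linarith) 12
  have hfac : ((Nat.factorial 12 : ℕ) : ℝ) = 479001600 := by norm_num [Nat.factorial]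
  rw [hfac] at h
  have h10 : (0.44 * 75 : ℝ) ^ 10 ≤ (0.44 * u) ^ 10 := by gcongr
  rw [Real.exp_neg, ← div_eq_mul_inv, div_le_div_iff₀ (Real.exp_pos _) (by norm_num), one_mul]
  refine le_trans ?_ h
  rw [le_div_iff₀ (by norm_num)]
  have e : (0.44 * u) ^ 12 = (0.44 * u) ^ 10 * (0.44 ^ 2 * u ^ 2) := by ring
  rw [e]
  calc u ^ 2 * 200000 * 479001600 ≤ (0.44 * 75 : ℝ) ^ 10 * (0.44 ^ 2 * u ^ 2) := by
        have := sq_nonneg u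
        nlinarith
    _ ≤ _ := by gcongr

end parameters

/-! ### The individual terms at the chosen parameters. -/

theorem inv_scale_le {T h ε : ℝ} (hT : 0 < T) (hh : 0 < h) (hε : 0 < ε) :
    1 / min (T / 4) (ε / (3 * h ^ 2 * T)) ≤ 4 / T + 3 * h ^ 2 * T / ε := by
  have h1 : 0 < 4 / T := by positivity
  have h2 : 0 < 3 * h ^ 2 * T / ε := by positivity
  rcases min_choice (T / 4) (ε / (3 * h ^ 2 * T)) with e | e <;> rw [e, one_div_div] <;> linarith

/-- The case s = T/4 gives 1/s = 4/T, which lacks the factor (hT)²; the lower bound hT ≥ c supplies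
it at the price of 1/c². -/
theorem control_bound {T h ε c p : ℝ} (hT : 0 < T) (hh : 0 < h) (hε : 0 < ε) (hε1 : ε ≤ 1)
    (hc : 0 < c) (hch : c ≤ h * T)
    (hp : 12 / nu * (4 / c ^ 2 + 3) * (h * T) ^ 3 / ε ^ 2 ≤ p) :
    3 * h * T ^ 2 / (2 * p * nu * min (T / 4) (ε / (3 * h ^ 2 * T))) ≤ ε / 8 := by
  have hν := nu_pos
  have hp0 : 0 < p := lt_of_lt_of_le (by positivity) hp
  have h1 : 4 / T + 3 * h ^ 2 * T / ε ≤ (4 / c ^ 2 + 3) * (h * T) ^ 2 / (T * ε) := by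
    have e : (4 / c ^ 2 + 3) * (h * T) ^ 2 / (T * ε)
        = 4 * ((h * T) ^ 2 / c ^ 2) / (T * ε) + 3 * h ^ 2 * T / ε := by field_simp
    rw [e]
    gcongr ?_ + _
    have : 1 ≤ (h * T) ^ 2 / c ^ 2 := by rw [one_le_div (by positivity)]; gcongr
    gcongr
    · linarith
    · nlinarith
  have hp' := (div_le_iff₀ (by positivity)).mp hp
  have hp'' : 12 * (4 / c ^ 2 + 3) * (h * T) ^ 3 ≤ p * ε ^ 2 * nu := by
    calc 12 * (4 / c ^ 2 + 3) * (h * T) ^ 3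
        = 12 / nu * (4 / c ^ 2 + 3) * (h * T) ^ 3 * nu := by
          linear_combination (-(4 / c ^ 2 + 3) * (h * T) ^ 3) * div_mul_cancel₀ (12 : ℝ) hν.ne'
      _ ≤ p * ε ^ 2 * nu := by gcongr
  calc 3 * h * T ^ 2 / (2 * p * nu * min (T / 4) (ε / (3 * h ^ 2 * T)))
      = 3 * h * T ^ 2 / (2 * p * nu) * (1 / min (T / 4) (ε / (3 * h ^ 2 * T))) := by
        rw [div_mul_div_comm, mul_one]
    _ ≤ 3 * h * T ^ 2 / (2 * p * nu) * ((4 / c ^ 2 + 3) * (h * T) ^ 2 / (T * ε)) := by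
        exact mul_le_mul_of_nonneg_left ((inv_scale_le hT hh hε).trans h1) (by positivity)
    _ = (12 * (4 / c ^ 2 + 3) * (h * T) ^ 3) / (8 * p * nu * ε) := by field_simp; ring
    _ ≤ (p * ε ^ 2 * nu) / (8 * p * nu * ε) := by gcongr
    _ = ε / 8 := by field_simp

/-- Write w = hT√N. Since y² = 28L, the Gaussian factor exp(-y²/4) equals (ε/w)⁷. One power cancels
the prefactor 4w, and the other six, each at most 1/2, turn 8ε into ε/8. -/
theorem tail_bound {N : ℕ} {T h ε y p B L : ℝ} (hT : 0 < T) (hh : 0 < h) (hε : 0 < ε) (hp : 0 < p)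
    (hN : 2 * ε ≤ h * T * √N) (hL : Real.exp L = h * T * √N / ε) (hy : 4 ≤ y) (hyL : y ^ 2 = 28 * L)
    (hB : 1 / 2 ≤ B) :
    4 * T * h * √(N * (T / (p * y)) / (T / p))
      * (Real.exp (-((T / p) ^ 2 / (4 * (T / (p * y)) ^ 2))) / B) ≤ ε / 8 := by
  have hy0 : 0 < y := by linarith
  have e1 : (T / p) ^ 2 / (4 * (T / (p * y)) ^ 2) = (7 : ℕ) * L := by
    have : (T / p) ^ 2 / (4 * (T / (p * y)) ^ 2) = y ^ 2 / 4 := by field_simp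
    rw [this, hyL]; push_cast; ring
  have hsN : 0 < √(N : ℝ) := by
    by_contra! h0
    have : √(N : ℝ) = 0 := le_antisymm h0 (Real.sqrt_nonneg _)
    rw [this] at hN; linarith
  have e2 : √(N * (T / (p * y)) / (T / p)) ≤ √N := by
    apply Real.sqrt_le_sqrt
    have : N * (T / (p * y)) / (T / p) = N / y := by field_simp
    rw [this]
    exact div_le_self (Nat.cast_nonneg N) (by linarith)
  have hw0 : 0 < h * T * √N := by positivity
  rw [e1, ← mul_neg, Real.exp_nat_mul, Real.exp_neg, hL, inv_div]
  set w := h * T * √N with hw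
  have hq : ε / w ≤ 1 / 2 := by rw [div_le_div_iff₀ hw0 two_pos]; linarith
  have hq0 : 0 < ε / w := by positivity
  calc 4 * T * h * √(N * (T / (p * y)) / (T / p)) * ((ε / w) ^ 7 / B)
      ≤ 4 * T * h * √N * ((ε / w) ^ 7 / (1 / 2)) := by gcongr
    _ = 8 * ε * (ε / w) ^ 6 := by
        have : 4 * T * h * √N = 4 * w := by rw [hw]; ring
        rw [this]; field_simp; norm_num
    _ ≤ 8 * ε * (1 / 2) ^ 6 := by gcongr
    _ = ε / 8 := by ring

/-- The constant is 10752 = 8 · 4 · 12 · 28: the share ε/8, the prefactor 4, the bound on AD/B, and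
y² = 28L. -/
theorem dispersion_bound {N : ℕ} {T ε y p q Q L : ℝ} (hT : 0 < T) (hε : 0 < ε) (hp : 0 < p)
    (hq0 : 0 < q) (hy : 4 ≤ y) (hyL : y ^ 2 = 28 * L) (hQ : Q ≤ 12)
    (hq : 10752 * √N * p * L / ε ≤ q) :
    4 * T * √N * Q * (T / (p * q) / (T / (p * y)) ^ 2) ≤ ε / 8 := by
  have hy0 : 0 < y := by linarith
  have e : T / (p * q) / (T / (p * y)) ^ 2 = p * y ^ 2 / (q * T) := by field_simp
  rw [div_le_iff₀ hε] at hq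
  calc 4 * T * √N * Q * (T / (p * q) / (T / (p * y)) ^ 2)
      ≤ 4 * T * √N * 12 * (T / (p * q) / (T / (p * y)) ^ 2) := by gcongr
    _ = (10752 * √N * p * L) / (8 * q) := by rw [e, hyL]; field_simp; ring
    _ ≤ (q * ε) / (8 * q) := by gcongr
    _ = ε / 8 := by field_simp

/-- With x = T/σ = py the Gaussian factor decays in x². All else is polynomial in x apart from
√N/ε³, which is at most exp(L)p, and L ≤ x²/100 leaves almost the whole decay to beat x⁴. -/
theorem wrap_bound {N : ℕ} {T ε y p q B L : ℝ} (hT : 0 < T) (hε : 0 < ε) (hp : 2 ≤ p)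
    (hL : 0.69 ≤ L) (hy : 4 ≤ y) (hyL : y ^ 2 = 28 * L) (hB : 1 / 2 ≤ B)
    (hNε : √N / ε ^ 3 ≤ Real.exp L * p)
    (hq : 384 * y ^ 2 ≤ q) (hq' : q ≤ 21504 * √N * p * L / ε) :
    2 * √(p * q * T / (T / (p * y)))
      * (Real.exp (-((T - 6 * (T / (p * q))) ^ 2 / (4 * (T / (p * y)) ^ 2))) / B) ≤ ε / 8 := by
  have hy0 : 0 < y := by linarith
  have hp0 : 0 < p := by linarith
  have hq0 : 0 < q := by nlinarith
  have hB0 : 0 < B := by linarith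
  set x := p * y with hx
  have hx0 : 0 < x := by positivity
  have hx75 : 75 ≤ x ^ 2 := by rw [hx, mul_pow, hyL]; nlinarith
  have e1 : (T - 6 * (T / (p * q))) ^ 2 / (4 * (T / x) ^ 2)
      = x ^ 2 * (1 - 6 / (p * q)) ^ 2 / 4 := by field_simp
  have e2 : p * q * T / (T / x) = p * q * x := by field_simp
  rw [e1, e2]
  have h6 : 6 / (p * q) ≤ 1 / 100 := by
    rw [div_le_div_iff₀ (by positivity) (by norm_num)]; nlinarith
  have h6' : 0 < 6 / (p * q) := by positivity
  have h7 : 0.9 ≤ (1 - 6 / (p * q)) ^ 2 := by nlinarith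
  have h8 : Real.exp (-(x ^ 2 * (1 - 6 / (p * q)) ^ 2 / 4)) ≤ Real.exp (-(0.225 * x ^ 2)) := by
    rw [Real.exp_le_exp]; nlinarith [sq_nonneg x]
  have h9 : p * q * x * Real.exp (-(0.45 * x ^ 2)) ≤ (ε / 32) ^ 2 := by
    have hLx : L ≤ 0.01 * x ^ 2 := by
      have : 4 ≤ p ^ 2 := by nlinarith
      rw [hx, mul_pow, hyL]; nlinarith
    have hpx : p ≤ x / 4 := by rw [hx, le_div_iff₀ (by norm_num)]; nlinarith
    calc p * q * x * Real.exp (-(0.45 * x ^ 2))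
        ≤ p * (21504 * √N * p * L / ε) * x * Real.exp (-(0.45 * x ^ 2)) := by gcongr
      _ = (√N / ε ^ 3) * (ε ^ 2 * 768 * (p ^ 2 * (28 * L))) * x
            * Real.exp (-(0.45 * x ^ 2)) := by
          field_simp; ring
      _ = (√N / ε ^ 3) * (ε ^ 2 * 768 * x ^ 2) * x * Real.exp (-(0.45 * x ^ 2)) := by
          rw [← hyL, ← mul_pow]
      _ ≤ (Real.exp (0.01 * x ^ 2) * (x / 4)) * (ε ^ 2 * 768 * x ^ 2) * x
            * Real.exp (-(0.45 * x ^ 2)) := by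
          gcongr
          exact hNε.trans (by gcongr)
      _ = 192 * ε ^ 2 * ((x ^ 2) ^ 2 * (Real.exp (0.01 * x ^ 2) * Real.exp (-(0.45 * x ^ 2)))) := by
          ring
      _ = 192 * ε ^ 2 * ((x ^ 2) ^ 2 * Real.exp (-(0.44 * x ^ 2))) := by
          rw [← Real.exp_add, show 0.01 * x ^ 2 + -(0.45 * x ^ 2) = -(0.44 * x ^ 2) by ring]
      _ ≤ 192 * ε ^ 2 * (1 / 200000) := by gcongr; exact pow_mul_exp_neg_le hx75
      _ ≤ (ε / 32) ^ 2 := by nlinarith [sq_nonneg ε]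
  have h10 : √(p * q * x) * Real.exp (-(0.225 * x ^ 2)) ≤ ε / 32 := by
    refine abs_le_of_sq_le_sq' ?_ (by positivity) |>.2
    rw [mul_pow, Real.sq_sqrt (by positivity), ← Real.exp_nat_mul,
      show ((2 : ℕ) : ℝ) * -(0.225 * x ^ 2) = -(0.45 * x ^ 2) by push_cast; ring]
    exact h9
  calc 2 * √(p * q * x) * (Real.exp (-(x ^ 2 * (1 - 6 / (p * q)) ^ 2 / 4)) / B)
      ≤ 2 * √(p * q * x) * (Real.exp (-(0.225 * x ^ 2)) / (1 / 2)) := by gcongr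
    _ = 4 * (√(p * q * x) * Real.exp (-(0.225 * x ^ 2))) := by ring
    _ ≤ 4 * (ε / 32) := by gcongr
    _ = ε / 8 := by ring

/-- Parameters for which the explicit bound is at most `ε`. -/
theorem exists_parameters (c : ℝ) (hc : 0 < c) : ∃ K : ℝ, 0 < K ∧
    ∀ (N : ℕ) (T h ε : ℝ), 0 < T → 0 < h → c ≤ h * T → 0 < ε → ε ≤ 1 → 2 * ε ≤ h * T * √N →
      ∃ (Np Nq : ℕ) (_ : NeZero Np) (_ : NeZero Nq) (σ : ℝ),
        Even (Np * Nq) ∧ 0 < σ ∧ 0 < constBsq T (T / (Np * Nq)) σ ∧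
        ((Np * Nq : ℕ) : ℝ) ≤ K * (√N * (h * T) ^ 6 / ε ^ 5 * Real.log (h * T * √N / ε)) ∧
        errorBound N h T (min (T / 4) (ε / (3 * h ^ 2 * T))) σ Np Nq ≤ ε := by
  have hν := nu_pos
  -- The first summand is what `control_bound` asks for, the second gives P ≥ 1, and the third gives
  -- aθ⁴ ≥ 1, used for the wrap-around term.
  set a : ℝ := 12 / nu * (4 / c ^ 2 + 3) + 1 / c ^ 3 + 1 / c ^ 4 with ha
  have ha0 : 0 < a := by positivity
  refine ⟨344064 * a ^ 2, by positivity, fun N T h ε hT hh hch hε hε1 hN => ?_⟩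
  set θ := h * T with hθ
  have hθ0 : 0 < θ := by positivity
  have hN1 : (1 : ℝ) ≤ √N := by
    rw [Real.one_le_sqrt]
    rcases Nat.eq_zero_or_pos N with h0 | h0
    · rw [h0, Nat.cast_zero, Real.sqrt_zero] at hN; linarith
    · exact_mod_cast h0
  have hE2 : 2 ≤ θ * √N / ε := by rw [le_div_iff₀ hε]; exact hN
  set L := Real.log (θ * √N / ε) with hLdef
  have hexpL : Real.exp L = θ * √N / ε := Real.exp_log (by linarith)
  have hL : 0.69 ≤ L := le_trans (by linarith [Real.log_two_gt_d9])
    (Real.log_le_log two_pos hE2)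
  set P := a * θ ^ 3 / ε ^ 2 with hP
  have hP1 : 1 ≤ P := by
    have h1 : 1 / c ^ 3 ≤ a := by
      have : 0 < 12 / nu * (4 / c ^ 2 + 3) + 1 / c ^ 4 := by positivity
      linarith
    rw [hP, le_div_iff₀ (by positivity), one_mul]
    calc ε ^ 2 ≤ 1 := pow_le_one₀ hε.le hε1
      _ = 1 / c ^ 3 * c ^ 3 := by field_simp
      _ ≤ a * θ ^ 3 := by gcongr
  set m := ⌈P⌉₊ with hm
  have hm1 : P ≤ m := Nat.le_ceil P
  have hm2 : (m : ℝ) < P + 1 := Nat.ceil_lt_add_one (by linarith)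
  -- The least N_q allowed by the dispersion term. As 10752 = 384 · 28, it also gives q ≥ 384y². N_p
  -- is taken as 2m, so the parity condition holds for any N_q.
  set Q := 10752 * √N * ((2 * m : ℕ) : ℝ) * L / ε with hQ
  have hp2 : (2 : ℝ) ≤ ((2 * m : ℕ) : ℝ) := by push_cast; linarith
  have hpP : P ≤ ((2 * m : ℕ) : ℝ) := by push_cast; linarith
  have hp4 : ((2 * m : ℕ) : ℝ) ≤ 4 * P := by push_cast; linarith
  have hQL : 10752 * L ≤ Q := by
    rw [hQ, le_div_iff₀ hε]
    have h1 : 1 ≤ √N * ((2 * m : ℕ) : ℝ) := one_le_mul_of_one_le_of_one_le hN1 (by linarith)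
    calc 10752 * L * ε ≤ 10752 * L * 1 := by gcongr
      _ ≤ 10752 * L * (√N * ((2 * m : ℕ) : ℝ)) := by gcongr
      _ = _ := by ring
  set k := ⌈Q⌉₊ with hk
  have hk1 : Q ≤ k := Nat.le_ceil Q
  have hk2 : (k : ℝ) < Q + 1 := Nat.ceil_lt_add_one (by linarith)
  have hm0 : 2 * m ≠ 0 := by
    intro h0; rw [h0] at hp2; norm_num at hp2
  have hk0 : k ≠ 0 := by
    intro h0; rw [h0, Nat.cast_zero] at hk1; linarith
  set p : ℝ := ((2 * m : ℕ) : ℝ) with hp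
  set q : ℝ := (k : ℝ) with hq
  have hp0 : 0 < p := by linarith
  have hq0 : 0 < q := by linarith
  set y := √(28 * L) with hy
  have hyL : y ^ 2 = 28 * L := Real.sq_sqrt (by linarith)
  have hy4 : 4 ≤ y := Real.le_sqrt_of_sq_le (by linarith)
  have hqy : 384 * y ^ 2 ≤ q := by rw [hyL]; linarith
  have hqQ : q ≤ 21504 * √N * p * L / ε := by
    have : 21504 * √N * p * L / ε = 2 * Q := by rw [hQ]; ring
    rw [this]; linarith
  obtain ⟨hB, hADB⟩ := constants_le hT hp2 hy4 hqy (σ := T / (p * y)) rfl (δ := T / (p * q)) rfl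
  refine ⟨2 * m, k, ⟨hm0⟩, ⟨hk0⟩, T / (p * y), ?_, by positivity, ?_, ?_, ?_⟩
  · rw [mul_assoc]; exact even_two_mul _
  · exact lt_of_lt_of_le (by norm_num) (quarter_le_constBsq hT hp2 hy4 hqy rfl rfl)
  · rw [Nat.cast_mul, ← hp, ← hq]
    calc p * q ≤ p * (21504 * √N * p * L / ε) := by gcongr
      _ = 21504 * √N * p ^ 2 * L / ε := by ring
      _ ≤ 21504 * √N * (4 * P) ^ 2 * L / ε := by gcongr
      _ = _ := by rw [hP]; field_simp; ring
  · have h1 : 3 * h * T ^ 2 / (2 * p * nu * min (T / 4) (ε / (3 * h ^ 2 * T))) ≤ ε / 8 := by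
      refine control_bound hT hh hε hε1 hc hch (le_trans ?_ hpP)
      rw [hP]
      gcongr
      have : 0 < 1 / c ^ 3 + 1 / c ^ 4 := by positivity
      linarith
    have h2 := tail_bound hT hh hε hp0 hN hexpL hy4 hyL hB
    have h3 := dispersion_bound hT hε hp0 hq0 hy4 hyL hADB hk1
    have hNε : √N / ε ^ 3 ≤ Real.exp L * p := by
      have h1 : 1 / c ^ 4 ≤ a := by
        have : 0 < 12 / nu * (4 / c ^ 2 + 3) + 1 / c ^ 3 := by positivity
        linarith
      have h2 : 1 ≤ a * θ ^ 4 := by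
        calc (1 : ℝ) = 1 / c ^ 4 * c ^ 4 := by field_simp
          _ ≤ a * θ ^ 4 := by gcongr
      calc √N / ε ^ 3 = √N / ε ^ 3 * 1 := by ring
        _ ≤ √N / ε ^ 3 * (a * θ ^ 4) := by gcongr
        _ = Real.exp L * P := by rw [hexpL, hP]; field_simp
        _ ≤ Real.exp L * p := by gcongr
    have h4 := wrap_bound hT hε hp2 hL hy4 hyL hB hNε hqy hqQ
    -- The choice of s gives the mollification term half of ε; the other four terms take ε/8 each.
    have h5 : 3 / 2 * h ^ 2 * min (T / 4) (ε / (3 * h ^ 2 * T)) * T ≤ ε / 2 := by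
      calc _ ≤ 3 / 2 * h ^ 2 * (ε / (3 * h ^ 2 * T)) * T := by gcongr; exact min_le_right _ _
        _ = ε / 2 := by field_simp
    simp only [errorBound]
    linarith

end WWRL

/-- First part: the explicit error bound, for all admissible parameters.
Second part: with `s = min{T/4, ε/(3h²T)}`, error at most `ε` is reached by a local time-independent
Hamiltonian with `Nc = O(√N (hT)⁶ ε⁻⁵ log(hT√N/ε))`, where the parameters depend only on
`N`, `T`, `h`, `ε`, and the constant only on a lower bound for `hT`. -/
theorem corollaryS3 :
    (∀ (V : Type u) [Fintype V] [DecidableEq V] (G : SimpleGraph V) [Fintype G.edgeSet]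
      (T : ℝ) (_ : 0 < T) (H : WWRL.TimeDepHamiltonian G T)
      (ρ : G.edgeSet → V) (_ : ∀ e : G.edgeSet, ρ e ∈ (e : Sym2 V))
      (U : ℝ → WWRL.Op V (Fin 2)) (_ : WWRL.IsEvolution T H.total U)
      (s : ℝ) (_ : 0 < s) (_ : s ≤ T / 4)
      (Np Nq : ℕ) [NeZero Np] [NeZero Nq] (_ : Even (Np * Nq))
      (σ : ℝ) (_ : 0 < σ) (_ : 0 < WWRL.constBsq T (T / (Np * Nq)) σ)
      (ψ : EuclideanSpace ℂ (V → Fin 2)) (_ : ‖ψ‖ = 1),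
      WWRL.clockError (Np * Nq) T σ (U T) (WWRL.clockHamiltonian H ρ s (Np * Nq)) ψ
        ≤ WWRL.errorBound (Fintype.card V) H.strength T s σ Np Nq)
    ∧
    (∀ c : ℝ, 0 < c → ∃ K : ℝ, 0 < K ∧
      ∀ (N : ℕ) (T h ε : ℝ), 0 < T → 0 < h → c ≤ h * T → 0 < ε → ε ≤ 1 →
        2 * ε ≤ h * T * Real.sqrt N →
      ∃ (Np Nq : ℕ) (_ : NeZero Np) (_ : NeZero Nq) (σ : ℝ),
        Even (Np * Nq) ∧ 0 < σ ∧ 0 < WWRL.constBsq T (T / (Np * Nq)) σ ∧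
        ((Np * Nq : ℕ) : ℝ)
          ≤ K * (Real.sqrt N * (h * T) ^ 6 / ε ^ 5 * Real.log (h * T * Real.sqrt N / ε)) ∧
        WWRL.errorBound N h T (min (T / 4) (ε / (3 * h ^ 2 * T))) σ Np Nq ≤ ε ∧
        ∀ (V : Type u) [Fintype V] [DecidableEq V] (G : SimpleGraph V) [Fintype G.edgeSet]
          (H : WWRL.TimeDepHamiltonian G T) (ρ : G.edgeSet → V)
          (_ : ∀ e : G.edgeSet, ρ e ∈ (e : Sym2 V)) (_ : Fintype.card V = N) (_ : H.strength = h)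
          (U : ℝ → WWRL.Op V (Fin 2)) (_ : WWRL.IsEvolution T H.total U),
          WWRL.IsLocalHamiltonian G
            (WWRL.clockHamiltonian H ρ (min (T / 4) (ε / (3 * h ^ 2 * T))) (Np * Nq)) ∧
          ∀ ψ : EuclideanSpace ℂ (V → Fin 2), ‖ψ‖ = 1 →
            WWRL.clockError (Np * Nq) T σ (U T)
              (WWRL.clockHamiltonian H ρ (min (T / 4) (ε / (3 * h ^ 2 * T))) (Np * Nq)) ψ
              ≤ ε) := by
  refine ⟨fun V _ _ G _ T hT H ρ _ U hU s hs hs' Np Nq _ _ hev σ hσ hB ψ hψ =>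
    WWRL.clockError_le_errorBound hT H ρ hU hs hs' hev hσ hB ψ hψ, fun c hc => ?_⟩
  obtain ⟨K, hK, h⟩ := WWRL.exists_parameters c hc
  refine ⟨K, hK, fun N T h' ε hT hh hch hε hε1 hN => ?_⟩
  obtain ⟨Np, Nq, _, _, σ, hev, hσ, hB, hNc, hbound⟩ := h N T h' ε hT hh hch hε hε1 hN
  have hs : 0 < min (T / 4) (ε / (3 * h' ^ 2 * T)) := lt_min (by positivity) (by positivity)
  refine ⟨Np, Nq, ‹_›, ‹_›, σ, hev, hσ, hB, hNc, hbound, ?_⟩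
  intro V _ _ G _ H ρ hρ hV hH U hU
  refine ⟨WWRL.isLocalHamiltonian_clockHamiltonian hT.le hs H hρ, fun ψ hψ => ?_⟩
  refine (WWRL.clockError_le_errorBound hT H ρ hU hs (min_le_left _ _) hev hσ hB ψ hψ).trans ?_
  rw [hV, hH]
  exact hbound
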